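/- Let $\mathcal L\subset\mathbb R^3$ be a Bravais lattice whose closed Wigner--Seitz (Voronoi) cell $Q$ around $0$ has volume $1$ and has no dipole and no quadrupole, i.e. $\int_Q x\,dx=0$ and $\int_Q x_ix_j\,dx=\frac{\delta_{ij}}3\int_Q|x|^2dx$ for all $i,j$. Put $$W(x)=\frac1{|x|}-\int_Q\frac{dy}{|x-y|}.$$ For a bounded region $C$ let $N=\#(\mathcal L\cap C)$, let $\Omega$ be the union of the cells $p+Q$, $p\in\mathcal L\cap C$, and let $$\mathcal E_{\rm Jel}(C)=\frac12\sum_{p\ne q\in\mathcal L\cap C}\frac1{|p-q|}-\sum_{p\in\mathcal L\cap C}\int_\Omega\frac{dy}{|p-y|}+\frac12\int_\Omega\int_\Omega\frac{dx\,dy}{|x-y|}$$ be the Jellium energy. The lattice state in $C$ is the symmetrized delta distribution of $N$ particles at the points of $\mathcal L\cap C$, translated by $y$ and integrated over $y\in Q$. Its indirect energy $\mathcal E_{\rm Ind}(C)$ is the expectation of $\sum_{i<j}|x_i-x_j|^{-1}$ minus the direct energy $\frac12\iint|x-y|^{-1}d\rho(x)\,d\rho(y)$ of its one-body density $\rho$.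 Below, a growing sequence of regions means $C_n=g_n(t_nD)$, where $D$ is a fixed bounded set with non-empty interior and boundary of measure zero, $t_n\to\infty$, and $g_n$ are arbitrary isometries of $\mathbb R^3$ (for instance, arbitrarily placed cubes, or balls, of size tending to infinity). Let $e_{\rm Jel}(\mathcal L)$ be the limit of $\mathcal E_{\rm Jel}(C_n)/N_n$ along the cubes $C_n=[-n/2,n/2]^3$. Then: 1. For every bounded $C$ the lattice state is a probability measure whose one-body density is equal to $1$ on $\Omega$ and $0$ elsewhere. 2. The limit $e_{\rm Jel}(\mathcal L)$ exists, and $\mathcal E_{\rm Jel}(C_n)/N_n\to e_{\rm Jel}(\mathcal L)$ for every growing sequence of regions. Moreover $W\in L^1(\mathbb R^3)$, $\sum_{x\in\mathcal L\setminus\{0\}}|W(x)|<\infty$, and $$e_{\rm Jel}(\mathcal L)=\frac12\sum_{x\in\mathcal L\setminus\{0\}}W(x)-\frac12\int_Q\frac{dy}{|y|}-\frac12\int_{\mathbb R^3}W(y)\,dy .$$ 3. For every growing sequence of regions, $$\frac{\mathcal E_{\rm Ind}(C_n)}{N_n}\longrightarrow e_{\rm Jel}(\mathcal L)+\int_{\mathbb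 R^3}W(y)\,dy .$$ 4. The shift is $$\int_{\mathbb R^3}W(y)\,dy=4\pi\lim_{k\to0}|k|^{-2}\Big(1-\int_Qe^{-ik\cdot x}dx\Big)=\frac{2\pi}3\int_Q|x|^2dx>0,$$ so the limiting indirect energy per particle is strictly larger than $e_{\rm Jel}(\mathcal L)$. 5. The body-centered cubic lattice of unit density satisfies all the assumptions, and, to within $5\cdot10^{-5}$, $e_{\rm Jel}({\rm BCC})\simeq-1.4442$ and $e_{\rm Jel}({\rm BCC})+\int W\simeq-0.9507$. -/

import Mathlib

open MeasureTheory Filter Topology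
open scoped Pointwise RealInnerProductSpace Nat ENNReal

noncomputable section

/-- Euclidean three-dimensional space. -/
abbrev E3 : Type := EuclideanSpace ℝ (Fin 3)

/-- A Bravais lattice in `ℝ³`: all integer combinations of three linearly independent vectors. -/
def IsBravaisLattice (L : Submodule ℤ E3) : Prop :=
  ∃ b : Module.Basis (Fin 3) ℝ E3, L = Submodule.span ℤ (Set.range b)

/-- The Wigner–Seitz (Voronoi) cell of the lattice point `0`. -/
def wignerSeitz (L : Submodule ℤ E3) : Set E3 :=
  {x | ∀ v ∈ L, ‖x‖ ≤ ‖x - v‖}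

/-- The Wigner–Seitz cell has no dipole moment. -/
def NoDipole (L : Submodule ℤ E3) : Prop :=
  (∫ x in wignerSeitz L, x) = 0

/-- The Wigner–Seitz cell has no quadrupole moment. -/
def NoQuadrupole (L : Submodule ℤ E3) : Prop :=
  ∀ i j : Fin 3, (∫ x in wignerSeitz L, x i * x j) =
    (if i = j then 1 else 0) / 3 * (∫ x in wignerSeitz L, ‖x‖ ^ 2)

/-- The Coulomb potential of a point charge screened by the uniform cell around it,
`W(x) = 1/|x| - ∫_Q dy/|x-y|`. -/
def screenedCoulomb (L : Submodule ℤ E3) (x : E3) : ℝ :=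
  1 / ‖x‖ - (∫ y in wignerSeitz L, 1 / ‖x - y‖)

/-- The Jellium energy of unit point charges at the points of `S` in a background of opposite
charge with density one in `Ω`. -/
def jelliumEnergy (S : Finset E3) (Ω : Set E3) : ℝ :=
  1 / 2 * (∑ x ∈ S, ∑ y ∈ S with y ≠ x, 1 / ‖x - y‖)
    - (∑ x ∈ S, ∫ y in Ω, 1 / ‖x - y‖)
    + 1 / 2 * (∫ x in Ω, ∫ y in Ω, 1 / ‖x - y‖)

/-- The one-body density (as a measure) of an `N`-particle probability distribution. -/
def oneBodyDensity {N : ℕ} (P : Measure (Fin N → E3)) : Measure E3 :=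
  ∑ i, P.map (fun x => x i)

/-- The direct Coulomb energy of a charge distribution. -/
def directEnergy (ρ : Measure E3) : ℝ :=
  1 / 2 * (∫ x, (∫ y, 1 / ‖x - y‖ ∂ρ) ∂ρ)

/-- The indirect energy of an `N`-particle probability distribution: the expectation of the
interparticle Coulomb energy minus the direct energy of the one-body density. -/
def indirectEnergy {N : ℕ} (P : Measure (Fin N → E3)) : ℝ :=
  (∫ x, (1 / 2 * (∑ i, ∑ j with j ≠ i, 1 / ‖x i - x j‖)) ∂P) - directEnergy (oneBodyDensity P)

open Classical in
/-- The finite set of lattice points in a region `C` (only used when `C` is bounded). -/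
def latticePoints (L : Submodule ℤ E3) (C : Set E3) : Finset E3 :=
  if h : ((L : Set E3) ∩ C).Finite then h.toFinset else ∅

/-- The union of the cells centered at the lattice points in `C`. -/
def cellUnion (L : Submodule ℤ E3) (C : Set E3) : Set E3 :=
  ⋃ p ∈ latticePoints L C, p +ᵥ wignerSeitz L

open Classical in
/-- The symmetrized delta distribution of the particles at the points of `S`, translated by a
vector that is integrated over the cell `Q` with respect to Lebesgue measure. -/
def translatedState (S : Finset E3) (Q : Set E3) : Measure (Fin S.card → E3) :=
  ((S.card ! : ℝ≥0∞))⁻¹ •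
    ∑ σ : Fin S.card ≃ S, (volume.restrict Q).map (fun (y : E3) i => (σ i : E3) + y)

/-- The lattice state: the particles sit at the lattice points in `C`, and the configuration is
averaged over translations in the Wigner–Seitz cell. -/
def latticeState (L : Submodule ℤ E3) (C : Set E3) :
    Measure (Fin (latticePoints L C).card → E3) :=
  translatedState (latticePoints L C) (wignerSeitz L)

/-- Jellium energy per particle of the lattice points in `C`, with the union of their cells as
background. -/
def jelliumPerParticle (L : Submodule ℤ E3) (C : Set E3) : ℝ :=
  jelliumEnergy (latticePoints L C) (cellUnion L C) / (latticePoints L C).card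

/-- Indirect energy per particle of the lattice state in `C`. -/
def indirectPerParticle (L : Submodule ℤ E3) (C : Set E3) : ℝ :=
  indirectEnergy (latticeState L C) / (latticePoints L C).card

/-- The cube of side length `r` centered at the origin. -/
def cube (r : ℝ) : Set E3 := {x | ∀ i, |x i| ≤ r / 2}

/-- The Jellium energy per particle of the infinite lattice, the thermodynamic limit along
growing cubes. -/
def eJel (L : Submodule ℤ E3) : ℝ :=
  limUnder atTop (fun n : ℕ => jelliumPerParticle L (cube n))

/-- A sequence of growing copies of a fixed shape `D`, each dilated and then moved by an arbitrary
isometry of space. The shape is bounded, has an interior point, and its boundary is a null set;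
for `D = cube 1` one gets cubes of arbitrary position and orientation. -/
structure IsGrowingSequence (C : ℕ → Set E3) (D : Set E3) : Prop where
  isBounded : Bornology.IsBounded D
  nonempty_interior : (interior D).Nonempty
  frontier_null : volume (frontier D) = 0
  exists_dilation : ∃ (t : ℕ → ℝ) (g : ℕ → (E3 ≃ᵢ E3)),
    Tendsto t atTop atTop ∧ ∀ n, C n = g n '' (t n • D)

/-- The body-centered cubic lattice with one point per unit volume. -/
def bcc : Submodule ℤ E3 :=
  Submodule.span ℤ (Set.range fun i : Fin 3 =>
    (4 : ℝ) ^ (-(1 / 3) : ℝ) • (![!₂[-1, 1, 1], !₂[1, -1, 1], !₂[1, 1, -1]] i : E3))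

end

/-! ### Geometry of the Wigner–Seitz cell -/

/-! Both energies are double sums over lattice points `p`, `q` of a function of `p - q`
(`jelliumEnergy_eq_sum`, `indirectEnergy_latticeState`). With `W` the screened potential, the pair
function is `(W(z) - ∫_Q W(z + x) dx) / 2` for the Jellium energy and `(W(z) + ∫_Q W(z + x) dx) / 2`
for the indirect energy: averaging over translations leaves the point-point repulsion unchanged but
smears the one-body density into cells. The convention `1 / ‖0‖ = 0` puts the self-energies on the
diagonal.

A cell without dipole and quadrupole has the potential of a point charge up to order `‖x‖⁻⁴`, so `W`
is integrable and summable over the lattice (`exists_abs_screenedCoulomb_le`). For a summable pair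
function the double sum per particle converges to the lattice sum, because a fixed translation moves
only a vanishing fraction of the points out of a growing region
(`IsGrowingSequence.tendsto_pair_sum`). The cells tile space, so the cell averages of `W` add up to
`∫ W`. The two limits are therefore half of `∑ W - ∫ W` and half of `∑ W + ∫ W`, and they differ by
`∫ W`.

To compute `∫ W`, the integrand is multiplied by a wide Gaussian, which allows the two parts of `W`
to be integrated separately. The result compares the potential of the Gaussian at the origin with
its average over `Q`; near the origin this potential drops by `2π‖y‖²/3` to leading order
(`abs_gaussianPotential_sub_le`, `integral_screenedCoulomb`). The Fourier form of the shift is the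
second-order Taylor expansion of the exponential.

For the body-centered cubic lattice, reflections and coordinate permutations give the moment
condition, and the cell is an explicit truncated octahedron whose second moment is elementary. The
Jellium energy comes from Ewald's method: the Coulomb kernel is a superposition of Gaussians, and
for each Gaussian the lattice sum is a theta function (`eJel_eq_integral`). Cubes of Jacobi theta
constants and their inversion formulas reduce it to rapidly convergent exponentials, which are
enclosed by rational arithmetic (`eJel_bcc_mem`). -/

lemma IsBravaisLattice.discreteTopology {L : Submodule ℤ E3} (hL : IsBravaisLattice L) :
    DiscreteTopology L := by
  obtain ⟨b, rfl⟩ := hL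
  infer_instance

lemma IsBravaisLattice.isZLattice {L : Submodule ℤ E3} [DiscreteTopology L]
    (hL : IsBravaisLattice L) : IsZLattice ℝ L := by
  obtain ⟨b, rfl⟩ := hL
  infer_instance

lemma IsBravaisLattice.countable {L : Submodule ℤ E3} (hL : IsBravaisLattice L) :
    Countable L := by
  have := hL.discreteTopology
  have := hL.isZLattice
  infer_instance

lemma IsBravaisLattice.finite_inter {L : Submodule ℤ E3} (hL : IsBravaisLattice L) {C : Set E3}
    (hC : Bornology.IsBounded C) : ((L : Set E3) ∩ C).Finite := by
  obtain ⟨b, rfl⟩ := hL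
  rw [Set.inter_comm]
  exact ZSpan.setFinite_inter b hC

lemma mem_latticePoints {L : Submodule ℤ E3} (hL : IsBravaisLattice L) {C : Set E3}
    (hC : Bornology.IsBounded C) {x : E3} : x ∈ latticePoints L C ↔ x ∈ L ∧ x ∈ C := by
  simp [latticePoints, hL.finite_inter hC]

lemma wignerSeitz_eq_iInter (L : Submodule ℤ E3) :
    wignerSeitz L = ⋂ v ∈ L, {x | ‖x‖ ≤ ‖x - v‖} := by
  ext x; simp [wignerSeitz]

lemma isClosed_wignerSeitz (L : Submodule ℤ E3) : IsClosed (wignerSeitz L) := by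
  rw [wignerSeitz_eq_iInter]
  exact isClosed_biInter fun v _ => isClosed_le (by fun_prop) (by fun_prop)

lemma measurableSet_wignerSeitz (L : Submodule ℤ E3) : MeasurableSet (wignerSeitz L) :=
  (isClosed_wignerSeitz L).measurableSet

lemma neg_mem_wignerSeitz {L : Submodule ℤ E3} {x : E3} (hx : x ∈ wignerSeitz L) :
    -x ∈ wignerSeitz L := fun v hv => by
  have h := hx (-v) (L.neg_mem hv)
  rwa [norm_neg, show -x - v = -(x - -v) by abel, norm_neg]

lemma neg_wignerSeitz (L : Submodule ℤ E3) : -wignerSeitz L = wignerSeitz L := by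
  ext x
  exact ⟨fun h => by simpa using neg_mem_wignerSeitz h, fun h => neg_mem_wignerSeitz h⟩

lemma IsBravaisLattice.exists_dist_le {L : Submodule ℤ E3} (hL : IsBravaisLattice L) :
    ∃ r : ℝ, 0 < r ∧ ∀ x : E3, ∃ v ∈ L, ‖x - v‖ ≤ r := by
  obtain ⟨b, rfl⟩ := hL
  refine ⟨1 + ∑ i, ‖b i‖, by positivity, fun x => ⟨ZSpan.floor b x, (ZSpan.floor b x).2, ?_⟩⟩
  have := ZSpan.norm_fract_le b x
  rw [ZSpan.fract_apply] at this
  linarith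

lemma IsBravaisLattice.exists_norm_le_of_mem_wignerSeitz {L : Submodule ℤ E3}
    (hL : IsBravaisLattice L) : ∃ r : ℝ, 0 < r ∧ ∀ x ∈ wignerSeitz L, ‖x‖ ≤ r := by
  obtain ⟨r, hr, h⟩ := hL.exists_dist_le
  refine ⟨r, hr, fun x hx => ?_⟩
  obtain ⟨v, hv, hxv⟩ := h x
  exact (hx v hv).trans hxv

lemma IsBravaisLattice.isBounded_wignerSeitz {L : Submodule ℤ E3} (hL : IsBravaisLattice L) :
    Bornology.IsBounded (wignerSeitz L) := by
  obtain ⟨r, -, h⟩ := hL.exists_norm_le_of_mem_wignerSeitz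
  exact isBounded_iff_forall_norm_le.2 ⟨r, h⟩

lemma IsBravaisLattice.isCompact_wignerSeitz {L : Submodule ℤ E3} (hL : IsBravaisLattice L) :
    IsCompact (wignerSeitz L) :=
  Metric.isCompact_of_isClosed_isBounded (isClosed_wignerSeitz L) hL.isBounded_wignerSeitz

/-- A nearest lattice point does the job. It exists because only finitely many lattice points lie in
a ball of the covering radius, and those outside it cannot compete. -/
lemma IsBravaisLattice.exists_sub_mem_wignerSeitz {L : Submodule ℤ E3} (hL : IsBravaisLattice L)
    (x : E3) : ∃ v ∈ L, x - v ∈ wignerSeitz L := by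
  obtain ⟨r, hr, h⟩ := hL.exists_dist_le
  obtain ⟨v₀, hv₀, hxv₀⟩ := h x
  have hfin := hL.finite_inter (Metric.isBounded_closedBall (x := x) (r := r))
  obtain ⟨v, hv, hmin⟩ := hfin.toFinset.exists_min_image (fun v => ‖x - v‖)
    ⟨v₀, by simpa [hv₀, dist_eq_norm, norm_sub_rev] using hxv₀⟩
  simp only [Set.Finite.mem_toFinset, Set.mem_inter_iff, SetLike.mem_coe,
    Metric.mem_closedBall, dist_eq_norm] at hv hmin
  refine ⟨v, hv.1, fun w hw => ?_⟩
  by_cases hwr : ‖v + w - x‖ ≤ r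
  · simpa [sub_sub] using hmin (v + w) ⟨L.add_mem hv.1 hw, hwr⟩
  · have h2 : ‖v + w - x‖ = ‖x - v - w‖ := by
      rw [norm_sub_rev]; congr 1; abel
    have h3 := hv.2
    rw [norm_sub_rev] at h3
    rw [← h2]; linarith

lemma volume_bisector_eq_zero {v w : E3} (h : v ≠ w) :
    volume {x : E3 | ‖x - v‖ = ‖x - w‖} = 0 := by
  have h1 : {x : E3 | ‖x - v‖ = ‖x - w‖} = (AffineSubspace.perpBisector v w : Set E3) := by
    ext x
    rw [SetLike.mem_coe, AffineSubspace.mem_perpBisector_iff_dist_eq, dist_eq_norm, dist_eq_norm]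
    rfl
  rw [h1]
  refine Measure.addHaar_affineSubspace _ _ fun htop => ?_
  have : v ∈ AffineSubspace.perpBisector v w := htop ▸ AffineSubspace.mem_top ℝ E3 v
  rw [AffineSubspace.mem_perpBisector_iff_dist_eq, dist_self, eq_comm, dist_eq_zero] at this
  exact h this

/-- A common point of two cells is equidistant from both centers, hence lies in the bisector plane.
-/
lemma aedisjoint_vadd_wignerSeitz {L : Submodule ℤ E3} {v w : E3} (hv : v ∈ L) (hw : w ∈ L)
    (h : v ≠ w) : AEDisjoint volume (v +ᵥ wignerSeitz L) (w +ᵥ wignerSeitz L) := by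
  refine measure_mono_null ?_ (volume_bisector_eq_zero h)
  rintro x ⟨h1, h2⟩
  rw [Set.mem_vadd_set_iff_neg_vadd_mem, vadd_eq_add, neg_add_eq_sub] at h1 h2
  have h3 := h1 (w - v) (L.sub_mem hw hv)
  have h4 := h2 (v - w) (L.sub_mem hv hw)
  rw [show x - v - (w - v) = x - w by abel] at h3
  rw [show x - w - (v - w) = x - v by abel] at h4
  exact le_antisymm h3 h4

lemma IsBravaisLattice.isAddFundamentalDomain_wignerSeitz {L : Submodule ℤ E3}
    (hL : IsBravaisLattice L) : IsAddFundamentalDomain L (wignerSeitz L) (volume : Measure E3) where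
  nullMeasurableSet := (measurableSet_wignerSeitz L).nullMeasurableSet
  ae_covers := .of_forall fun x => by
    obtain ⟨v, hv, hx⟩ := hL.exists_sub_mem_wignerSeitz x
    refine ⟨⟨-v, L.neg_mem hv⟩, ?_⟩
    rwa [Submodule.vadd_def, vadd_eq_add, neg_add_eq_sub]
  aedisjoint v w h := aedisjoint_vadd_wignerSeitz v.2 w.2 fun h' => h (Subtype.ext h')

lemma cell_restrict_eq_map (L : Submodule ℤ E3) (p : E3) :
    volume.restrict (p +ᵥ wignerSeitz L) =
      (volume.restrict (wignerSeitz L)).map (fun y => p + y) := by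
  have h := (measurePreserving_add_left (volume : Measure E3) p).restrict_image_emb
    (measurableEmbedding_addLeft p) (wignerSeitz L)
  exact h.map_eq.symm

lemma volume_restrict_cellUnion {L : Submodule ℤ E3} (hL : IsBravaisLattice L) {C : Set E3}
    (hC : Bornology.IsBounded C) :
    volume.restrict (cellUnion L C) =
      ∑ p ∈ latticePoints L C, (volume.restrict (wignerSeitz L)).map (fun y => p + y) := by
  have h : cellUnion L C = ⋃ p : latticePoints L C, ((p : E3) +ᵥ wignerSeitz L) := by
    rw [cellUnion, Set.iUnion_subtype]
  rw [h, Measure.restrict_iUnion_ae, Measure.sum_fintype, 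
    ← Finset.sum_coe_sort (latticePoints L C)
      (fun p => (volume.restrict (wignerSeitz L)).map (fun y => p + y))]
  · exact Finset.sum_congr rfl fun p _ => cell_restrict_eq_map L p
  · intro p q hpq
    exact aedisjoint_vadd_wignerSeitz ((mem_latticePoints hL hC).1 p.2).1
      ((mem_latticePoints hL hC).1 q.2).1 fun h' => hpq (Subtype.ext h')
  · exact fun p => ((measurableSet_wignerSeitz L).const_vadd _).nullMeasurableSet

/-- Unfolding over the tiling by cells. This is what turns lattice sums of cell averages into
integrals over space, both for `W` and for the Gaussians of Ewald's method. -/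
lemma IsBravaisLattice.hasSum_wignerSeitz {L : Submodule ℤ E3} (hL : IsBravaisLattice L)
    {f : E3 → ℝ} (hf : Integrable f) :
    HasSum (fun z : L => ∫ x in wignerSeitz L, f (z + x)) (∫ x, f x) := by
  have := hL.countable
  have : VAddInvariantMeasure L E3 volume :=
    inferInstanceAs (VAddInvariantMeasure L.toAddSubgroup E3 volume)
  have hfd := hL.isAddFundamentalDomain_wignerSeitz
  have h1 : ∀ z : L, (∫ x in (z +ᵥ wignerSeitz L), f x) = ∫ x in wignerSeitz L, f (z + x) := by
    intro z
    have := cell_restrict_eq_map L z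
    rw [show (z +ᵥ wignerSeitz L) = ((z : E3) +ᵥ wignerSeitz L) from rfl, this,
      (measurableEmbedding_addLeft (z : E3)).integral_map]
  simp_rw [← h1]
  have h2 := hasSum_integral_measure (μ := fun z : L => volume.restrict (z +ᵥ wignerSeitz L))
    (f := f) (by rwa [hfd.sum_restrict])
  rwa [hfd.sum_restrict] at h2

lemma volume_wignerSeitz_lt_top {L : Submodule ℤ E3} (hL : IsBravaisLattice L) :
    volume (wignerSeitz L) < ⊤ := hL.isBounded_wignerSeitz.measure_lt_top

lemma setIntegral_wignerSeitz_neg (L : Submodule ℤ E3) {F : Type*} [NormedAddCommGroup F]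
    [NormedSpace ℝ F] (f : E3 → F) :
    ∫ x in wignerSeitz L, f (-x) = ∫ x in wignerSeitz L, f x := by
  have h := (Measure.measurePreserving_neg (volume : Measure E3)).setIntegral_preimage_emb
    (MeasurableEquiv.neg E3).measurableEmbedding f (wignerSeitz L)
  rwa [show Neg.neg ⁻¹' wignerSeitz L = wignerSeitz L from neg_wignerSeitz L] at h

/-! ### The Coulomb kernel -/

lemma integrableOn_coulomb_ball : IntegrableOn (fun x : E3 => 1 / ‖x‖) (Metric.ball 0 1) := by
  -- In polar coordinates the Jacobian `r ^ 2` absorbs the singularity and leaves `r` on `(0, 1)`.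
  rw [integrableOn_fun_norm_addHaar (volume : Measure E3) (f := fun r : ℝ => 1 / r)]
  have h : IntegrableOn (fun y : ℝ => y) (Set.Ioo 0 1) :=
    (continuous_id.integrableOn_Icc (a := (0 : ℝ)) (b := 1)).mono_set Set.Ioo_subset_Icc_self
  refine h.congr_fun (fun y hy => ?_) measurableSet_Ioo
  have : y ≠ 0 := hy.1.ne'
  simp only [finrank_euclideanSpace, Fintype.card_fin, smul_eq_mul]
  field_simp

/-- The Coulomb energy of a unit ball of charge with its center. -/
noncomputable def coulombBall : ℝ := ∫ x in Metric.ball (0 : E3) 1, 1 / ‖x‖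

/-- Splitting off the integrable singularity bounds the potential of a set of finite volume
uniformly in space, wherever the set lies. -/
lemma coulomb_le_indicator (x : E3) :
    1 / ‖x‖ ≤ (Metric.ball (0 : E3) 1).indicator (fun x => 1 / ‖x‖) x + 1 := by
  by_cases hx : x ∈ Metric.ball (0 : E3) 1
  · rw [Set.indicator_of_mem hx]; linarith
  · rw [Set.indicator_of_notMem hx, zero_add]
    have : 1 ≤ ‖x‖ := by simpa using hx
    exact (div_le_one (by linarith)).2 this

lemma integrable_indicator_coulomb :
    Integrable ((Metric.ball (0 : E3) 1).indicator (fun x => 1 / ‖x‖)) :=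
  (integrable_indicator_iff Metric.isOpen_ball.measurableSet).2 integrableOn_coulomb_ball

lemma measurable_coulomb : Measurable fun x : E3 => 1 / ‖x‖ :=
  measurable_const.div measurable_norm

lemma integrableOn_coulomb {A : Set E3} (hA : volume A < ⊤) (x : E3) :
    IntegrableOn (fun y => 1 / ‖x - y‖) A := by
  have : IsFiniteMeasure (volume.restrict A) := ⟨by simpa using hA⟩
  have h1 : Integrable (fun y => (Metric.ball (0 : E3) 1).indicator (fun x => 1 / ‖x‖) (x - y) + 1)
      (volume.restrict A) :=
    (integrable_indicator_coulomb.comp_sub_left x).restrict.add (integrable_const _)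
  refine h1.mono' (measurable_coulomb.comp (measurable_const.sub measurable_id)).aestronglyMeasurable
    (.of_forall fun y => ?_)
  rw [Real.norm_of_nonneg (by positivity)]
  exact coulomb_le_indicator _

/-- The Coulomb potential of a uniformly charged set. -/
noncomputable def uniformPotential (A : Set E3) (x : E3) : ℝ := ∫ y in A, 1 / ‖x - y‖

lemma uniformPotential_nonneg (A : Set E3) (x : E3) : 0 ≤ uniformPotential A x :=
  integral_nonneg fun y => by positivity

lemma uniformPotential_le {A : Set E3} (hA : volume A < ⊤) (x : E3) :
    uniformPotential A x ≤ coulombBall + volume.real A := by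
  have : IsFiniteMeasure (volume.restrict A) := ⟨by simpa using hA⟩
  have h0 := integrable_indicator_coulomb.comp_sub_left x
  calc uniformPotential A x
      ≤ ∫ y in A, ((Metric.ball (0 : E3) 1).indicator (fun x => 1 / ‖x‖) (x - y) + 1) :=
        integral_mono (integrableOn_coulomb hA x) (h0.restrict.add (integrable_const _))
          fun y => coulomb_le_indicator _
    _ = (∫ y in A, (Metric.ball (0 : E3) 1).indicator (fun x => 1 / ‖x‖) (x - y))
          + volume.real A := by
        rw [integral_add h0.restrict (integrable_const _)]; simp
    _ ≤ (∫ y, (Metric.ball (0 : E3) 1).indicator (fun x => 1 / ‖x‖) (x - y)) + volume.real A :=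
        add_le_add_left (setIntegral_le_integral h0 (.of_forall fun y =>
          Set.indicator_nonneg (fun _ _ => by positivity) _)) _
    _ = coulombBall + volume.real A := by
        rw [integral_sub_left_eq_self _ volume x,
          integral_indicator Metric.isOpen_ball.measurableSet, coulombBall]

lemma measurable_uniformPotential (A : Set E3) : Measurable (uniformPotential A) := by
  have h : StronglyMeasurable (fun p : E3 × E3 => 1 / ‖p.1 - p.2‖) :=
    (measurable_coulomb.comp (measurable_fst.sub measurable_snd)).stronglyMeasurable
  exact (h.integral_prod_right (ν := volume.restrict A)).measurable

lemma integrableOn_uniformPotential {A B : Set E3} (hA : volume A < ⊤) (hB : volume B < ⊤)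
    (z : E3) : IntegrableOn (fun x => uniformPotential A (z + x)) B := by
  have : IsFiniteMeasure (volume.restrict B) := ⟨by simpa using hB⟩
  refine Integrable.of_bound ((measurable_uniformPotential A).comp
    (measurable_const.add measurable_id)).aestronglyMeasurable (coulombBall + volume.real A)
    (.of_forall fun x => ?_)
  rw [Real.norm_of_nonneg (uniformPotential_nonneg _ _)]
  exact uniformPotential_le hA _

lemma screenedCoulomb_eq (L : Submodule ℤ E3) (x : E3) :
    screenedCoulomb L x = 1 / ‖x‖ - uniformPotential (wignerSeitz L) x := rfl

lemma measurable_screenedCoulomb (L : Submodule ℤ E3) : Measurable (screenedCoulomb L) :=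
  measurable_coulomb.sub (measurable_uniformPotential _)

/-- Uses the central symmetry of the cell. -/
lemma setIntegral_coulomb_add (L : Submodule ℤ E3) (z : E3) :
    ∫ x in wignerSeitz L, 1 / ‖z + x‖ = uniformPotential (wignerSeitz L) z := by
  rw [uniformPotential, ← setIntegral_wignerSeitz_neg]
  simp [sub_eq_add_neg]

lemma integrableOn_coulomb_add {A : Set E3} (hA : volume A < ⊤) (z : E3) :
    IntegrableOn (fun x => 1 / ‖z + x‖) A := by
  have := integrableOn_coulomb hA (-z)
  refine this.congr (.of_forall fun x => ?_)
  simp only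
  rw [← norm_neg]; congr 2; abel

lemma setIntegral_screenedCoulomb {L : Submodule ℤ E3} (hL : IsBravaisLattice L) (z : E3) :
    ∫ x in wignerSeitz L, screenedCoulomb L (z + x) =
      uniformPotential (wignerSeitz L) z -
        ∫ x in wignerSeitz L, uniformPotential (wignerSeitz L) (z + x) := by
  have hQ := volume_wignerSeitz_lt_top hL
  simp_rw [screenedCoulomb_eq]
  rw [integral_sub (integrableOn_coulomb_add hQ z) (integrableOn_uniformPotential hQ hQ z),
    setIntegral_coulomb_add]

/-! ### Energies as double sums over the lattice points -/

/-- The interaction of two screened charges. -/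
noncomputable def jelliumPair (L : Submodule ℤ E3) (z : E3) : ℝ :=
  1 / 2 * (screenedCoulomb L z - ∫ x in wignerSeitz L, screenedCoulomb L (z + x))

/-- The interaction of two point charges minus that of two uniform cells. -/
noncomputable def indirectPair (L : Submodule ℤ E3) (z : E3) : ℝ :=
  1 / 2 * (screenedCoulomb L z + ∫ x in wignerSeitz L, screenedCoulomb L (z + x))

/-- The three terms are point-point, point-cell and cell-cell interactions. At `z = 0` the first
vanishes since `1 / 0 = 0`, and the others are the energy of a point in its own cell and the
self-energy of that cell. -/
lemma jelliumPair_eq {L : Submodule ℤ E3} (hL : IsBravaisLattice L) (z : E3) :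
    jelliumPair L z = 1 / 2 * (1 / ‖z‖) - uniformPotential (wignerSeitz L) z +
      1 / 2 * ∫ x in wignerSeitz L, uniformPotential (wignerSeitz L) (z + x) := by
  rw [jelliumPair, setIntegral_screenedCoulomb hL, screenedCoulomb_eq]
  ring

lemma indirectPair_eq {L : Submodule ℤ E3} (hL : IsBravaisLattice L) (z : E3) :
    indirectPair L z = 1 / 2 * (1 / ‖z‖) -
      1 / 2 * ∫ x in wignerSeitz L, uniformPotential (wignerSeitz L) (z + x) := by
  rw [indirectPair, setIntegral_screenedCoulomb hL, screenedCoulomb_eq]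
  ring

lemma uniformPotential_cellUnion {L : Submodule ℤ E3} (hL : IsBravaisLattice L) {C : Set E3}
    (hC : Bornology.IsBounded C) (x : E3) :
    uniformPotential (cellUnion L C) x =
      ∑ q ∈ latticePoints L C, uniformPotential (wignerSeitz L) (x - q) := by
  have hQ := volume_wignerSeitz_lt_top hL
  rw [uniformPotential, volume_restrict_cellUnion hL hC, integral_finsetSum_measure]
  · refine Finset.sum_congr rfl fun q _ => ?_
    rw [(measurableEmbedding_addLeft q).integral_map]
    simp [uniformPotential, sub_sub]
  · intro q _
    rw [(measurableEmbedding_addLeft q).integrable_map_iff]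
    refine (integrableOn_coulomb hQ (x - q)).congr (.of_forall fun y => ?_)
    simp [sub_sub]

lemma setIntegral_uniformPotential_cellUnion {L : Submodule ℤ E3} (hL : IsBravaisLattice L)
    {C : Set E3} (hC : Bornology.IsBounded C) :
    ∫ x in cellUnion L C, uniformPotential (cellUnion L C) x =
      ∑ p ∈ latticePoints L C, ∑ q ∈ latticePoints L C,
        ∫ x in wignerSeitz L, uniformPotential (wignerSeitz L) (p - q + x) := by
  have hQ := volume_wignerSeitz_lt_top hL
  have hi : ∀ p q : E3,
      IntegrableOn (fun x => uniformPotential (wignerSeitz L) (p + x - q)) (wignerSeitz L) :=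
    fun p q => (integrableOn_uniformPotential hQ hQ (p - q)).congr (.of_forall fun x => by
      simp only; congr 1; abel)
  simp_rw [uniformPotential_cellUnion hL hC]
  rw [volume_restrict_cellUnion hL hC, integral_finsetSum_measure]
  · refine Finset.sum_congr rfl fun p _ => ?_
    rw [(measurableEmbedding_addLeft p).integral_map, integral_finsetSum _ fun q _ => hi p q]
    refine Finset.sum_congr rfl fun q _ => integral_congr_ae (.of_forall fun x => ?_)
    simp only; congr 1; abel
  · intro p _
    rw [(measurableEmbedding_addLeft p).integrable_map_iff]
    exact integrable_finsetSum _ fun q _ => hi p q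

/-- The diagonal terms are `1 / 0 = 0`, so including them is free. -/
lemma sum_coulomb_ne (S : Finset E3) :
    ∑ x ∈ S, ∑ y ∈ S with y ≠ x, 1 / ‖x - y‖ = ∑ x ∈ S, ∑ y ∈ S, 1 / ‖x - y‖ := by
  refine Finset.sum_congr rfl fun x _ => Finset.sum_subset (Finset.filter_subset _ _) ?_
  intro y hy hxy
  have : y = x := by simpa [hy] using hxy
  simp [this]

lemma jelliumEnergy_eq_sum {L : Submodule ℤ E3} (hL : IsBravaisLattice L) {C : Set E3}
    (hC : Bornology.IsBounded C) :
    jelliumEnergy (latticePoints L C) (cellUnion L C) =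
      ∑ p ∈ latticePoints L C, ∑ q ∈ latticePoints L C, jelliumPair L (p - q) := by
  have h1 : ∫ x in cellUnion L C, ∫ y in cellUnion L C, 1 / ‖x - y‖ = _ :=
    setIntegral_uniformPotential_cellUnion hL hC
  have h2 : ∀ x, ∫ y in cellUnion L C, 1 / ‖x - y‖ = _ := uniformPotential_cellUnion hL hC
  rw [jelliumEnergy, sum_coulomb_ne, h1]
  simp only [h2, jelliumPair_eq hL, Finset.mul_sum, ← Finset.sum_sub_distrib,
    ← Finset.sum_add_distrib]

/-! ### The lattice state -/

lemma card_fin_equiv_finset (S : Finset E3) [Fintype (Fin S.card ≃ S)] :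
    Fintype.card (Fin S.card ≃ S) = S.card ! := by
  classical
  rw [← Nat.card_eq_fintype_card,
    Nat.card_congr (Equiv.equivCongr (Equiv.refl (Fin S.card)) S.equivFin),
    Nat.card_eq_fintype_card, Fintype.card_perm, Fintype.card_fin]

lemma measurable_translate {N : ℕ} (p : Fin N → E3) :
    Measurable (fun (y : E3) i => p i + y) :=
  measurable_pi_lambda _ fun _ => measurable_const.add measurable_id

lemma isProbabilityMeasure_translatedState (S : Finset E3) {Q : Set E3} (hQ : volume Q = 1) :
    IsProbabilityMeasure (translatedState S Q) := by
  constructor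
  rw [translatedState, Measure.smul_apply, Measure.finsetSum_apply]
  have h : ∀ σ : Fin S.card ≃ S,
      (volume.restrict Q).map (fun (y : E3) i => (σ i : E3) + y) Set.univ = 1 := fun σ => by
    rw [Measure.map_apply (measurable_translate _) .univ]; simp [hQ]
  rw [Finset.sum_congr rfl fun σ _ => h σ]
  rw [Finset.sum_const, Finset.card_univ, card_fin_equiv_finset, nsmul_one, smul_eq_mul]
  exact ENNReal.inv_mul_cancel (by simpa using (Nat.factorial_pos _).ne') (by simp)

open Classical in
lemma oneBodyDensity_translatedState (S : Finset E3) (Q : Set E3) :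
    oneBodyDensity (translatedState S Q) =
      ∑ p ∈ S, (volume.restrict Q).map (fun y => p + y) := by
  ext s hs
  have h0 : ∀ p : E3, Measurable fun y : E3 => p + y := fun p => measurable_const.add measurable_id
  have h1 : ∀ i, (translatedState S Q).map (fun x => x i) s =
      (S.card ! : ℝ≥0∞)⁻¹ * ∑ σ : Fin S.card ≃ S, (volume.restrict Q).map (fun y => (σ i : E3) + y) s := by
    intro i
    rw [Measure.map_apply (measurable_pi_apply i) hs, translatedState, Measure.smul_apply,
      Measure.finsetSum_apply, smul_eq_mul]
    congr 1
    refine Finset.sum_congr (by congr!) fun σ _ => ?_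
    rw [Measure.map_apply (measurable_translate _) (hs.preimage (measurable_pi_apply i)),
      Measure.map_apply (h0 _) hs]
    rfl
  rw [oneBodyDensity, Measure.finsetSum_apply, Finset.sum_congr rfl fun i _ => h1 i,
    Measure.finsetSum_apply, ← Finset.mul_sum, Finset.sum_comm]
  -- For each labelling the particles occupy every point of `S` once, so all `S.card !` terms agree
  -- and the normalization cancels.
  have h : ∀ σ : Fin S.card ≃ S, ∑ i, (volume.restrict Q).map (fun y => (σ i : E3) + y) s =
      ∑ p ∈ S, (volume.restrict Q).map (fun y => p + y) s := fun σ => by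
    rw [← Finset.sum_coe_sort S,
      Equiv.sum_comp σ (fun p : S => (volume.restrict Q).map (fun y => (p : E3) + y) s)]
  rw [Finset.sum_congr rfl fun σ _ => h σ]
  rw [Finset.sum_const, Finset.card_univ, card_fin_equiv_finset, nsmul_eq_mul, ← mul_assoc,
    ENNReal.inv_mul_cancel (by simpa using (Nat.factorial_pos _).ne') (by simp), one_mul]

/-- Meant for the interparticle energy, which is unchanged by relabelling and by a common
translation and is therefore constant along the state. -/
lemma integral_translatedState (S : Finset E3) {Q : Set E3} (hQ : volume Q = 1)
    {H : (Fin S.card → E3) → ℝ} (hH : Measurable H) {E : ℝ}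
    (hE : ∀ (σ : Fin S.card ≃ S) (y : E3), H (fun i => σ i + y) = E) :
    ∫ x, H x ∂(translatedState S Q) = E := by
  have : IsProbabilityMeasure (volume.restrict Q) := ⟨by simpa using hQ⟩
  have h1 : ∀ σ : Fin S.card ≃ S,
      Integrable H ((volume.restrict Q).map (fun (y : E3) i => (σ i : E3) + y)) := fun σ => by
    rw [integrable_map_measure hH.aestronglyMeasurable (measurable_translate _).aemeasurable]
    exact (integrable_const E).congr (.of_forall fun y => (hE σ y).symm)
  rw [translatedState, integral_smul_measure, integral_finsetSum_measure fun σ _ => h1 σ]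
  have h2 : ∀ σ : Fin S.card ≃ S,
      ∫ x, H x ∂((volume.restrict Q).map (fun (y : E3) i => (σ i : E3) + y)) = E := fun σ => by
    rw [integral_map (measurable_translate _).aemeasurable hH.aestronglyMeasurable]
    simp_rw [hE]
    simp
  rw [Finset.sum_congr rfl fun σ _ => h2 σ]
  rw [Finset.sum_const, Finset.card_univ, card_fin_equiv_finset, nsmul_eq_mul, smul_eq_mul]
  have : ((S.card ! : ℕ) : ℝ) ≠ 0 := by exact_mod_cast (Nat.factorial_pos _).ne'
  rw [ENNReal.toReal_inv, ENNReal.toReal_natCast]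
  field_simp

lemma indirectEnergy_latticeState {L : Submodule ℤ E3} (hL : IsBravaisLattice L)
    (hvol : volume (wignerSeitz L) = 1) {C : Set E3} (hC : Bornology.IsBounded C) :
    indirectEnergy (latticeState L C) =
      ∑ p ∈ latticePoints L C, ∑ q ∈ latticePoints L C, indirectPair L (p - q) := by
  set S := latticePoints L C with hS
  have h1 : ∫ x in cellUnion L C, ∫ y in cellUnion L C, 1 / ‖x - y‖ = _ :=
    setIntegral_uniformPotential_cellUnion hL hC
  have hexp : ∫ x, (1 / 2 * (∑ i, ∑ j with j ≠ i, 1 / ‖x i - x j‖)) ∂(latticeState L C) =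
      1 / 2 * ∑ p ∈ S, ∑ q ∈ S, 1 / ‖p - q‖ := by
    refine integral_translatedState S hvol ?_ fun σ y => ?_
    · refine Measurable.const_mul (Finset.measurable_sum _ fun i _ =>
        Finset.measurable_sum _ fun j _ => measurable_coulomb.comp ?_) _
      exact (measurable_pi_apply i).sub (measurable_pi_apply j)
    · congr 1
      have h2 : ∀ i, ∑ j with j ≠ i, 1 / ‖(σ i + y : E3) - (σ j + y)‖ =
          ∑ q : S, 1 / ‖(σ i : E3) - q‖ := fun i => by
        rw [← Equiv.sum_comp σ]
        simp only [add_sub_add_right_eq_sub]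
        refine Finset.sum_subset (Finset.filter_subset _ _) fun j _ hj => ?_
        have : j = i := by simpa using hj
        simp [this]
      rw [Finset.sum_congr rfl fun i _ => h2 i]
      rw [Equiv.sum_comp σ (fun p : S => ∑ q : S, 1 / ‖(p : E3) - q‖), ← Finset.sum_coe_sort S]
      exact Finset.sum_congr rfl fun p _ => Finset.sum_coe_sort S (fun q => 1 / ‖(p : E3) - q‖)
  rw [indirectEnergy, hexp, latticeState, oneBodyDensity_translatedState,
    ← volume_restrict_cellUnion hL hC, directEnergy]
  rw [h1]
  simp only [indirectPair_eq hL, Finset.mul_sum, ← hS, ← Finset.sum_sub_distrib]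

lemma latticeState_spec {L : Submodule ℤ E3} (hL : IsBravaisLattice L)
    (hvol : volume (wignerSeitz L) = 1) {C : Set E3} (hC : Bornology.IsBounded C) :
    IsProbabilityMeasure (latticeState L C) ∧
      oneBodyDensity (latticeState L C) = volume.restrict (cellUnion L C) :=
  ⟨isProbabilityMeasure_translatedState _ hvol, by
    rw [latticeState, oneBodyDensity_translatedState, volume_restrict_cellUnion hL hC]⟩

/-! ### Thermodynamic limits -/

/-- Lattice points are counted by the volume of their cells, which converts counting estimates into
inclusions of sets. -/
lemma card_eq_volume_cells {L : Submodule ℤ E3} (hvol : volume (wignerSeitz L) = 1)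
    {T : Finset E3} (hT : ∀ p ∈ T, p ∈ L) :
    (T.card : ℝ≥0∞) = volume (⋃ p ∈ T, p +ᵥ wignerSeitz L) := by
  rw [measure_biUnion_finset₀]
  · simp [measure_vadd, hvol]
  · intro p hp q hq hpq
    exact aedisjoint_vadd_wignerSeitz (hT p hp) (hT q hq) hpq
  · exact fun p _ => ((measurableSet_wignerSeitz L).const_vadd _).nullMeasurableSet

lemma IsometryEquiv.volume_image (g : E3 ≃ᵢ E3) (s : Set E3) : volume (g '' s) = volume s := by
  have h : ∀ x, g x = g.toRealLinearIsometryEquiv x + g 0 := fun x => by simp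
  have h2 : g '' s = (fun x => x + g 0) '' (g.toRealLinearIsometryEquiv '' s) := by
    rw [Set.image_image]
    exact Set.image_congr fun x _ => h x
  rw [h2, Set.image_add_right, measure_preimage_add_right,
    LinearIsometryEquiv.image_eq_preimage_symm,
    (LinearIsometryEquiv.measurePreserving _).measure_preimage_emb
      g.toRealLinearIsometryEquiv.symm.toHomeomorph.measurableEmbedding]

/-- The segment from `p` to `p - z` is connected; if it missed the frontier it would be split by the
interior and the exterior of `C`. -/
lemma exists_mem_frontier_of_sub_notMem {C : Set E3} {p z : E3} (hp : p ∈ C) (hz : p - z ∉ C) :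
    ∃ w ∈ frontier C, ‖p - w‖ ≤ ‖z‖ := by
  have hc : IsPreconnected (segment ℝ p (p - z)) := (convex_segment _ _).isPreconnected
  obtain ⟨w, hw, hwf⟩ : (segment ℝ p (p - z) ∩ frontier C).Nonempty := by
    by_contra hne
    have hd : ∀ x ∈ segment ℝ p (p - z), x ∉ frontier C := fun x hx hf => hne ⟨x, hx, hf⟩
    obtain ⟨x, -, hx1, hx2⟩ := hc (interior C) (closure C)ᶜ isOpen_interior
      isClosed_closure.isOpen_compl
      (fun x hx => by
        by_contra hu
        simp only [Set.mem_union, Set.mem_compl_iff, not_or, not_not] at hu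
        exact hd x hx ⟨hu.2, hu.1⟩)
      ⟨p, left_mem_segment ℝ _ _, by
        by_contra hi
        exact hd p (left_mem_segment ℝ _ _) ⟨subset_closure hp, hi⟩⟩
      ⟨p - z, right_mem_segment ℝ _ _, fun hi =>
        hd _ (right_mem_segment ℝ _ _) ⟨hi, fun hi' => hz (interior_subset hi')⟩⟩
    exact hx2 (subset_closure (interior_subset hx1))
  refine ⟨w, hwf, ?_⟩
  rw [segment_eq_image'] at hw
  obtain ⟨θ, hθ, rfl⟩ := hw
  simp only [sub_sub_cancel_left, smul_neg, sub_add_cancel_left, neg_neg, norm_smul]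
  rw [Real.norm_of_nonneg hθ.1]
  exact mul_le_of_le_one_left (norm_nonneg _) hθ.2

/-! ### Counting lattice points in growing regions: bulk and boundary -/

namespace IsGrowingSequence

variable {C : ℕ → Set E3} {D : Set E3}

lemma isBounded_seq (h : IsGrowingSequence C D) (n : ℕ) : Bornology.IsBounded (C n) := by
  obtain ⟨t, g, -, hC⟩ := h.exists_dilation
  rw [hC]
  exact (g n).isometry.lipschitz.isBounded_image (h.isBounded.smul₀ (t n))

/-- The dilated shape contains a ball of radius `t n * ρ`. Once the cell radius is at most `t n * ρ
/ 2`, every point of the concentric ball of half that radius lies in the cell of a lattice point of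
the region. -/
lemma exists_card_lower_bound {L : Submodule ℤ E3} (hL : IsBravaisLattice L)
    (hvol : volume (wignerSeitz L) = 1) (h : IsGrowingSequence C D) {t : ℕ → ℝ}
    {g : ℕ → (E3 ≃ᵢ E3)} (ht : Tendsto t atTop atTop) (hC : ∀ n, C n = g n '' (t n • D)) :
    ∃ c > 0, ∀ᶠ n in atTop, c * t n ^ 3 ≤ (latticePoints L (C n)).card := by
  obtain ⟨x₀, hx₀⟩ := h.nonempty_interior
  obtain ⟨ρ, hρ, hball⟩ := Metric.isOpen_iff.1 isOpen_interior x₀ hx₀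
  obtain ⟨r, hr, hQr⟩ := hL.exists_norm_le_of_mem_wignerSeitz
  have hv : 0 < volume.real (Metric.ball (0 : E3) 1) :=
    ENNReal.toReal_pos (Metric.measure_ball_pos _ _ one_pos).ne' measure_ball_lt_top.ne
  refine ⟨(ρ / 2) ^ 3 * volume.real (Metric.ball (0 : E3) 1), by positivity, ?_⟩
  filter_upwards [ht.eventually_ge_atTop (2 * r / ρ), ht.eventually_gt_atTop 0] with n hn hn0
  have hrn : r ≤ t n * ρ / 2 := by
    rw [div_le_iff₀ hρ] at hn; linarith
  have hsub : Metric.ball (g n (t n • x₀)) (t n * ρ / 2) ⊆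
      ⋃ p ∈ latticePoints L (C n), p +ᵥ wignerSeitz L := by
    intro x hx
    obtain ⟨v, hv, hxv⟩ := hL.exists_sub_mem_wignerSeitz x
    simp only [Set.mem_iUnion]
    refine ⟨v, (mem_latticePoints hL (h.isBounded_seq n)).2 ⟨hv, ?_⟩, ?_⟩
    · rw [hC]
      refine ⟨(g n).symm v, ?_, by simp⟩
      rw [Set.mem_smul_set_iff_inv_smul_mem₀ hn0.ne']
      refine interior_subset (hball ?_)
      have h1 : dist ((g n).symm v) (t n • x₀) < t n * ρ := by
        rw [← (g n).dist_eq, IsometryEquiv.apply_symm_apply]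
        have h2 : dist v x ≤ r := by
          rw [dist_comm, dist_eq_norm]; exact hQr _ hxv
        have := dist_triangle v x (g n (t n • x₀))
        have := Metric.mem_ball.1 hx
        linarith
      rw [Metric.mem_ball, ← inv_smul_smul₀ hn0.ne' x₀, dist_smul₀, norm_inv,
        Real.norm_of_nonneg hn0.le, inv_mul_lt_iff₀ hn0]
      simpa [smul_smul, hn0.ne'] using h1
    · rwa [Set.mem_vadd_set_iff_neg_vadd_mem, vadd_eq_add, neg_add_eq_sub]
  have h2 := measure_mono (μ := volume) hsub
  rw [← card_eq_volume_cells hvol fun p hp => ((mem_latticePoints hL (h.isBounded_seq n)).1 hp).1,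
    Measure.addHaar_ball _ _ (by positivity)] at h2
  have h3 := ENNReal.toReal_mono (by simp) h2
  rw [ENNReal.toReal_mul, ENNReal.toReal_ofReal (by positivity), ENNReal.toReal_natCast] at h3
  simp only [finrank_euclideanSpace, Fintype.card_fin] at h3
  refine le_trans (le_of_eq ?_) h3
  rw [Measure.real]; ring

open Classical in
-- A point that `-z` moves out of the region is within `‖z‖` of its frontier, so its cell lies
-- within `‖z‖ + r` of it. After rescaling by `t n` this is a neighborhood of the fixed compact set
-- `frontier D` of thickness tending to zero, whose volume tends to that of `frontier D`, which is
-- null. The factor `t n ^ 3` cancels against the lower bound on the number of points.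
lemma tendsto_boundary_ratio {L : Submodule ℤ E3} (hL : IsBravaisLattice L)
    (hvol : volume (wignerSeitz L) = 1) (h : IsGrowingSequence C D) {z : E3} (hz : z ∈ L) :
    Tendsto (fun n => (((latticePoints L (C n)).filter
      (fun p => p - z ∉ latticePoints L (C n))).card : ℝ) / (latticePoints L (C n)).card)
      atTop (𝓝 0) := by
  obtain ⟨t, g, ht, hC⟩ := h.exists_dilation
  obtain ⟨c, hc, hcard⟩ := h.exists_card_lower_bound hL hvol ht hC
  obtain ⟨r, hr, hQr⟩ := hL.exists_norm_le_of_mem_wignerSeitz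
  have hK : IsCompact (frontier D) := Metric.isCompact_of_isClosed_isBounded isClosed_frontier
    (h.isBounded.closure.subset frontier_subset_closure)
  have hlim : Tendsto (fun n => (volume (Metric.cthickening ((‖z‖ + r) / t n)
      (frontier D))).toReal / c) atTop (𝓝 0) := by
    have h1 := (tendsto_measure_cthickening_of_isCompact (μ := volume) hK).comp
      ((tendsto_const_nhds (x := ‖z‖ + r)).div_atTop ht)
    rw [h.frontier_null] at h1
    have h2 := ((ENNReal.tendsto_toReal ENNReal.zero_ne_top).comp h1).div_const c
    simpa using h2
  refine squeeze_zero' (.of_forall fun n => by positivity) ?_ hlim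
  filter_upwards [hcard, ht.eventually_gt_atTop 0] with n hn hn0
  set S := latticePoints L (C n) with hS
  have hmem : ∀ p, p ∈ S ↔ p ∈ L ∧ p ∈ C n := fun p => mem_latticePoints hL (h.isBounded_seq n)
  have hfin : volume (Metric.cthickening ((‖z‖ + r) / t n) (frontier D)) ≠ ⊤ :=
    (hK.isBounded.cthickening).measure_lt_top.ne
  have hsub : (⋃ p ∈ S.filter (fun p => p - z ∉ S), p +ᵥ wignerSeitz L) ⊆
      g n '' (t n • Metric.cthickening ((‖z‖ + r) / t n) (frontier D)) := by
    intro x hx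
    simp only [Set.mem_iUnion, Finset.mem_filter] at hx
    obtain ⟨p, ⟨hpS, hpz⟩, hxp⟩ := hx
    rw [Set.mem_vadd_set_iff_neg_vadd_mem, vadd_eq_add, neg_add_eq_sub] at hxp
    have hp := (hmem p).1 hpS
    have hpz' : p - z ∉ C n := fun hh => hpz ((hmem _).2 ⟨L.sub_mem hp.1 hz, hh⟩)
    obtain ⟨w, hw, hpw⟩ := exists_mem_frontier_of_sub_notMem hp.2 hpz'
    rw [hC, ← (g n).coe_toHomeomorph, ← Homeomorph.image_frontier] at hw
    obtain ⟨w', hw', rfl⟩ := hw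
    have hfr : frontier (t n • D) = t n • frontier D :=
      ((Homeomorph.smulOfNeZero (t n) hn0.ne').image_frontier D).symm
    rw [hfr] at hw'
    obtain ⟨k, hk, rfl⟩ := hw'
    refine ⟨(g n).symm x, ?_, by simp⟩
    rw [Set.mem_smul_set_iff_inv_smul_mem₀ hn0.ne']
    refine Metric.mem_cthickening_of_dist_le _ k _ _ hk ?_
    rw [← inv_smul_smul₀ hn0.ne' k, dist_smul₀, norm_inv, Real.norm_of_nonneg hn0.le,
      inv_mul_eq_div]
    gcongr
    rw [← (g n).dist_eq, IsometryEquiv.apply_symm_apply]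
    have h1 := dist_triangle x p (g n (t n • k))
    have h2 : dist x p ≤ r := by rw [dist_eq_norm]; exact hQr _ hxp
    rw [dist_eq_norm p] at h1
    have h3 : ‖p - g n (t n • k)‖ ≤ ‖z‖ := hpw
    linarith
  have h2 := measure_mono (μ := volume) hsub
  rw [← card_eq_volume_cells hvol fun p hp => ((hmem p).1 (Finset.mem_filter.1 hp).1).1,
    IsometryEquiv.volume_image, Measure.addHaar_smul] at h2
  have h3 := ENNReal.toReal_mono (ENNReal.mul_ne_top (by simp) hfin) h2
  rw [ENNReal.toReal_mul, ENNReal.toReal_ofReal (by positivity), ENNReal.toReal_natCast,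
    finrank_euclideanSpace, Fintype.card_fin, abs_of_pos (by positivity)] at h3
  have h4 : 0 < t n ^ 3 := by positivity
  calc _ ≤ t n ^ 3 * (volume (Metric.cthickening ((‖z‖ + r) / t n) (frontier D))).toReal /
        (c * t n ^ 3) := by gcongr
    _ = _ := by field_simp

end IsGrowingSequence

/-! ### From pair sums in a region to lattice series -/

lemma sum_sub_eq_tsum {L : Submodule ℤ E3} {S : Finset E3} (hS : ∀ p ∈ S, p ∈ L) (F : E3 → ℝ)
    [DecidableEq E3] :
    ∑ p ∈ S, ∑ q ∈ S, F (p - q) =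
      ∑' z : L, F z * ((S.filter (fun p => p - (z : E3) ∈ S)).card : ℝ) := by
  classical
  have h1 : ∀ p ∈ S, HasSum (fun z : L => if p - (z : E3) ∈ S then F z else 0)
      (∑ q ∈ S, F (p - q)) := by
    intro p hp
    have h2 : HasSum (fun q : L => if (q : E3) ∈ S then F (p - q) else 0)
        (∑ q ∈ S.subtype (· ∈ L), if (q : E3) ∈ S then F (p - q) else 0) :=
      hasSum_sum_of_ne_finset_zero fun q hq => if_neg (by simpa using hq)
    rw [Finset.sum_subtype_of_mem (fun q => if q ∈ S then F (p - q) else 0) hS,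
      Finset.sum_congr rfl fun q hq => if_pos hq] at h2
    rw [← (Equiv.subLeft (⟨p, hS p hp⟩ : L)).hasSum_iff] at h2
    convert h2 using 2 with z
    simp
  have h3 := hasSum_sum h1
  rw [← h3.tsum_eq]
  refine tsum_congr fun z => ?_
  rw [Finset.card_filter]
  push_cast
  rw [Finset.mul_sum]
  exact Finset.sum_congr rfl fun p _ => by split_ifs <;> simp

lemma IsGrowingSequence.tendsto_pair_sum {C : ℕ → Set E3} {D : Set E3} {L : Submodule ℤ E3}
    (hL : IsBravaisLattice L) (hvol : volume (wignerSeitz L) = 1) (h : IsGrowingSequence C D)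
    {F : E3 → ℝ} (hF : Summable fun z : L => F z) :
    Tendsto (fun n => (∑ p ∈ latticePoints L (C n), ∑ q ∈ latticePoints L (C n), F (p - q)) /
      (latticePoints L (C n)).card) atTop (𝓝 (∑' z : L, F z)) := by
  classical
  have h1 : ∀ n, (∑ p ∈ latticePoints L (C n), ∑ q ∈ latticePoints L (C n), F (p - q)) /
      (latticePoints L (C n)).card = ∑' z : L, F z * (((latticePoints L (C n)).filter
        (fun p => p - (z : E3) ∈ latticePoints L (C n))).card / (latticePoints L (C n)).card) := by
    intro n
    rw [sum_sub_eq_tsum (L := L)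
      (fun p hp => ((mem_latticePoints hL (h.isBounded_seq n)).1 hp).1) F, ← tsum_div_const]
    exact tsum_congr fun z => by rw [mul_div_assoc]
  simp_rw [h1]
  -- Grouped by the difference `z`, the term `F z` carries the fraction of points `p` with `p - z`
  -- still in the region. This weight is at most one and tends to one.
  refine tendsto_tsum_of_dominated_convergence hF.norm (fun z => ?_) (.of_forall fun n z => ?_)
  · obtain ⟨t, g, ht, hC⟩ := h.exists_dilation
    obtain ⟨c, hc, hcard⟩ := h.exists_card_lower_bound hL hvol ht hC
    have h2 := ((h.tendsto_boundary_ratio hL hvol z.2).const_sub 1).const_mul (F z)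
    simp only [sub_zero, mul_one] at h2
    refine h2.congr' ?_
    filter_upwards [hcard, ht.eventually_gt_atTop 0] with n hn hn0
    have h3 : (0 : ℝ) < (latticePoints L (C n)).card :=
      lt_of_lt_of_le (by positivity) hn
    have h4 := Finset.card_filter_add_card_filter_not (s := latticePoints L (C n))
      (fun p => p - (z : E3) ∈ latticePoints L (C n))
    have h5 : (((latticePoints L (C n)).filter
        (fun p => p - (z : E3) ∈ latticePoints L (C n))).card : ℝ) +
        ((latticePoints L (C n)).filter
        (fun p => ¬ (p - (z : E3) ∈ latticePoints L (C n)))).card =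
        (latticePoints L (C n)).card := by exact_mod_cast h4
    congr 1
    rw [sub_eq_iff_eq_add, ← add_div, h5, div_self h3.ne']
  · rw [norm_mul]
    refine mul_le_of_le_one_right (norm_nonneg _) ?_
    rw [Real.norm_of_nonneg (by positivity)]
    exact div_le_one_of_le₀ (by exact_mod_cast Finset.card_filter_le _ _) (by positivity)

/-! ### Decay of the screened potential -/

lemma abs_inv_sqrt_one_add_sub_le {t : ℝ} (ht : |t| ≤ 1 / 2) :
    |1 / √(1 + t) - (1 - t / 2 + 3 / 8 * t ^ 2)| ≤ 4 * |t| ^ 3 := by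
  obtain ⟨h1, h2⟩ := abs_le.1 ht
  have hs : 0 < √(1 + t) := Real.sqrt_pos.2 (by linarith)
  set s := 1 / √(1 + t) with hsdef
  have hs0 : 0 < s := by positivity
  have hs2 : s ^ 2 * (1 + t) = 1 := by
    rw [hsdef, div_pow, Real.sq_sqrt (by linarith)]
    field_simp [show (1 + t) ≠ 0 by linarith]
  set P := 1 - t / 2 + 3 / 8 * t ^ 2 with hP
  have hP0 : 1 / 2 < P := by rw [hP]; nlinarith [sq_nonneg t]
  -- Since `s ^ 2 * (1 + t) = 1`, the product is the polynomial `1 - P ^ 2 * (1 + t)`, divisible by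
  -- `t ^ 3` because `P` is the second-order Taylor polynomial. The factor 4 in the bound inverts
  -- the estimate `1 / 4 ≤ (s + P) * (1 + t)`.
  have key : (s - P) * ((s + P) * (1 + t)) = -t ^ 3 * (5 / 8 - 15 / 64 * t + 9 / 64 * t ^ 2) := by
    have : (s - P) * ((s + P) * (1 + t)) = s ^ 2 * (1 + t) - P ^ 2 * (1 + t) := by ring
    rw [this, hs2, hP]; ring
  have h3 : 1 / 4 ≤ (s + P) * (1 + t) := by nlinarith
  have h4 : |5 / 8 - 15 / 64 * t + 9 / 64 * t ^ 2| ≤ 1 := by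
    rw [abs_le]; constructor <;> nlinarith
  have h5 : |s - P| * ((s + P) * (1 + t)) ≤ |t| ^ 3 := by
    rw [← abs_of_pos (show 0 < (s + P) * (1 + t) by linarith), ← abs_mul, key, abs_mul, abs_neg,
      abs_pow]
    exact mul_le_of_le_one_right (by positivity) h4
  have h6 := mul_le_mul_of_nonneg_left h3 (abs_nonneg (s - P))
  linarith

/-- The multipole expansion through the quadrupole, from the expansion of `1 / √(1 + t)` with `‖x -
y‖ ^ 2 = ‖x‖ ^ 2 * (1 + t)`. The factor 6 in `hx` makes `|t| ≤ 3 * ρ / ‖x‖ ≤ 1 / 2`. -/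
lemma abs_coulomb_expansion_le {x y : E3} {ρ : ℝ} (hy : ‖y‖ ≤ ρ) (hx : 6 * ρ ≤ ‖x‖)
    (hρ : 0 < ρ) :
    |1 / ‖x - y‖ - (1 / ‖x‖ + ⟪x, y⟫ / ‖x‖ ^ 3 - ‖y‖ ^ 2 / (2 * ‖x‖ ^ 3)
      + 3 / 2 * ⟪x, y⟫ ^ 2 / ‖x‖ ^ 5)| ≤ 110 * ρ ^ 3 / ‖x‖ ^ 4 := by
  set r := ‖x‖ with hr
  have hr0 : 0 < r := by linarith
  set a : ℝ := ⟪x, y⟫ with ha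
  set b := ‖y‖ with hb
  have hb0 : 0 ≤ b := norm_nonneg y
  have hab : |a| ≤ r * ρ := (abs_real_inner_le_norm x y).trans (by gcongr)
  have hsq : ‖x - y‖ ^ 2 = r ^ 2 - 2 * a + b ^ 2 := norm_sub_sq_real x y
  set t := (b ^ 2 - 2 * a) / r ^ 2 with htdef
  have hb2 : b ^ 2 ≤ ρ ^ 2 := by gcongr
  have hnum : |b ^ 2 - 2 * a| ≤ 3 * ρ * r := by
    calc |b ^ 2 - 2 * a| ≤ |b ^ 2| + |2 * a| := abs_sub _ _
      _ ≤ ρ ^ 2 + 2 * (r * ρ) := by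
        rw [abs_of_nonneg (by positivity : 0 ≤ b ^ 2), abs_mul, abs_two]; gcongr
      _ ≤ 3 * ρ * r := by nlinarith
  have ht3 : |t| ≤ 3 * ρ / r := by
    rw [htdef, abs_div, abs_of_pos (by positivity : 0 < r ^ 2), div_le_div_iff₀ (by positivity)
      hr0]
    nlinarith
  have ht : |t| ≤ 1 / 2 := ht3.trans (by rw [div_le_div_iff₀ hr0 two_pos]; linarith)
  have hnorm : 1 / ‖x - y‖ = 1 / r * (1 / √(1 + t)) := by
    have : ‖x - y‖ = r * √(1 + t) := by
      rw [← Real.sqrt_sq (norm_nonneg (x - y)), hsq]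
      rw [show r ^ 2 - 2 * a + b ^ 2 = r ^ 2 * (1 + t) by rw [htdef]; field_simp; ring,
        Real.sqrt_mul (by positivity), Real.sqrt_sq hr0.le]
    rw [this, one_div_mul_one_div]
  have h1 := abs_inv_sqrt_one_add_sub_le ht
  -- The term `t ^ 2` also produces the pieces `b ^ 4` and `a * b ^ 2`, which are of higher order
  -- and go into the error. The constant 110 dominates `4 * 3 ^ 3 + 15 / 8`.
  have hid : 1 / r * (1 / √(1 + t)) - (1 / r + a / r ^ 3 - b ^ 2 / (2 * r ^ 3)
      + 3 / 2 * a ^ 2 / r ^ 5) = 1 / r * (1 / √(1 + t) - (1 - t / 2 + 3 / 8 * t ^ 2)) +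
      3 / 8 * (b ^ 4 - 4 * a * b ^ 2) / r ^ 5 := by
    rw [htdef]; field_simp; ring
  have h2 : |b ^ 4 - 4 * a * b ^ 2| ≤ 5 * ρ ^ 3 * r := by
    calc |b ^ 4 - 4 * a * b ^ 2| ≤ |b ^ 4| + |4 * a * b ^ 2| := abs_sub _ _
      _ = (b ^ 2) ^ 2 + 4 * |a| * b ^ 2 := by
        rw [abs_of_nonneg (by positivity : 0 ≤ b ^ 4), abs_mul, abs_mul,
          abs_of_nonneg (by positivity : 0 ≤ b ^ 2)]
        norm_num; ring
      _ ≤ (ρ ^ 2) ^ 2 + 4 * (r * ρ) * ρ ^ 2 := by gcongr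
      _ ≤ 5 * ρ ^ 3 * r := by nlinarith [pow_pos hρ 3]
  rw [hnorm, hid]
  calc _ ≤ |1 / r * (1 / √(1 + t) - (1 - t / 2 + 3 / 8 * t ^ 2))| +
        |3 / 8 * (b ^ 4 - 4 * a * b ^ 2) / r ^ 5| := abs_add_le _ _
    _ ≤ 1 / r * (4 * (3 * ρ / r) ^ 3) + 3 / 8 * (5 * ρ ^ 3 * r) / r ^ 5 := by
      rw [abs_mul, abs_of_pos (by positivity : 0 < 1 / r), abs_div, abs_mul,
        abs_of_pos (by positivity : 0 < r ^ 5), abs_of_pos (by norm_num : (0 : ℝ) < 3 / 8)]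
      gcongr
      exact h1.trans (by gcongr)
    _ = (108 + 15 / 8) * ρ ^ 3 / r ^ 4 := by field_simp; ring
    _ ≤ _ := by gcongr; norm_num

lemma IsBravaisLattice.integrableOn_of_continuous {L : Submodule ℤ E3} (hL : IsBravaisLattice L)
    {F : Type*} [NormedAddCommGroup F] {f : E3 → F} (hf : Continuous f) :
    IntegrableOn f (wignerSeitz L) :=
  hf.continuousOn.integrableOn_compact hL.isCompact_wignerSeitz

lemma integral_inner_wignerSeitz {L : Submodule ℤ E3} (hL : IsBravaisLattice L)
    (hd : NoDipole L) (x : E3) : ∫ y in wignerSeitz L, ⟪x, y⟫ = 0 := by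
  have h := integral_inner (𝕜 := ℝ) (hL.integrableOn_of_continuous continuous_id) x
  simp only [id] at h
  rw [h, hd, inner_zero_right]

lemma integral_inner_sq_wignerSeitz {L : Submodule ℤ E3} (hL : IsBravaisLattice L)
    (hq : NoQuadrupole L) (x : E3) :
    ∫ y in wignerSeitz L, ⟪x, y⟫ ^ 2 = ‖x‖ ^ 2 / 3 * ∫ y in wignerSeitz L, ‖y‖ ^ 2 := by
  have h1 : ∀ y : E3, ⟪x, y⟫ ^ 2 = ∑ i, ∑ j, x i * x j * (y i * y j) := fun y => by
    rw [PiLp.inner_apply, sq, Finset.sum_mul_sum]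
    refine Finset.sum_congr rfl fun i _ => Finset.sum_congr rfl fun j _ => ?_
    simp only [RCLike.inner_apply, conj_trivial]
    ring
  have hc : ∀ i j : Fin 3, IntegrableOn (fun y : E3 => x i * x j * (y i * y j)) (wignerSeitz L) :=
    fun i j => hL.integrableOn_of_continuous (by fun_prop)
  simp_rw [h1]
  rw [integral_finsetSum _ fun i _ => integrable_finsetSum _ fun j _ => hc i j]
  rw [Finset.sum_congr rfl fun i _ => integral_finsetSum _ fun j _ => hc i j]
  simp_rw [integral_const_mul, hq _ _]
  rw [EuclideanSpace.real_norm_sq_eq]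
  simp [Fin.sum_univ_three]
  ring

lemma exists_abs_screenedCoulomb_le {L : Submodule ℤ E3} (hL : IsBravaisLattice L)
    (hvol : volume (wignerSeitz L) = 1) (hd : NoDipole L) (hq : NoQuadrupole L) :
    ∃ R > 0, ∃ c > 0, ∀ x, R ≤ ‖x‖ → |screenedCoulomb L x| ≤ c / ‖x‖ ^ 4 := by
  obtain ⟨ρ, hρ, hQ⟩ := hL.exists_norm_le_of_mem_wignerSeitz
  refine ⟨6 * ρ, by positivity, 110 * ρ ^ 3, by positivity, fun x hx => ?_⟩
  have hx0 : 0 < ‖x‖ := by linarith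
  have hp : IsProbabilityMeasure (volume.restrict (wignerSeitz L)) := ⟨by simpa using hvol⟩
  have hi1 : IntegrableOn (fun y : E3 => (⟪x, y⟫ : ℝ)) (wignerSeitz L) :=
    hL.integrableOn_of_continuous (by fun_prop)
  have hi2 : IntegrableOn (fun y : E3 => ‖y‖ ^ 2) (wignerSeitz L) :=
    hL.integrableOn_of_continuous (by fun_prop)
  have hi3 : IntegrableOn (fun y : E3 => (⟪x, y⟫ : ℝ) ^ 2) (wignerSeitz L) :=
    hL.integrableOn_of_continuous (by fun_prop)
  have hi4 : IntegrableOn (fun y : E3 => 1 / ‖x‖ + ⟪x, y⟫ / ‖x‖ ^ 3 - ‖y‖ ^ 2 / (2 * ‖x‖ ^ 3)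
      + 3 / 2 * ⟪x, y⟫ ^ 2 / ‖x‖ ^ 5) (wignerSeitz L) :=
    hL.integrableOn_of_continuous (by fun_prop)
  -- The dipole term integrates to zero. With `M` the second moment, the other two give `-M / (2 *
  -- ‖x‖ ^ 3)` and `(3 / 2) * (M / 3) / ‖x‖ ^ 3`, which cancel.
  have hmean : ∫ y in wignerSeitz L, (1 / ‖x‖ + ⟪x, y⟫ / ‖x‖ ^ 3 - ‖y‖ ^ 2 / (2 * ‖x‖ ^ 3)
      + 3 / 2 * ⟪x, y⟫ ^ 2 / ‖x‖ ^ 5) = 1 / ‖x‖ := by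
    have hi5 : IntegrableOn (fun y : E3 => 1 / ‖x‖ + ⟪x, y⟫ / ‖x‖ ^ 3) (wignerSeitz L) :=
      hL.integrableOn_of_continuous (by fun_prop)
    have hi6 : IntegrableOn (fun y : E3 => 1 / ‖x‖ + ⟪x, y⟫ / ‖x‖ ^ 3 - ‖y‖ ^ 2 / (2 * ‖x‖ ^ 3))
      (wignerSeitz L) := hL.integrableOn_of_continuous (by fun_prop)
    rw [integral_add hi6 ((hi3.const_mul _).div_const _), integral_sub hi5 (hi2.div_const _),
      integral_add (integrable_const _) (hi1.div_const _), integral_div, integral_div,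
      integral_div, integral_div, integral_const_mul, integral_inner_wignerSeitz hL hd,
      integral_inner_sq_wignerSeitz hL hq]
    simp
    field_simp
    ring
  rw [screenedCoulomb, ← hmean, ← integral_sub hi4 (integrableOn_coulomb
    (volume_wignerSeitz_lt_top hL) x), ← Real.norm_eq_abs]
  have h := norm_setIntegral_le_of_norm_le_const (volume_wignerSeitz_lt_top hL)
    (f := fun y : E3 => (1 / ‖x‖ + ⟪x, y⟫ / ‖x‖ ^ 3 - ‖y‖ ^ 2 / (2 * ‖x‖ ^ 3)
      + 3 / 2 * ⟪x, y⟫ ^ 2 / ‖x‖ ^ 5) - 1 / ‖x - y‖) (C := 110 * ρ ^ 3 / ‖x‖ ^ 4) fun y hy => by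
      rw [norm_sub_rev]
      exact abs_coulomb_expansion_le (hQ y hy) hx hρ
  simpa [Measure.real, hvol] using h

lemma integrable_screenedCoulomb {L : Submodule ℤ E3} (hL : IsBravaisLattice L)
    (hvol : volume (wignerSeitz L) = 1) (hd : NoDipole L) (hq : NoQuadrupole L) :
    Integrable (screenedCoulomb L) := by
  obtain ⟨R, hR, c, hc, h⟩ := exists_abs_screenedCoulomb_le hL hvol hd hq
  have hQ := volume_wignerSeitz_lt_top hL
  have hloc : IntegrableOn (screenedCoulomb L) (Metric.ball 0 (max R 1)) := by
    have hb : volume (Metric.ball (0 : E3) (max R 1)) < ⊤ := measure_ball_lt_top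
    have h1 := integrableOn_coulomb_add hb (0 : E3)
    have h2 := integrableOn_uniformPotential hQ hb (0 : E3)
    simp only [zero_add] at h1 h2
    exact h1.sub h2
  have hfar : IntegrableOn (screenedCoulomb L) (Metric.ball 0 (max R 1))ᶜ := by
    have h1 : Integrable (fun x : E3 => c * 16 * (1 + ‖x‖) ^ (-4 : ℝ)) :=
      (integrable_one_add_norm (by simp; norm_num)).const_mul _
    refine Integrable.mono' h1.integrableOn (measurable_screenedCoulomb L).aestronglyMeasurable ?_
    refine ae_restrict_of_forall_mem Metric.isOpen_ball.measurableSet.compl fun x hx => ?_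
    have hx' : max R 1 ≤ ‖x‖ := by simpa using hx
    have hx1 : 1 ≤ ‖x‖ := (le_max_right _ _).trans hx'
    refine (h x ((le_max_left _ _).trans hx')).trans ?_
    rw [Real.rpow_neg (by positivity), mul_assoc, div_eq_mul_inv]
    gcongr
    rw [show (4 : ℝ) = (4 : ℕ) by norm_num, Real.rpow_natCast, ← div_eq_mul_inv,
      inv_le_comm₀ (by positivity) (by positivity), inv_div, div_le_iff₀ (by norm_num)]
    calc (1 + ‖x‖) ^ 4 ≤ (2 * ‖x‖) ^ 4 := by gcongr; linarith
      _ = ‖x‖ ^ 4 * 16 := by ring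
  have := hloc.union hfar
  rwa [Set.union_compl_self, integrableOn_univ] at this

/-- The exponent 4 exceeds the rank 3 of the lattice, and only finitely many points escape the decay
hypothesis. -/
lemma summable_lattice_of_decay {L : Submodule ℤ E3} (hL : IsBravaisLattice L) {f : L → ℝ}
    {R c : ℝ} (h : ∀ z : L, R ≤ ‖(z : E3)‖ → |f z| ≤ c / ‖(z : E3)‖ ^ 4) : Summable f := by
  have := hL.discreteTopology
  have := hL.isZLattice
  have h1 : Summable fun z : L => c * ‖z‖⁻¹ ^ 4 := by
    refine (ZLattice.summable_norm_pow_inv L 4 ?_).mul_left c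
    rw [ZLattice.rank ℝ L]; simp
  refine Summable.of_norm_bounded_eventually h1 ?_
  rw [Filter.eventually_cofinite]
  refine Set.Finite.subset ((hL.finite_inter (Metric.isBounded_ball (x := (0 : E3))
    (r := R))).preimage (f := ((↑) : L → E3)) Subtype.val_injective.injOn) fun z hz => ?_
  refine ⟨z.2, ?_⟩
  by_contra hzR
  refine hz ?_
  have := h z (by simpa using hzR)
  rwa [div_eq_mul_inv, ← inv_pow] at this

lemma summable_screenedCoulomb {L : Submodule ℤ E3} (hL : IsBravaisLattice L)
    (hvol : volume (wignerSeitz L) = 1) (hd : NoDipole L) (hq : NoQuadrupole L) :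
    Summable fun z : L => screenedCoulomb L z := by
  obtain ⟨R, -, c, -, h⟩ := exists_abs_screenedCoulomb_le hL hvol hd hq
  exact summable_lattice_of_decay hL (R := R) (c := c) fun z hz => h z hz

lemma summable_screenedCoulomb_ne_zero {L : Submodule ℤ E3}
    (hs : Summable fun z : L => screenedCoulomb L z) :
    Summable (fun x : {x : E3 // x ∈ L ∧ x ≠ 0} => screenedCoulomb L x) :=
  hs.comp_injective (i := fun x : {x : E3 // x ∈ L ∧ x ≠ 0} => (⟨x, x.2.1⟩ : L))
    fun _ _ h => Subtype.ext (congrArg (fun z : L => (z : E3)) h)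

/-- The term at the origin is `-∫_Q dy/‖y‖`, again because `1 / ‖0‖ = 0`; it supplies the middle
term of the formula for `eJel`. -/
lemma tsum_screenedCoulomb {L : Submodule ℤ E3}
    (hs : Summable fun z : L => screenedCoulomb L z) :
    ∑' z : L, screenedCoulomb L z = (∑' x : {x : E3 // x ∈ L ∧ x ≠ 0}, screenedCoulomb L x)
      - ∫ y in wignerSeitz L, 1 / ‖y‖ := by
  classical
  have hinj : Function.Injective (fun x : {x : E3 // x ∈ L ∧ x ≠ 0} => (⟨x, x.2.1⟩ : L)) :=
    fun _ _ h => Subtype.ext (congrArg (fun z : L => (z : E3)) h)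
  have h1 := hinj.tsum_eq (f := fun z : L => if z = 0 then 0 else screenedCoulomb L z)
    (fun z hz => ⟨⟨z, z.2, fun h0 => hz (if_pos (Subtype.ext h0))⟩, rfl⟩)
  have h2 : (∑' x : {x : E3 // x ∈ L ∧ x ≠ 0}, screenedCoulomb L x) =
      ∑' z : L, if z = 0 then 0 else screenedCoulomb L z := by
    rw [← h1]
    exact tsum_congr fun x => (if_neg fun h0 => x.2.2 (congrArg Subtype.val h0)).symm
  rw [hs.tsum_eq_add_tsum_ite 0, h2]
  simp [screenedCoulomb]
  ring

/-! ### The limits of the energies per particle -/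

lemma hasSum_setIntegral_screenedCoulomb {L : Submodule ℤ E3} (hL : IsBravaisLattice L)
    (hi : Integrable (screenedCoulomb L)) :
    HasSum (fun z : L => ∫ x in wignerSeitz L, screenedCoulomb L (z + x))
      (∫ y, screenedCoulomb L y) :=
  hL.hasSum_wignerSeitz hi

lemma hasSum_jelliumPair {L : Submodule ℤ E3} (hL : IsBravaisLattice L)
    (hvol : volume (wignerSeitz L) = 1) (hd : NoDipole L) (hq : NoQuadrupole L) :
    HasSum (fun z : L => jelliumPair L z)
      (1 / 2 * (∑' z : L, screenedCoulomb L z - ∫ y, screenedCoulomb L y)) :=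
  ((summable_screenedCoulomb hL hvol hd hq).hasSum.sub (hasSum_setIntegral_screenedCoulomb hL
    (integrable_screenedCoulomb hL hvol hd hq))).mul_left _

lemma hasSum_indirectPair {L : Submodule ℤ E3} (hL : IsBravaisLattice L)
    (hvol : volume (wignerSeitz L) = 1) (hd : NoDipole L) (hq : NoQuadrupole L) :
    HasSum (fun z : L => indirectPair L z)
      (1 / 2 * (∑' z : L, screenedCoulomb L z + ∫ y, screenedCoulomb L y)) :=
  ((summable_screenedCoulomb hL hvol hd hq).hasSum.add (hasSum_setIntegral_screenedCoulomb hL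
    (integrable_screenedCoulomb hL hvol hd hq))).mul_left _

lemma convex_cube (r : ℝ) : Convex ℝ (cube r) := by
  have : cube r = ⋂ i, {x : E3 | |x i| ≤ r / 2} := by ext; simp [cube]
  rw [this]
  refine convex_iInter fun i => ?_
  have h2 : {x : E3 | |x i| ≤ r / 2} = (EuclideanSpace.proj i : E3 →L[ℝ] ℝ) ⁻¹'
      Set.Icc (-(r / 2)) (r / 2) := by
    ext x; simp [abs_le]
  rw [h2]
  exact (convex_Icc _ _).linear_preimage (EuclideanSpace.proj i : E3 →L[ℝ] ℝ).toLinearMap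

lemma isGrowingSequence_cube : IsGrowingSequence (fun n : ℕ => cube n) (cube 1) where
  isBounded := by
    refine isBounded_iff_forall_norm_le.2 ⟨√3, fun x hx => ?_⟩
    rw [EuclideanSpace.norm_eq]
    refine Real.sqrt_le_sqrt ?_
    calc ∑ i, ‖x i‖ ^ 2 ≤ ∑ i : Fin 3, (1 : ℝ) := by
          refine Finset.sum_le_sum fun i _ => ?_
          have := hx i
          rw [Real.norm_eq_abs]
          exact pow_le_one₀ (abs_nonneg _) (by linarith)
      _ = 3 := by simp
  nonempty_interior := by
    refine ⟨0, mem_interior_iff_mem_nhds.2 (Filter.mem_of_superset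
      (Metric.ball_mem_nhds 0 (by norm_num : (0 : ℝ) < 1 / 2)) fun x hx i => ?_)⟩
    have h1 : ‖x i‖ ≤ ‖x‖ := PiLp.norm_apply_le x i
    have h2 : ‖x‖ < 1 / 2 := by simpa using hx
    rw [Real.norm_eq_abs] at h1
    linarith
  frontier_null := (convex_cube 1).addHaar_frontier volume
  exists_dilation := by
    refine ⟨fun n => n, fun _ => IsometryEquiv.refl _, tendsto_natCast_atTop_atTop, fun n => ?_⟩
    change cube n = id '' ((n : ℝ) • cube 1)
    rw [Set.image_id]
    -- For `n = 0` both the cube and the dilated set are the single point at the origin.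
    rcases eq_or_ne (n : ℝ) 0 with h | h
    · rw [h, Set.zero_smul_set ⟨0, fun i => by simp⟩]
      ext x
      simp only [cube, zero_div, abs_nonpos_iff, Set.mem_ofPred_eq, Set.mem_zero]
      exact ⟨fun h => by ext i; simpa using h i, fun h i => by simp [h]⟩
    · ext x
      have hn : (0 : ℝ) < n := lt_of_le_of_ne (Nat.cast_nonneg n) h.symm
      rw [Set.mem_smul_set_iff_inv_smul_mem₀ h]
      simp only [cube, Set.mem_ofPred_eq, PiLp.smul_apply, smul_eq_mul, abs_mul, abs_inv,
        abs_of_pos hn, inv_mul_le_iff₀ hn]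
      exact forall_congr' fun i => by rw [mul_one_div]

lemma tendsto_jelliumPerParticle {L : Submodule ℤ E3} (hL : IsBravaisLattice L)
    (hvol : volume (wignerSeitz L) = 1) (hd : NoDipole L) (hq : NoQuadrupole L)
    {D : Set E3} {C : ℕ → Set E3} (h : IsGrowingSequence C D) :
    Tendsto (fun n => jelliumPerParticle L (C n)) atTop
      (𝓝 (1 / 2 * (∑' z : L, screenedCoulomb L z - ∫ y, screenedCoulomb L y))) := by
  have hs := hasSum_jelliumPair hL hvol hd hq
  have h1 := h.tendsto_pair_sum hL hvol hs.summable
  rw [hs.tsum_eq] at h1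
  exact h1.congr fun n => by rw [jelliumPerParticle, jelliumEnergy_eq_sum hL (h.isBounded_seq n)]

lemma eJel_eq {L : Submodule ℤ E3} (hL : IsBravaisLattice L)
    (hvol : volume (wignerSeitz L) = 1) (hd : NoDipole L) (hq : NoQuadrupole L) :
    eJel L = 1 / 2 * (∑' z : L, screenedCoulomb L z - ∫ y, screenedCoulomb L y) :=
  (tendsto_jelliumPerParticle hL hvol hd hq isGrowingSequence_cube).limUnder_eq

lemma tendsto_indirectPerParticle {L : Submodule ℤ E3} (hL : IsBravaisLattice L)
    (hvol : volume (wignerSeitz L) = 1) (hd : NoDipole L) (hq : NoQuadrupole L)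
    {D : Set E3} {C : ℕ → Set E3} (h : IsGrowingSequence C D) :
    Tendsto (fun n => indirectPerParticle L (C n)) atTop
      (𝓝 (eJel L + ∫ y, screenedCoulomb L y)) := by
  have hs := hasSum_indirectPair hL hvol hd hq
  have h1 := h.tendsto_pair_sum hL hvol hs.summable
  rw [hs.tsum_eq] at h1
  rw [eJel_eq hL hvol hd hq]
  convert h1 using 2 with n
  · rw [indirectPerParticle, indirectEnergy_latticeState hL hvol (h.isBounded_seq n)]
  · ring

/-! ### The Gaussian representation of the Coulomb kernel -/

/-- The form of Tonelli's theorem behind the later interchanges of integrals: for a nonnegative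
kernel, one finite iterated integral suffices. -/
lemma integrable_uncurry_of_nonneg {α β : Type*} [MeasurableSpace α] [MeasurableSpace β]
    {μ : Measure α} {ν : Measure β} [SFinite μ] [SFinite ν] {f : α → β → ℝ}
    (hm : Measurable (Function.uncurry f)) (h0 : ∀ x y, 0 ≤ f x y)
    (h1 : ∀ᵐ y ∂ν, Integrable (fun x => f x y) μ)
    (h2 : Integrable (fun y => ∫ x, f x y ∂μ) ν) :
    Integrable (Function.uncurry f) (μ.prod ν) := by
  rw [integrable_prod_iff' hm.aestronglyMeasurable]
  refine ⟨h1, h2.congr (.of_forall fun y => ?_)⟩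
  exact integral_congr_ae (.of_forall fun x => (Real.norm_of_nonneg (h0 x y)).symm)

/-- The Gaussian of width parameter `u`, with the weight that makes the Coulomb kernel
`∫ u in (0, ∞), heat u x = 1 / ‖x‖`. -/
noncomputable def heat (u : ℝ) (x : E3) : ℝ := 1 / √u * Real.exp (-Real.pi * u * ‖x‖ ^ 2)

lemma heat_nonneg (u : ℝ) (x : E3) : 0 ≤ heat u x := by unfold heat; positivity

lemma integrableOn_sq_inv_sqrt_mul_exp {r : ℝ} (hr : 0 < r) :
    IntegrableOn (fun u => 1 / √u * Real.exp (-Real.pi * u * r ^ 2)) (Set.Ioi 0) ∧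
    ∫ u in Set.Ioi 0, 1 / √u * Real.exp (-Real.pi * u * r ^ 2) = 1 / r := by
  have h := Real.integral_rpow_mul_exp_neg_mul_Ioi (a := 1 / 2) (r := Real.pi * r ^ 2)
    (by norm_num) (by positivity)
  have hcongr : ∀ u ∈ Set.Ioi (0 : ℝ), u ^ ((1 / 2 : ℝ) - 1) * Real.exp (-(Real.pi * r ^ 2 * u)) =
      1 / √u * Real.exp (-Real.pi * u * r ^ 2) := fun u hu => by
    rw [Real.sqrt_eq_rpow, one_div (u ^ _), ← Real.rpow_neg (le_of_lt hu)]
    norm_num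
    left; ring
  rw [setIntegral_congr_fun measurableSet_Ioi hcongr] at h
  have hval : (1 / (Real.pi * r ^ 2)) ^ (1 / 2 : ℝ) * Real.Gamma (1 / 2) = 1 / r := by
    rw [Real.Gamma_one_half_eq, ← Real.sqrt_eq_rpow, Real.sqrt_div zero_le_one, Real.sqrt_one,
      Real.sqrt_mul Real.pi_pos.le, Real.sqrt_sq hr.le]
    have := Real.sqrt_pos.2 Real.pi_pos
    field_simp
  rw [hval] at h
  refine ⟨?_, h⟩
  -- The integral of a non-integrable function is zero by convention, so a positive value proves
  -- integrability.
  by_contra hn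
  rw [integral_undef hn] at h
  have : 0 < 1 / r := by positivity
  linarith

lemma integrableOn_heat {x : E3} (hx : x ≠ 0) : IntegrableOn (fun u => heat u x) (Set.Ioi 0) :=
  (integrableOn_sq_inv_sqrt_mul_exp (norm_pos_iff.2 hx)).1

lemma setIntegral_heat {x : E3} (hx : x ≠ 0) : ∫ u in Set.Ioi 0, heat u x = 1 / ‖x‖ :=
  (integrableOn_sq_inv_sqrt_mul_exp (norm_pos_iff.2 hx)).2

lemma gaussian_integrable {b : ℝ} (hb : 0 < b) :
    Integrable (fun x : E3 => Real.exp (-Real.pi * b * ‖x‖ ^ 2)) ∧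
    ∫ x : E3, Real.exp (-Real.pi * b * ‖x‖ ^ 2) = 1 / (b * √b) := by
  have h := GaussianFourier.integral_rexp_neg_mul_sq_norm (V := E3) (b := Real.pi * b)
    (by positivity)
  have hval : (Real.pi / (Real.pi * b)) ^ ((Module.finrank ℝ E3 : ℝ) / 2) = 1 / (b * √b) := by
    rw [div_mul_cancel_left₀ Real.pi_pos.ne', finrank_euclideanSpace, Fintype.card_fin,
      show ((3 : ℕ) : ℝ) / 2 = 1 + 1 / 2 by norm_num, Real.rpow_add (by positivity), Real.rpow_one,
      ← Real.sqrt_eq_rpow, Real.sqrt_inv]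
    field_simp
  rw [hval] at h
  simp only [← neg_mul] at h
  refine ⟨?_, h⟩
  by_contra hn
  rw [integral_undef hn] at h
  have : 0 < 1 / (b * √b) := by positivity
  linarith

lemma integrable_heat {u : ℝ} (hu : 0 < u) : Integrable (heat u) :=
  (gaussian_integrable hu).1.const_mul _

lemma integral_heat {u : ℝ} (hu : 0 < u) : ∫ x, heat u x = 1 / u ^ 2 := by
  unfold heat
  rw [integral_const_mul, (gaussian_integrable hu).2, div_mul_div_comm, one_mul]
  congr 1
  rw [← mul_assoc, mul_comm (√u) u, mul_assoc, Real.mul_self_sqrt hu.le, sq]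

/-! ### The integral of the screened potential -/

lemma complete_square {ε u : ℝ} (h : ε + u ≠ 0) (x y : E3) :
    ε * ‖x‖ ^ 2 + u * ‖x - y‖ ^ 2 =
      (ε + u) * ‖x - (u / (ε + u)) • y‖ ^ 2 + ε * u / (ε + u) * ‖y‖ ^ 2 := by
  rw [norm_sub_sq_real, norm_sub_sq_real, inner_smul_right, norm_smul, mul_pow, Real.norm_eq_abs,
    sq_abs]
  field_simp
  ring

lemma integral_gaussian_mul_heat {ε u : ℝ} (hε : 0 < ε) (hu : 0 < u) (y : E3) :
    ∫ x : E3, heat u (x - y) * Real.exp (-Real.pi * ε * ‖x‖ ^ 2) =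
      1 / √u * (1 / ((ε + u) * √(ε + u))) *
        Real.exp (-(Real.pi * (ε * u / (ε + u)) * ‖y‖ ^ 2)) := by
  have h : ∀ x : E3, heat u (x - y) * Real.exp (-Real.pi * ε * ‖x‖ ^ 2) =
      1 / √u * Real.exp (-(Real.pi * (ε * u / (ε + u)) * ‖y‖ ^ 2)) *
        Real.exp (-Real.pi * (ε + u) * ‖x - (u / (ε + u)) • y‖ ^ 2) := fun x => by
    rw [heat, mul_assoc (1 / √u), mul_assoc (1 / √u), ← Real.exp_add, ← Real.exp_add]
    congr 2
    linear_combination -Real.pi * complete_square (show ε + u ≠ 0 by positivity) x y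
  simp_rw [h]
  rw [integral_const_mul,
    integral_sub_right_eq_self (fun x : E3 => Real.exp (-Real.pi * (ε + u) * ‖x‖ ^ 2)),
    (gaussian_integrable (by positivity)).2]
  ring

/-- The Coulomb potential of a Gaussian charge distribution. -/
noncomputable def gaussianPotential (ε : ℝ) (y : E3) : ℝ :=
  ∫ x : E3, Real.exp (-Real.pi * ε * ‖x‖ ^ 2) * (1 / ‖x - y‖)

lemma integrable_gaussian_mul_coulomb {ε : ℝ} (hε : 0 < ε) (y : E3) :
    Integrable fun x : E3 => Real.exp (-Real.pi * ε * ‖x‖ ^ 2) * (1 / ‖x - y‖) := by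
  have h1 := (integrable_indicator_coulomb.comp_sub_right y).add (gaussian_integrable hε).1
  refine h1.mono' (Measurable.aestronglyMeasurable (by fun_prop)) (.of_forall fun x => ?_)
  rw [Real.norm_of_nonneg (by positivity)]
  have h2 := coulomb_le_indicator (x - y)
  have h3 : 0 ≤ (Metric.ball (0 : E3) 1).indicator (fun x => 1 / ‖x‖) (x - y) :=
    Set.indicator_nonneg (fun _ _ => by positivity) _
  have h4 : Real.exp (-Real.pi * ε * ‖x‖ ^ 2) ≤ 1 := Real.exp_le_one_iff.2 (by
    have : 0 ≤ Real.pi * ε * ‖x‖ ^ 2 := by positivity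
    linarith)
  have h5 := Real.exp_pos (-Real.pi * ε * ‖x‖ ^ 2)
  calc _ ≤ Real.exp (-Real.pi * ε * ‖x‖ ^ 2) *
        ((Metric.ball (0 : E3) 1).indicator (fun x => 1 / ‖x‖) (x - y) + 1) := by gcongr
    _ ≤ _ := by
      simp only [Pi.add_apply]
      nlinarith

lemma gaussianPotential_eq {ε : ℝ} (hε : 0 < ε) (y : E3) :
    IntegrableOn (fun u => 1 / √u * (1 / ((ε + u) * √(ε + u))) *
      Real.exp (-(Real.pi * (ε * u / (ε + u)) * ‖y‖ ^ 2))) (Set.Ioi 0) ∧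
    gaussianPotential ε y = ∫ u in Set.Ioi 0, 1 / √u * (1 / ((ε + u) * √(ε + u))) *
      Real.exp (-(Real.pi * (ε * u / (ε + u)) * ‖y‖ ^ 2)) := by
  have hae : ∀ᵐ x : E3, x - y ≠ 0 := by
    filter_upwards [compl_mem_ae_iff.2 (measure_singleton y)] with x hx
    exact sub_ne_zero.2 hx
  have hint : ∀ᵐ x : E3, ∫ u in Set.Ioi 0, heat u (x - y) * Real.exp (-Real.pi * ε * ‖x‖ ^ 2) =
      Real.exp (-Real.pi * ε * ‖x‖ ^ 2) * (1 / ‖x - y‖) := by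
    filter_upwards [hae] with x hx
    rw [integral_mul_const, setIntegral_heat hx, mul_comm]
  have hm : Measurable (Function.uncurry fun (u : ℝ) (x : E3) =>
      heat u (x - y) * Real.exp (-Real.pi * ε * ‖x‖ ^ 2)) := by
    unfold heat Function.uncurry
    fun_prop
  have hprod := integrable_uncurry_of_nonneg (μ := volume.restrict (Set.Ioi (0 : ℝ)))
    (ν := (volume : Measure E3)) hm
    (fun u x => mul_nonneg (heat_nonneg _ _) (Real.exp_pos _).le)
    (by filter_upwards [hae] with x hx using (integrableOn_heat hx).mul_const _)
    ((integrable_gaussian_mul_coulomb hε y).congr (by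
      filter_upwards [hint] with x hx using hx.symm))
  have hc : ∀ u ∈ Set.Ioi (0 : ℝ),
      ∫ x : E3, heat u (x - y) * Real.exp (-Real.pi * ε * ‖x‖ ^ 2) = _ :=
    fun u hu => integral_gaussian_mul_heat hε hu y
  constructor
  · have := hprod.integral_prod_left
    simp only [Function.uncurry] at this
    exact IntegrableOn.congr_fun this hc measurableSet_Ioi
  · rw [← setIntegral_congr_fun measurableSet_Ioi hc, integral_integral_swap hprod,
      gaussianPotential]
    exact integral_congr_ae (by filter_upwards [hint] with x hx using hx.symm)

lemma integral_sqrt_ratio {ε : ℝ} (hε : 0 < ε) :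
    -- The antiderivative is `2 / 3 * (u / (ε + u)) ^ (3 / 2)`, so the value does not depend on `ε`.
    IntegrableOn (fun u => √(u / (ε + u)) * (ε / (ε + u) ^ 2)) (Set.Ioi 0) ∧
    ∫ u in Set.Ioi 0, √(u / (ε + u)) * (ε / (ε + u) ^ 2) = 2 / 3 := by
  have hcont : ContinuousWithinAt (fun u => 2 / 3 * √(u / (ε + u)) ^ 3) (Set.Ici 0) 0 := by
    refine ContinuousAt.continuousWithinAt ?_
    have : ContinuousAt (fun u => u / (ε + u)) 0 :=
      continuousAt_id.div (by fun_prop) (by simpa using hε.ne')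
    exact continuousAt_const.mul ((Real.continuous_sqrt.continuousAt.comp this).pow 3)
  have hderiv : ∀ u ∈ Set.Ioi (0 : ℝ), HasDerivAt (fun u => 2 / 3 * √(u / (ε + u)) ^ 3)
      (√(u / (ε + u)) * (ε / (ε + u) ^ 2)) u := by
    intro u hu
    have hu : 0 < u := hu
    have hpos : 0 < u / (ε + u) := by positivity
    have h1 : HasDerivAt (fun u => u / (ε + u)) ((1 * (ε + u) - u * 1) / (ε + u) ^ 2) u :=
      (hasDerivAt_id u).div ((hasDerivAt_id u).const_add ε) (by positivity)
    have h2 := ((h1.sqrt hpos.ne').pow 3).const_mul (2 / 3)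
    refine HasDerivAt.congr_deriv h2 ?_
    have h3 : √(u / (ε + u)) ≠ 0 := (Real.sqrt_pos.2 hpos).ne'
    push_cast
    field_simp
    ring
  have hpos : ∀ u ∈ Set.Ioi (0 : ℝ), 0 ≤ √(u / (ε + u)) * (ε / (ε + u) ^ 2) := fun u hu => by
    have hu : 0 < u := hu
    positivity
  have hlim : Tendsto (fun u => 2 / 3 * √(u / (ε + u)) ^ 3) atTop (𝓝 (2 / 3)) := by
    have h1 : Tendsto (fun u : ℝ => 1 - ε / (ε + u)) atTop (𝓝 (1 - 0)) :=
      tendsto_const_nhds.sub (tendsto_const_nhds.div_atTop (tendsto_atTop_add_const_left _ _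
        tendsto_id))
    have h2 : Tendsto (fun u : ℝ => u / (ε + u)) atTop (𝓝 1) := by
      rw [sub_zero] at h1
      refine h1.congr' ?_
      filter_upwards [eventually_gt_atTop 0] with u hu
      have : ε + u ≠ 0 := by positivity
      field_simp; ring
    have h3 := (((Real.continuous_sqrt.tendsto 1).comp h2).pow 3).const_mul (2 / 3)
    simpa using h3
  refine ⟨integrableOn_Ioi_deriv_of_nonneg hcont hderiv hpos hlim, ?_⟩
  rw [integral_Ioi_of_hasDerivAt_of_nonneg hcont hderiv hpos hlim]
  simp

lemma one_sub_exp_neg_bounds {a : ℝ} (ha : 0 ≤ a) :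
    1 - Real.exp (-a) ≤ a ∧ a - a ^ 2 / 2 ≤ 1 - Real.exp (-a) := by
  constructor
  · linarith [Real.add_one_le_exp (-a)]
  · have h := Real.quadratic_le_exp_of_nonneg ha
    have h2 : 0 < 1 + a + a ^ 2 / 2 := by positivity
    have h3 : Real.exp (-a) ≤ 1 / (1 + a + a ^ 2 / 2) := by
      rw [Real.exp_neg, inv_eq_one_div]; gcongr
    have h4 : 1 / (1 + a + a ^ 2 / 2) ≤ 1 - a + a ^ 2 / 2 := by
      rw [div_le_iff₀ h2]; nlinarith [pow_nonneg ha 4]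
    linarith

/-- In the integral over `u` the difference of potentials is a weight times `1 - exp (-a)` with `a =
π * ε * ‖y‖ ^ 2 * u / (ε + u)`. The part linear in `a` integrates exactly to `2π‖y‖²/3` for every
`ε`, and the remainder, at most `a ^ 2 / 2`, costs one more factor `ε`. -/
lemma abs_gaussianPotential_sub_le {ε : ℝ} (hε : 0 < ε) (y : E3) :
    |gaussianPotential ε 0 - gaussianPotential ε y - 2 * Real.pi / 3 * ‖y‖ ^ 2| ≤
      ε * (Real.pi ^ 2 * ‖y‖ ^ 4) := by
  obtain ⟨hi0, h0⟩ := gaussianPotential_eq hε 0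
  obtain ⟨hiy, hy⟩ := gaussianPotential_eq hε y
  obtain ⟨hir, hr⟩ := integral_sqrt_ratio hε
  have hval : 2 * Real.pi / 3 * ‖y‖ ^ 2 = ∫ u in Set.Ioi 0,
      Real.pi * ‖y‖ ^ 2 * (√(u / (ε + u)) * (ε / (ε + u) ^ 2)) := by
    rw [integral_const_mul, hr]; ring
  have hbound : ε * (Real.pi ^ 2 * ‖y‖ ^ 4) / 3 = ∫ u in Set.Ioi 0,
      Real.pi ^ 2 * ‖y‖ ^ 4 * ε / 2 * (√(u / (ε + u)) * (ε / (ε + u) ^ 2)) := by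
    rw [integral_const_mul, hr]; ring
  have hi : IntegrableOn (fun u => 1 / √u * (1 / ((ε + u) * √(ε + u))) *
      Real.exp (-(Real.pi * (ε * u / (ε + u)) * ‖(0 : E3)‖ ^ 2)) -
      1 / √u * (1 / ((ε + u) * √(ε + u))) *
      Real.exp (-(Real.pi * (ε * u / (ε + u)) * ‖y‖ ^ 2))) (Set.Ioi 0) := hi0.sub hiy
  rw [h0, hy, hval, ← integral_sub hi0 hiy, ← integral_sub hi (hir.const_mul _),
    ← Real.norm_eq_abs]
  refine (norm_integral_le_of_norm_le (hir.const_mul (Real.pi ^ 2 * ‖y‖ ^ 4 * ε / 2)) ?_).trans ?_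
  · refine ae_restrict_of_forall_mem measurableSet_Ioi fun u hu => ?_
    have hu : 0 < u := hu
    set v := u / (ε + u) with hv
    have hv0 : 0 < v := by positivity
    have hv1 : v ≤ 1 := div_le_one_of_le₀ (by linarith) (by positivity)
    have hw : ε * u / (ε + u) = ε * v := by rw [hv]; ring
    have hpre : 1 / √u * (1 / ((ε + u) * √(ε + u))) * v = √v * (1 / (ε + u) ^ 2) := by
      rw [hv, Real.sqrt_div hu.le]
      have h1 : 0 < √u := Real.sqrt_pos.2 hu
      have h2 : 0 < √(ε + u) := Real.sqrt_pos.2 (by positivity)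
      field_simp
      rw [Real.sq_sqrt hu.le]
    set c := 1 / √u * (1 / ((ε + u) * √(ε + u))) with hc
    have hc0 : 0 ≤ c := by positivity
    set a := Real.pi * (ε * v) * ‖y‖ ^ 2 with ha
    have ha0 : 0 ≤ a := by positivity
    obtain ⟨b1, b2⟩ := one_sub_exp_neg_bounds ha0
    have e1 : Real.pi * ‖y‖ ^ 2 * (√v * (ε / (ε + u) ^ 2)) = c * a := by
      have : √v * (ε / (ε + u) ^ 2) = ε * (c * v) := by rw [hpre]; ring
      rw [this, ha]; ring
    have e2 : c * (a ^ 2 / 2) ≤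
        Real.pi ^ 2 * ‖y‖ ^ 4 * ε / 2 * (√v * (ε / (ε + u) ^ 2)) := by
      have h1 : √v * (ε / (ε + u) ^ 2) = ε * (c * v) := by rw [hpre]; ring
      have h2 : c * (a ^ 2 / 2) =
        Real.pi ^ 2 * ‖y‖ ^ 4 * ε / 2 * (ε * (c * v)) * v := by rw [ha]; ring
      rw [h1, h2]
      exact mul_le_of_le_one_right (by positivity) hv1
    rw [hw, e1, norm_zero, Real.norm_eq_abs]
    have e3 : c * Real.exp (-(Real.pi * (ε * v) * 0 ^ 2)) - c * Real.exp (-a) - c * a =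
        -(c * (a - (1 - Real.exp (-a)))) := by simp; ring
    rw [e3, abs_neg, abs_of_nonneg (mul_nonneg hc0 (by linarith))]
    refine le_trans ?_ e2
    gcongr
    linarith
  · rw [← hbound]
    have : 0 ≤ ε * (Real.pi ^ 2 * ‖y‖ ^ 4) := by positivity
    linarith

lemma integral_gaussian_mul_screenedCoulomb {L : Submodule ℤ E3} (hL : IsBravaisLattice L)
    {ε : ℝ} (hε : 0 < ε) :
    IntegrableOn (gaussianPotential ε) (wignerSeitz L) ∧
    ∫ x : E3, Real.exp (-Real.pi * ε * ‖x‖ ^ 2) * screenedCoulomb L x =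
      gaussianPotential ε 0 - ∫ y in wignerSeitz L, gaussianPotential ε y := by
  have hQ := volume_wignerSeitz_lt_top hL
  have hiU : Integrable fun x : E3 =>
      Real.exp (-Real.pi * ε * ‖x‖ ^ 2) * uniformPotential (wignerSeitz L) x := by
    refine (gaussian_integrable hε).1.mul_bdd (c := coulombBall + volume.real (wignerSeitz L))
      (measurable_uniformPotential _).aestronglyMeasurable
      (.of_forall fun x => ?_)
    rw [Real.norm_of_nonneg (uniformPotential_nonneg _ _)]
    exact uniformPotential_le hQ x
  have hm : Measurable (Function.uncurry fun (y : E3) (x : E3) =>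
      Real.exp (-Real.pi * ε * ‖x‖ ^ 2) * (1 / ‖x - y‖)) := by
    unfold Function.uncurry
    fun_prop
  have hUx : ∀ x : E3, ∫ y in wignerSeitz L,
      Real.exp (-Real.pi * ε * ‖x‖ ^ 2) * (1 / ‖x - y‖) =
      Real.exp (-Real.pi * ε * ‖x‖ ^ 2) * uniformPotential (wignerSeitz L) x := fun x => by
    rw [integral_const_mul, uniformPotential]
  have hprod := integrable_uncurry_of_nonneg (μ := volume.restrict (wignerSeitz L))
    (ν := (volume : Measure E3)) hm (fun y x => by positivity)
    (.of_forall fun x => (integrableOn_coulomb hQ x).const_mul _)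
    (by simpa only [hUx] using hiU)
  refine ⟨hprod.integral_prod_left, ?_⟩
  have h0 := integrable_gaussian_mul_coulomb hε 0
  simp only [sub_zero] at h0
  simp_rw [screenedCoulomb_eq, mul_sub]
  rw [integral_sub h0 hiU]
  congr 1
  · simp [gaussianPotential]
  · simp_rw [← hUx]
    exact (integral_integral_swap hprod).symm

theorem integral_screenedCoulomb {L : Submodule ℤ E3} (hL : IsBravaisLattice L)
    (hvol : volume (wignerSeitz L) = 1) (hW : Integrable (screenedCoulomb L)) :
    ∫ y, screenedCoulomb L y = 2 * Real.pi / 3 * ∫ x in wignerSeitz L, ‖x‖ ^ 2 := by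
  have hp : IsProbabilityMeasure (volume.restrict (wignerSeitz L)) := ⟨by simpa using hvol⟩
  have hε : Tendsto (fun n : ℕ => 1 / ((n : ℝ) + 1)) atTop (𝓝 0) :=
    tendsto_one_div_add_atTop_nhds_zero_nat
  have h1 : Tendsto (fun n : ℕ => ∫ x : E3,
      Real.exp (-Real.pi * (1 / ((n : ℝ) + 1)) * ‖x‖ ^ 2) * screenedCoulomb L x) atTop
      (𝓝 (∫ y, screenedCoulomb L y)) := by
    -- Integrability of `W` allows the Gaussian factor to be removed as its width grows, here with
    -- `ε = 1 / (n + 1)`.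
    refine tendsto_integral_of_dominated_convergence (fun x => ‖screenedCoulomb L x‖)
      (fun n => ?_) hW.norm (fun n => .of_forall fun x => ?_) (.of_forall fun x => ?_)
    · have := measurable_screenedCoulomb L
      exact Measurable.aestronglyMeasurable (by fun_prop)
    · rw [norm_mul]
      refine mul_le_of_le_one_left (norm_nonneg _) ?_
      rw [Real.norm_of_nonneg (Real.exp_pos _).le]
      refine Real.exp_le_one_iff.2 ?_
      have : 0 ≤ Real.pi * (1 / ((n : ℝ) + 1)) * ‖x‖ ^ 2 := by positivity
      linarith
    · have h2 : Tendsto (fun n : ℕ => Real.exp (-Real.pi * (1 / ((n : ℝ) + 1)) * ‖x‖ ^ 2)) atTop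
          (𝓝 (Real.exp (-Real.pi * 0 * ‖x‖ ^ 2))) :=
        (Real.continuous_exp.tendsto _).comp ((hε.const_mul _).mul_const _)
      simpa using h2.mul_const (screenedCoulomb L x)
  refine tendsto_nhds_unique h1 ?_
  set M := ∫ y in wignerSeitz L, Real.pi ^ 2 * ‖y‖ ^ 4 with hM
  have hi2 : IntegrableOn (fun y : E3 => 2 * Real.pi / 3 * ‖y‖ ^ 2) (wignerSeitz L) :=
    hL.integrableOn_of_continuous (by fun_prop)
  have hi4 : IntegrableOn (fun y : E3 => Real.pi ^ 2 * ‖y‖ ^ 4) (wignerSeitz L) :=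
    hL.integrableOn_of_continuous (by fun_prop)
  rw [tendsto_iff_norm_sub_tendsto_zero]
  refine squeeze_zero (fun n => norm_nonneg _) (fun n => ?_)
    (g := fun n : ℕ => 1 / ((n : ℝ) + 1) * M) (by simpa using hε.mul_const M)
  have hn : 0 < 1 / ((n : ℝ) + 1) := by positivity
  set ε := 1 / ((n : ℝ) + 1)
  obtain ⟨hi, he⟩ := integral_gaussian_mul_screenedCoulomb hL hn
  have hi3 : IntegrableOn (fun y => gaussianPotential ε 0 - gaussianPotential ε y)
      (wignerSeitz L) := (integrable_const _).sub hi
  have he2 : gaussianPotential ε 0 - ∫ y in wignerSeitz L, gaussianPotential ε y =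
      ∫ y in wignerSeitz L, (gaussianPotential ε 0 - gaussianPotential ε y) := by
    rw [integral_sub (integrable_const _) hi]; simp
  rw [he, he2, ← integral_const_mul, ← integral_sub hi3 hi2, hM, ← integral_const_mul]
  exact norm_integral_le_of_norm_le (hi4.const_mul _)
    (.of_forall fun y => abs_gaussianPotential_sub_le hn y)

/-! ### The shift as a limit in Fourier space -/

lemma norm_one_sub_cexp_sub_le {θ : ℝ} (hθ : |θ| ≤ 1) :
    ‖1 - Complex.exp (-Complex.I * θ) - (Complex.I * θ + (θ : ℂ) ^ 2 / 2)‖ ≤ |θ| ^ 3 := by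
  have hn : ‖-Complex.I * (θ : ℂ)‖ = |θ| := by simp
  have h := Complex.exp_bound (x := -Complex.I * θ) (by rw [hn]; exact hθ) (n := 3) (by norm_num)
  rw [hn] at h
  simp only [Finset.sum_range_succ, Finset.sum_range_zero, Nat.factorial, mul_pow, neg_sq,
    Complex.I_sq] at h
  rw [norm_sub_rev] at h
  -- `4 / 18` is the constant `(n + 1) / (n ! * n)` of `Complex.exp_bound` at `n = 3`.
  have h2 : |θ| ^ 3 * ((4 : ℝ) * (18 : ℝ)⁻¹) ≤ |θ| ^ 3 :=
    mul_le_of_le_one_right (by positivity) (by norm_num)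
  refine le_trans (le_of_eq ?_) (h.trans (le_trans (le_of_eq ?_) h2))
  · congr 1; push_cast; ring
  · norm_num

/-- Expand `1 - exp (-iθ) = iθ + θ²/2 + O(|θ|³)` at `θ = ⟪k, x⟫`. The dipole condition removes the
linear term, and isotropy of the second moment `M` turns the quadratic one into `‖k‖ ^ 2 * M / 6`.
The remainder is of order `‖k‖` after division by `‖k‖ ^ 2`. -/
lemma tendsto_fourier_shift {L : Submodule ℤ E3} (hL : IsBravaisLattice L)
    (hvol : volume (wignerSeitz L) = 1) (hd : NoDipole L) (hq : NoQuadrupole L) :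
    Tendsto (fun k : E3 => (4 * Real.pi * (‖k‖ ^ 2)⁻¹ : ℂ) *
      (1 - (∫ x in wignerSeitz L, Complex.exp (-Complex.I * (⟪k, x⟫ : ℝ))))) (𝓝[≠] 0)
      (𝓝 ((2 * Real.pi / 3 * ∫ x in wignerSeitz L, ‖x‖ ^ 2 : ℝ) : ℂ)) := by
  obtain ⟨ρ, hρ, hQ⟩ := hL.exists_norm_le_of_mem_wignerSeitz
  have hp : IsProbabilityMeasure (volume.restrict (wignerSeitz L)) := ⟨by simpa using hvol⟩
  set M := ∫ x in wignerSeitz L, ‖x‖ ^ 2 with hM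
  rw [tendsto_iff_norm_sub_tendsto_zero]
  have hlim : Tendsto (fun k : E3 => 4 * Real.pi * ρ ^ 3 * ‖k‖) (𝓝[≠] 0) (𝓝 0) := by
    have : Tendsto (fun k : E3 => 4 * Real.pi * ρ ^ 3 * ‖k‖) (𝓝 0)
        (𝓝 (4 * Real.pi * ρ ^ 3 * ‖(0 : E3)‖)) := (continuous_const.mul continuous_norm).tendsto 0
    simp only [norm_zero, mul_zero] at this
    exact this.mono_left nhdsWithin_le_nhds
  refine squeeze_zero' (.of_forall fun k => norm_nonneg _) ?_ hlim
  have hball : ∀ᶠ k : E3 in 𝓝[≠] 0, ‖k‖ < 1 / ρ :=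
    nhdsWithin_le_nhds (by
      filter_upwards [Metric.ball_mem_nhds (0 : E3) (show 0 < 1 / ρ by positivity)] with k hk
      simpa using hk)
  filter_upwards [hball, self_mem_nhdsWithin] with k hk hk0
  have hk0 : 0 < ‖k‖ := norm_pos_iff.2 hk0
  have hi1 : IntegrableOn (fun x : E3 => Complex.exp (-Complex.I * (⟪k, x⟫ : ℝ))) (wignerSeitz L) :=
    hL.integrableOn_of_continuous (by fun_prop)
  have hi2 : IntegrableOn (fun x : E3 => Complex.I * (⟪k, x⟫ : ℝ)) (wignerSeitz L) :=
    hL.integrableOn_of_continuous (by fun_prop)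
  have hi3 : IntegrableOn (fun x : E3 => ((⟪k, x⟫ : ℝ) : ℂ) ^ 2 / 2) (wignerSeitz L) :=
    hL.integrableOn_of_continuous (by fun_prop)
  have hi4 : IntegrableOn (fun x : E3 => 1 - Complex.exp (-Complex.I * (⟪k, x⟫ : ℝ)))
    (wignerSeitz L) := (integrable_const _).sub hi1
  have hi5 : IntegrableOn (fun x : E3 => Complex.I * (⟪k, x⟫ : ℝ) + ((⟪k, x⟫ : ℝ) : ℂ) ^ 2 / 2)
    (wignerSeitz L) := hi2.add hi3
  have h1 : (1 - ∫ x in wignerSeitz L, Complex.exp (-Complex.I * (⟪k, x⟫ : ℝ))) =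
      ∫ x in wignerSeitz L, (1 - Complex.exp (-Complex.I * (⟪k, x⟫ : ℝ))) := by
    rw [integral_sub (integrable_const _) hi1]; simp
  have h2 : ∫ x in wignerSeitz L, (Complex.I * (⟪k, x⟫ : ℝ) + ((⟪k, x⟫ : ℝ) : ℂ) ^ 2 / 2) =
      ((‖k‖ ^ 2 * M / 6 : ℝ) : ℂ) := by
    rw [integral_add hi2 hi3, integral_const_mul, integral_div, integral_complex_ofReal,
      integral_inner_wignerSeitz hL hd]
    simp_rw [← Complex.ofReal_pow]
    rw [integral_complex_ofReal, integral_inner_sq_wignerSeitz hL hq]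
    push_cast
    ring
  have h3 := norm_setIntegral_le_of_norm_le_const (volume_wignerSeitz_lt_top hL)
    (f := fun x : E3 => (1 - Complex.exp (-Complex.I * (⟪k, x⟫ : ℝ))) -
      (Complex.I * (⟪k, x⟫ : ℝ) + ((⟪k, x⟫ : ℝ) : ℂ) ^ 2 / 2)) (C := (‖k‖ * ρ) ^ 3) fun x hx => by
    have hθ : |(⟪k, x⟫ : ℝ)| ≤ ‖k‖ * ρ :=
      (abs_real_inner_le_norm k x).trans (by gcongr; exact hQ x hx)
    have hkρ : ‖k‖ * ρ ≤ 1 := by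
      rw [lt_div_iff₀ hρ] at hk; exact hk.le
    exact (norm_one_sub_cexp_sub_le (hθ.trans hkρ)).trans (by gcongr)
  rw [integral_sub hi4 hi5, ← h1, h2] at h3
  simp only [Measure.real, hvol, ENNReal.toReal_one, mul_one] at h3
  have h4 : (4 * Real.pi * (‖k‖ ^ 2)⁻¹ : ℂ) *
      (1 - (∫ x in wignerSeitz L, Complex.exp (-Complex.I * (⟪k, x⟫ : ℝ)))) -
      ((2 * Real.pi / 3 * M : ℝ) : ℂ) = ((4 * Real.pi * (‖k‖ ^ 2)⁻¹ : ℝ) : ℂ) *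
      (1 - (∫ x in wignerSeitz L, Complex.exp (-Complex.I * (⟪k, x⟫ : ℝ))) -
        ((‖k‖ ^ 2 * M / 6 : ℝ) : ℂ)) := by
    have : (‖k‖ : ℂ) ≠ 0 := by exact_mod_cast hk0.ne'
    push_cast
    field_simp
    ring
  rw [h4, norm_mul, Complex.norm_real, Real.norm_of_nonneg (by positivity)]
  calc _ ≤ 4 * Real.pi * (‖k‖ ^ 2)⁻¹ * (‖k‖ * ρ) ^ 3 := by gcongr
    _ = _ := by field_simp

lemma integral_norm_sq_wignerSeitz_pos {L : Submodule ℤ E3} (hL : IsBravaisLattice L)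
    (hvol : volume (wignerSeitz L) = 1) : 0 < ∫ x in wignerSeitz L, ‖x‖ ^ 2 := by
  rw [setIntegral_pos_iff_support_of_nonneg_ae (.of_forall fun x => by positivity)
    (hL.integrableOn_of_continuous (by fun_prop))]
  have h : (Function.support fun x : E3 => ‖x‖ ^ 2) = {0}ᶜ := by ext; simp
  rw [h, Set.inter_comm, ← Set.sdiff_eq, measure_sdiff_null (measure_singleton _), hvol]
  exact one_pos

/-! ### The body-centered cubic lattice -/

/-- Half of the side length of the cubic cell of the body-centered cubic lattice. -/
noncomputable def bccScale : ℝ := (4 : ℝ) ^ (-(1 / 3) : ℝ)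

lemma bccScale_pos : 0 < bccScale := by unfold bccScale; positivity

lemma bccScale_cube : bccScale ^ 3 = 1 / 4 := by
  rw [bccScale, ← Real.rpow_natCast, ← Real.rpow_mul (by norm_num)]
  norm_num [Real.rpow_neg]

/-- The generators of the body-centered cubic lattice. -/
noncomputable def bccVec (i : Fin 3) : E3 :=
  bccScale • (![!₂[-1, 1, 1], !₂[1, -1, 1], !₂[1, 1, -1]] i : E3)

lemma bcc_eq_span : bcc = Submodule.span ℤ (Set.range bccVec) := rfl

lemma det_bccVec :
    (EuclideanSpace.basisFun (Fin 3) ℝ).toBasis.det bccVec = 1 := by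
  rw [Module.Basis.det_apply, Matrix.det_fin_three]
  simp only [Module.Basis.toMatrix_apply, OrthonormalBasis.coe_toBasis_repr_apply,
    EuclideanSpace.basisFun_repr, bccVec, PiLp.smul_apply, smul_eq_mul]
  simp
  linear_combination 4 * bccScale_cube

lemma bccVec_basis : ∃ b : Module.Basis (Fin 3) ℝ E3, ⇑b = bccVec := by
  have h := ((EuclideanSpace.basisFun (Fin 3) ℝ).toBasis.is_basis_iff_det (v := bccVec)).2
    (by rw [det_bccVec]; exact isUnit_one)
  exact ⟨Module.Basis.mk h.1 h.2.ge, Module.Basis.coe_mk _ _⟩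

lemma isBravaisLattice_bcc : IsBravaisLattice bcc := by
  obtain ⟨b, hb⟩ := bccVec_basis
  exact ⟨b, by rw [bcc_eq_span, hb]⟩

/-- All fundamental domains of a lattice have the same volume, so the cell can be exchanged for the
parallelepiped of the basis. -/
lemma IsBravaisLattice.volume_wignerSeitz_eq (b : Module.Basis (Fin 3) ℝ E3) :
    volume (wignerSeitz (Submodule.span ℤ (Set.range b))) =
      ENNReal.ofReal |(EuclideanSpace.basisFun (Fin 3) ℝ).toBasis.det b| := by
  have hL : IsBravaisLattice (Submodule.span ℤ (Set.range b)) := ⟨b, rfl⟩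
  have := hL.countable
  have : VAddInvariantMeasure (Submodule.span ℤ (Set.range b)) E3 volume :=
    inferInstanceAs (VAddInvariantMeasure (Submodule.span ℤ (Set.range b)).toAddSubgroup E3 volume)
  rw [hL.isAddFundamentalDomain_wignerSeitz.measure_eq (ZSpan.isAddFundamentalDomain b volume),
    ZSpan.measure_fundamentalDomain b volume (EuclideanSpace.basisFun (Fin 3) ℝ).toBasis,
    measure_congr (ZSpan.fundamentalDomain_ae_parallelepiped _ _), OrthonormalBasis.coe_toBasis,
    OrthonormalBasis.volume_parallelepiped, mul_one]

lemma volume_wignerSeitz_bcc : volume (wignerSeitz bcc) = 1 := by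
  obtain ⟨b, hb⟩ := bccVec_basis
  rw [bcc_eq_span, ← hb, IsBravaisLattice.volume_wignerSeitz_eq, hb, det_bccVec]
  simp

/-- In units of `bccScale` the coordinates are integers of a common parity, that of `e`. This makes
the symmetries, the cell and the theta series accessible. -/
lemma mem_bcc_iff {x : E3} :
    x ∈ bcc ↔ ∃ (k : Fin 3 → ℤ) (e : ℤ), ∀ i, x i = bccScale * (2 * k i + e) := by
  have hv : ∀ (c : Fin 3 → ℤ) (i : Fin 3), (∑ j, c j • bccVec j) i =
      bccScale * (2 * (-c i : ℤ) + (∑ j, c j : ℤ)) := fun c i => by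
    fin_cases i <;> simp [bccVec, Fin.sum_univ_three] <;> ring
  rw [bcc_eq_span, Submodule.mem_span_range_iff_exists_fun]
  constructor
  · rintro ⟨c, rfl⟩
    exact ⟨fun i => -c i, ∑ j, c j, fun i => hv c i⟩
  · rintro ⟨k, e, h⟩
    -- These coefficients sum to `2 * ∑ k + 3 * e`, so subtracting twice the `i`-th one leaves `2 *
    -- k i + e`.
    refine ⟨fun i => ∑ j, k j + e - k i, ?_⟩
    ext i
    rw [hv, h]
    simp only [Fin.sum_univ_three]
    push_cast
    ring

/-! ### Symmetries -/

lemma setIntegral_wignerSeitz_comp {L : Submodule ℤ E3} (T : E3 ≃ₗᵢ[ℝ] E3)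
    (h : ∀ v, v ∈ L ↔ T v ∈ L) {F : Type*} [NormedAddCommGroup F] [NormedSpace ℝ F] (f : E3 → F) :
    ∫ x in wignerSeitz L, f (T x) = ∫ x in wignerSeitz L, f x := by
  have hpre : T ⁻¹' wignerSeitz L = wignerSeitz L := by
    ext x
    simp only [wignerSeitz, Set.mem_preimage, Set.mem_ofPred_eq, T.norm_map]
    constructor
    · intro hx v hv
      have := hx (T v) ((h v).1 hv)
      rwa [← map_sub, T.norm_map] at this
    · intro hx v hv
      have := hx (T.symm v) ((h _).2 (by simpa using hv))
      rwa [← T.norm_map x, ← T.norm_map (x - _), map_sub, T.apply_symm_apply, T.norm_map] at this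
  have h2 := T.measurePreserving.setIntegral_preimage_emb
    T.toHomeomorph.measurableEmbedding f (wignerSeitz L)
  rwa [hpre] at h2

/-- Holds for every lattice, since the cell is centrally symmetric. -/
lemma noDipole (L : Submodule ℤ E3) : NoDipole L := by
  have h := setIntegral_wignerSeitz_neg L (fun x => x)
  rw [integral_neg] at h
  have h2 : (2 : ℝ) • ∫ x in wignerSeitz L, x = 0 := by
    rw [two_smul]; nth_rewrite 1 [← h]; simp
  exact (smul_eq_zero.1 h2).resolve_left two_ne_zero

/-- The reflection that changes the sign of one coordinate. -/
noncomputable def flipCoord (i : Fin 3) : E3 ≃ₗᵢ[ℝ] E3 :=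
  LinearIsometryEquiv.piLpCongrRight 2 fun j =>
    if j = i then LinearIsometryEquiv.neg ℝ else LinearIsometryEquiv.refl ℝ ℝ

lemma flipCoord_apply (i j : Fin 3) (x : E3) :
    flipCoord i x j = if j = i then -x j else x j := by
  simp only [flipCoord, LinearIsometryEquiv.piLpCongrRight_apply]
  split_ifs <;> simp

lemma flipCoord_mem_bcc (i : Fin 3) {x : E3} (hx : x ∈ bcc) : flipCoord i x ∈ bcc := by
  obtain ⟨k, e, h⟩ := mem_bcc_iff.1 hx
  refine mem_bcc_iff.2 ⟨fun j => if j = i then -k j - e else k j, e, fun j => ?_⟩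
  rw [flipCoord_apply, h]
  by_cases hj : j = i
  · simp only [if_pos hj]; push_cast; ring
  · simp only [if_neg hj]

lemma flipCoord_flipCoord (i : Fin 3) (x : E3) : flipCoord i (flipCoord i x) = x := by
  ext j
  rw [flipCoord_apply, flipCoord_apply]
  split_ifs <;> simp

/-- The permutation of the coordinates. -/
noncomputable def permCoord (σ : Equiv.Perm (Fin 3)) : E3 ≃ₗᵢ[ℝ] E3 :=
  LinearIsometryEquiv.piLpCongrLeft 2 ℝ ℝ σ

lemma permCoord_apply (σ : Equiv.Perm (Fin 3)) (x : E3) (j : Fin 3) :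
    permCoord σ x j = x (σ.symm j) := by
  simp [permCoord, LinearIsometryEquiv.piLpCongrLeft_apply, Equiv.piCongrLeft'_apply]

lemma permCoord_mem_bcc (σ : Equiv.Perm (Fin 3)) {x : E3} (hx : x ∈ bcc) :
    permCoord σ x ∈ bcc := by
  obtain ⟨k, e, h⟩ := mem_bcc_iff.1 hx
  exact mem_bcc_iff.2 ⟨fun j => k (σ.symm j), e, fun j => by rw [permCoord_apply, h]⟩

lemma permCoord_mem_bcc_iff (σ : Equiv.Perm (Fin 3)) {x : E3} :
    x ∈ bcc ↔ permCoord σ x ∈ bcc := by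
  refine ⟨permCoord_mem_bcc σ, fun h => ?_⟩
  have := permCoord_mem_bcc σ.symm h
  convert this
  ext j; simp [permCoord_apply]

lemma setIntegral_bcc_mul_of_ne {i j : Fin 3} (h : i ≠ j) :
    ∫ x in wignerSeitz bcc, x i * x j = 0 := by
  have h1 := setIntegral_wignerSeitz_comp (L := bcc) (flipCoord i)
    (fun v => ⟨flipCoord_mem_bcc i, fun hv => by
      simpa [flipCoord_flipCoord] using flipCoord_mem_bcc i hv⟩) (fun x => x i * x j)
  simp only [flipCoord_apply, if_neg h.symm, ↓reduceIte, neg_mul] at h1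
  rw [integral_neg] at h1
  linarith

lemma setIntegral_bcc_sq_eq (i : Fin 3) :
    ∫ x in wignerSeitz bcc, x i * x i = ∫ x in wignerSeitz bcc, x 0 * x 0 := by
  have h1 := setIntegral_wignerSeitz_comp (L := bcc) (permCoord (Equiv.swap 0 i))
    (fun v => permCoord_mem_bcc_iff _) (fun x => x 0 * x 0)
  simpa [permCoord_apply] using h1

lemma setIntegral_bcc_norm_sq :
    ∫ x in wignerSeitz bcc, ‖x‖ ^ 2 = 3 * ∫ x in wignerSeitz bcc, x 0 * x 0 := by
  have hc : ∀ i : Fin 3, IntegrableOn (fun y : E3 => y i * y i) (wignerSeitz bcc) :=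
    fun i => isBravaisLattice_bcc.integrableOn_of_continuous (by fun_prop)
  simp_rw [EuclideanSpace.real_norm_sq_eq, sq]
  rw [integral_finsetSum _ fun i _ => hc i, Finset.sum_congr rfl fun i _ => setIntegral_bcc_sq_eq i]
  simp

lemma noQuadrupole_bcc : NoQuadrupole bcc := by
  intro i j
  split_ifs with h
  · rw [← h, setIntegral_bcc_sq_eq, setIntegral_bcc_norm_sq]; ring
  · rw [setIntegral_bcc_mul_of_ne h]; simp

/-! ### The truncated octahedron -/

lemma inner_le_iff_norm_le_norm_sub (x v : E3) : ‖x‖ ≤ ‖x - v‖ ↔ 2 * ⟪x, v⟫ ≤ ‖v‖ ^ 2 := by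
  rw [← sq_le_sq₀ (norm_nonneg _) (norm_nonneg _), norm_sub_sq_real]
  constructor <;> intro h <;> linarith

/-- The cell is a truncated octahedron: its square faces come from the vectors `±2` along one axis
and its hexagonal faces from the vectors `(±1, ±1, ±1)`, in units of `bccScale`. Every other lattice
vector gives a weaker condition. -/
lemma mem_wignerSeitz_bcc_iff {x : E3} :
    x ∈ wignerSeitz bcc ↔ (∀ i, |x i| ≤ bccScale) ∧ |x 0| + |x 1| + |x 2| ≤ 3 / 2 * bccScale := by
  have hs := bccScale_pos
  have hv : ∀ v : E3, ‖x‖ ≤ ‖x - v‖ ↔ 2 * ∑ i, x i * v i ≤ ∑ i, v i ^ 2 := fun v => by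
    rw [inner_le_iff_norm_le_norm_sub, EuclideanSpace.real_norm_sq_eq, PiLp.inner_apply]
    simp [mul_comm]
  constructor
  · intro hx
    have key : ∀ (k : Fin 3 → ℤ) (e : ℤ), 2 * ∑ i, x i * (2 * k i + e) ≤
        bccScale * ∑ i, (2 * k i + e : ℝ) ^ 2 := fun k e => by
      have h1 := hx (WithLp.toLp 2 fun i => bccScale * (2 * k i + e))
        (mem_bcc_iff.2 ⟨k, e, fun i => rfl⟩)
      rw [hv] at h1
      simp only [mul_pow] at h1
      rw [← Finset.mul_sum] at h1
      have h2 : ∑ i, x i * (bccScale * (2 * k i + e)) =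
          bccScale * ∑ i, x i * (2 * k i + e : ℝ) := by
        rw [Finset.mul_sum]; exact Finset.sum_congr rfl fun i _ => by ring
      rw [h2] at h1
      have h3 : bccScale * (2 * ∑ i, x i * (2 * k i + e : ℝ)) ≤
          bccScale * (bccScale * ∑ i, (2 * k i + e : ℝ) ^ 2) := by linarith
      exact le_of_mul_le_mul_left h3 hs
    constructor
    · intro i
      have h1 := key (Pi.single i 1) 0
      have h2 := key (Pi.single i (-1)) 0
      rw [abs_le]
      fin_cases i <;> simp [Fin.sum_univ_three] at h1 h2 ⊢ <;> constructor <;> linarith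
    · have h0 := key ![0, 0, 0] 1
      have h1 := key ![-1, 0, 0] 1
      have h2 := key ![0, -1, 0] 1
      have h3 := key ![0, 0, -1] 1
      have h4 := key ![0, -1, -1] 1
      have h5 := key ![-1, 0, -1] 1
      have h6 := key ![-1, -1, 0] 1
      have h7 := key ![-1, -1, -1] 1
      simp [Fin.sum_univ_three] at h0 h1 h2 h3 h4 h5 h6 h7
      norm_num at h0 h1 h2 h3 h4 h5 h6 h7
      rcases abs_cases (x 0) with ⟨a0, -⟩ | ⟨a0, -⟩ <;>
      rcases abs_cases (x 1) with ⟨a1, -⟩ | ⟨a1, -⟩ <;>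
      rcases abs_cases (x 2) with ⟨a2, -⟩ | ⟨a2, -⟩ <;>
      rw [a0, a1, a2] <;> linarith
  · rintro ⟨h1, h2⟩ v hvb
    obtain ⟨k, e, hk⟩ := mem_bcc_iff.1 hvb
    rw [hv]
    simp_rw [hk]
    have hle : ∀ i, x i * (bccScale * (2 * k i + e)) ≤
        bccScale * (|x i| * |(2 * k i + e : ℝ)|) := fun i => by
      calc x i * (bccScale * (2 * k i + e)) = bccScale * (x i * (2 * k i + e)) := by ring
        _ ≤ _ := mul_le_mul_of_nonneg_left (by rw [← abs_mul]; exact le_abs_self _) hs.le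
    have hmain : 2 * ∑ i, |x i| * |(2 * k i + e : ℝ)| ≤
        bccScale * ∑ i, |(2 * k i + e : ℝ)| ^ 2 := by
      rcases Int.even_or_odd e with he | he
      -- For even coordinates the bound splits coordinatewise: `|x i| ≤ bccScale` and `n ≤ n ^ 2`
      -- suffice.
      · have hn : ∀ i, ∃ n : ℕ, |(2 * k i + e : ℝ)| = 2 * n := fun i => by
          obtain ⟨m, hm⟩ := (even_two_mul (k i)).add he
          refine ⟨m.natAbs, ?_⟩
          have : (2 * k i + e : ℝ) = ((m + m : ℤ) : ℝ) := by rw [← hm]; push_cast; ring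
          rw [this, ← two_mul, Int.cast_mul, abs_mul, Nat.cast_natAbs, Int.cast_abs]; simp
        rw [Finset.mul_sum, Finset.mul_sum]
        refine Finset.sum_le_sum fun i _ => ?_
        obtain ⟨n, hn⟩ := hn i
        rw [hn]
        have hnn : (n : ℝ) ≤ (n : ℝ) ^ 2 := by exact_mod_cast Nat.le_self_pow two_ne_zero n
        calc 2 * (|x i| * (2 * n)) ≤ 2 * (bccScale * (2 * n)) := by gcongr; exact h1 i
          _ ≤ 4 * bccScale * (n : ℝ) ^ 2 := by nlinarith
          _ = _ := by ring
      · have hn : ∀ i, ∃ n : ℕ, |(2 * k i + e : ℝ)| = 2 * n + 1 := fun i => by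
          obtain ⟨m, hm⟩ := Int.natAbs_odd.2 ((even_two_mul (k i)).add_odd he)
          refine ⟨m, ?_⟩
          have : (2 * k i + e : ℝ) = ((2 * k i + e : ℤ) : ℝ) := by push_cast; ring
          rw [this, ← Int.cast_abs, ← Nat.cast_natAbs, hm]; push_cast; ring
        choose n hn using hn
        simp_rw [hn]
        -- For odd coordinates this reduces each one to the value `±1`, using `4 * n ≤ (2 * n + 1) ^
        -- 2 - 1`. What remains after summing is `2 * ∑ |x i| ≤ 3 * bccScale`, the hexagonal face
        -- condition.
        have hterm : ∀ i, 2 * (|x i| * (2 * n i + 1)) ≤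
            2 * |x i| + bccScale * ((2 * n i + 1 : ℝ) ^ 2) - bccScale := fun i => by
          have hnn : (n i : ℝ) ≤ (n i : ℝ) ^ 2 := by
            exact_mod_cast Nat.le_self_pow two_ne_zero (n i)
          have h3 : |x i| * n i ≤ bccScale * n i := by gcongr; exact h1 i
          nlinarith
        rw [Finset.mul_sum, Finset.mul_sum, Fin.sum_univ_three, Fin.sum_univ_three]
        have := hterm 0
        have := hterm 1
        have := hterm 2
        linarith
    calc 2 * ∑ i, x i * (bccScale * (2 * k i + e))
        ≤ 2 * ∑ i, bccScale * (|x i| * |(2 * k i + e : ℝ)|) :=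
          mul_le_mul_of_nonneg_left (Finset.sum_le_sum fun i _ => hle i) zero_le_two
      _ = bccScale * (2 * ∑ i, |x i| * |(2 * k i + e : ℝ)|) := by rw [← Finset.mul_sum]; ring
      _ ≤ bccScale * (bccScale * ∑ i, |(2 * k i + e : ℝ)| ^ 2) := by gcongr
      _ = _ := by
        rw [Finset.mul_sum, Finset.mul_sum]
        exact Finset.sum_congr rfl fun i _ => by rw [sq_abs]; ring

/-! ### The second moment of the truncated octahedron -/

lemma measurePreserving_E3_mk :
    MeasurePreserving (fun p : ℝ × ℝ × ℝ => (!₂[p.1, p.2.1, p.2.2] : E3)) := by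
  have h1 := ((MeasurePreserving.id (volume : Measure ℝ)).prod (volume_preserving_finTwoArrow ℝ)).comp
    (volume_preserving_piFinSuccAbove (fun _ : Fin 3 => ℝ) 0)
  have h2 := (PiLp.volume_preserving_ofLp (Fin 3))
  have h3 := h1.comp h2
  let e : E3 ≃ᵐ ℝ × ℝ × ℝ := (MeasurableEquiv.toLp 2 (Fin 3 → ℝ)).symm.trans
    ((MeasurableEquiv.piFinSuccAbove (fun _ : Fin 3 => ℝ) 0).trans
      ((MeasurableEquiv.refl ℝ).prodCongr MeasurableEquiv.finTwoArrow))
  have h4 : MeasurePreserving e := h3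
  have h5 := h4.symm
  convert h5 using 1
  ext p : 1
  rw [← e.symm_apply_apply (!₂[p.1, p.2.1, p.2.2] : E3)]
  rfl

lemma integral_E3_eq {f : E3 → ℝ} (hf : Integrable f) :
    ∫ x, f x = ∫ x, ∫ y, ∫ z, f !₂[x, y, z] := by
  have hmp := measurePreserving_E3_mk
  have he : MeasurableEmbedding (fun p : ℝ × ℝ × ℝ => (!₂[p.1, p.2.1, p.2.2] : E3)) := by
    refine MeasurableEmbedding.of_measurable_inverse (g := fun x : E3 => (x 0, x 1, x 2))
      hmp.measurable ?_ (by fun_prop) (fun p => rfl)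
    have : Set.range (fun p : ℝ × ℝ × ℝ => (!₂[p.1, p.2.1, p.2.2] : E3)) = Set.univ := by
      refine Set.range_eq_univ.2 fun x => ⟨(x 0, x 1, x 2), ?_⟩
      ext i; fin_cases i <;> rfl
    rw [this]; exact .univ
  have hf2 := (hmp.integrable_comp_emb he).2 hf
  rw [← hmp.integral_comp he]
  refine (integral_prod _ hf2).trans (integral_congr_ae ?_)
  filter_upwards [hf2.prod_right_ae] with x hx
  exact integral_prod _ hx

lemma integral_octant (s a b : ℝ) :
    ∫ z in Set.Ioi 0, (if (a ≤ s ∧ b ≤ s ∧ z ≤ s) ∧ a + b + z ≤ 3 / 2 * s then a ^ 2 else 0) =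
      if a ≤ s ∧ b ≤ s then a ^ 2 * max 0 (min s (3 / 2 * s - a - b)) else 0 := by
  split_ifs with h
  · have h1 : ∀ z ∈ Set.Ioi (0 : ℝ),
        (if (a ≤ s ∧ b ≤ s ∧ z ≤ s) ∧ a + b + z ≤ 3 / 2 * s then a ^ 2 else 0) =
        (Set.Iic (min s (3 / 2 * s - a - b))).indicator (fun _ => a ^ 2) z := fun z _ => by
      rw [Set.indicator_apply]
      refine if_congr ?_ rfl rfl
      rw [Set.mem_Iic, le_min_iff]
      constructor
      · rintro ⟨⟨-, -, h2⟩, h3⟩; exact ⟨h2, by linarith⟩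
      · rintro ⟨h2, h3⟩; exact ⟨⟨h.1, h.2, h2⟩, by linarith⟩
    rw [setIntegral_congr_fun measurableSet_Ioi h1, setIntegral_indicator measurableSet_Iic,
      Set.Ioi_inter_Iic, setIntegral_const, smul_eq_mul, Real.volume_real_Ioc, sub_zero, mul_comm,
      max_comm]
  · refine integral_eq_zero_of_ae (.of_forall fun z => if_neg ?_)
    rintro ⟨⟨h2, h3, -⟩, -⟩
    exact h ⟨h2, h3⟩

lemma intervalIntegral_const_sub (c x y : ℝ) :
    ∫ b in x..y, (c - b) = ((c - x) ^ 2 - (c - y) ^ 2) / 2 := by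
  rw [intervalIntegral.integral_sub (by simp) (by simp)]
  simp
  ring

/-- For `a ≥ s / 2` the height `3 / 2 * s - a - b` never exceeds `s` and reaches zero at `b = c`. In
the companion `integral_octant_slice_of_ge` it never becomes negative but is cut off at `s` for `b ≤
c - s`. -/
lemma integral_octant_slice_of_le {s a : ℝ} (hs : 0 < s) (ha : s / 2 ≤ a) (has : a ≤ s) :
    ∫ b in (0 : ℝ)..s, max 0 (min s (3 / 2 * s - a - b)) = (3 / 2 * s - a) ^ 2 / 2 := by
  set c := 3 / 2 * s - a with hc
  have hcont : Continuous fun b : ℝ => max 0 (min s (c - b)) := by fun_prop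
  rw [← intervalIntegral.integral_add_adjacent_intervals (b := c)
    (hcont.intervalIntegrable _ _) (hcont.intervalIntegrable _ _)]
  have h1 : ∫ b in (0 : ℝ)..c, max 0 (min s (c - b)) = ∫ b in (0 : ℝ)..c, (c - b) := by
    refine intervalIntegral.integral_congr fun b hb => ?_
    rw [Set.uIcc_of_le (by linarith)] at hb
    rw [min_eq_right (by linarith [hb.1]), max_eq_right (by linarith [hb.2])]
  have h2 : ∫ b in c..s, max 0 (min s (c - b)) = ∫ b in c..s, (0 : ℝ) := by
    refine intervalIntegral.integral_congr fun b hb => ?_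
    rw [Set.uIcc_of_le (by linarith)] at hb
    exact max_eq_left ((min_le_right _ _).trans (by linarith [hb.1]))
  rw [h1, h2, intervalIntegral_const_sub, intervalIntegral.integral_zero]
  ring

lemma integral_octant_slice_of_ge {s a : ℝ} (hs : 0 < s) (ha0 : 0 ≤ a) (ha : a ≤ s / 2) :
    ∫ b in (0 : ℝ)..s, max 0 (min s (3 / 2 * s - a - b)) =
      s * (s / 2 - a) + (s ^ 2 - (s / 2 - a) ^ 2) / 2 := by
  set c := 3 / 2 * s - a with hc
  have hcont : Continuous fun b : ℝ => max 0 (min s (c - b)) := by fun_prop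
  rw [← intervalIntegral.integral_add_adjacent_intervals (b := c - s)
    (hcont.intervalIntegrable _ _) (hcont.intervalIntegrable _ _)]
  have h1 : ∫ b in (0 : ℝ)..(c - s), max 0 (min s (c - b)) = ∫ b in (0 : ℝ)..(c - s), s := by
    refine intervalIntegral.integral_congr fun b hb => ?_
    rw [Set.uIcc_of_le (by linarith)] at hb
    rw [min_eq_left (by linarith [hb.2]), max_eq_right hs.le]
  have h2 : ∫ b in (c - s)..s, max 0 (min s (c - b)) = ∫ b in (c - s)..s, (c - b) := by
    refine intervalIntegral.integral_congr fun b hb => ?_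
    rw [Set.uIcc_of_le (by linarith)] at hb
    rw [min_eq_right (by linarith [hb.1]), max_eq_right (by linarith [hb.2])]
  rw [h1, h2, intervalIntegral_const_sub, intervalIntegral.integral_const, smul_eq_mul, hc]
  ring

lemma integral_octant_last {s : ℝ} (hs : 0 < s) :
    ∫ a in (0 : ℝ)..s, a ^ 2 * ∫ b in (0 : ℝ)..s, max 0 (min s (3 / 2 * s - a - b)) =
      19 / 192 * s ^ 5 := by
  have h1 : ∀ a ∈ Set.uIcc 0 (s / 2),
      a ^ 2 * ∫ b in (0 : ℝ)..s, max 0 (min s (3 / 2 * s - a - b)) =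
      a ^ 2 * (s * (s / 2 - a) + (s ^ 2 - (s / 2 - a) ^ 2) / 2) := fun a ha => by
    rw [Set.uIcc_of_le (by linarith)] at ha
    rw [integral_octant_slice_of_ge hs ha.1 ha.2]
  have h2 : ∀ a ∈ Set.uIcc (s / 2) s,
      a ^ 2 * ∫ b in (0 : ℝ)..s, max 0 (min s (3 / 2 * s - a - b)) =
      a ^ 2 * ((3 / 2 * s - a) ^ 2 / 2) := fun a ha => by
    rw [Set.uIcc_of_le (by linarith)] at ha
    rw [integral_octant_slice_of_le hs ha.1 ha.2]
  have i1 : IntervalIntegrable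
      (fun a => a ^ 2 * ∫ b in (0 : ℝ)..s, max 0 (min s (3 / 2 * s - a - b))) volume 0 (s / 2) :=
    (ContinuousOn.congr (Continuous.continuousOn (by fun_prop)) h1).intervalIntegrable
  have i2 : IntervalIntegrable
      (fun a => a ^ 2 * ∫ b in (0 : ℝ)..s, max 0 (min s (3 / 2 * s - a - b))) volume (s / 2) s :=
    (ContinuousOn.congr (Continuous.continuousOn (by fun_prop)) h2).intervalIntegrable
  rw [← intervalIntegral.integral_add_adjacent_intervals i1 i2,
    intervalIntegral.integral_congr h1, intervalIntegral.integral_congr h2]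
  have d1 : ∀ a ∈ Set.uIcc 0 (s / 2), HasDerivAt
      (fun a => 7 / 24 * s ^ 2 * a ^ 3 - s * a ^ 4 / 8 - a ^ 5 / 10)
      (a ^ 2 * (s * (s / 2 - a) + (s ^ 2 - (s / 2 - a) ^ 2) / 2)) a := fun a _ => by
    have := (((hasDerivAt_pow 3 a).const_mul (7 / 24 * s ^ 2)).sub
      (((hasDerivAt_pow 4 a).const_mul s).div_const 8)).sub ((hasDerivAt_pow 5 a).div_const 10)
    refine HasDerivAt.congr_deriv this ?_
    push_cast; ring
  have d2 : ∀ a ∈ Set.uIcc (s / 2) s, HasDerivAt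
      (fun a => 3 / 8 * s ^ 2 * a ^ 3 - 3 / 8 * s * a ^ 4 + a ^ 5 / 10)
      (a ^ 2 * ((3 / 2 * s - a) ^ 2 / 2)) a := fun a _ => by
    have := (((hasDerivAt_pow 3 a).const_mul (3 / 8 * s ^ 2)).sub
      ((hasDerivAt_pow 4 a).const_mul (3 / 8 * s))).add ((hasDerivAt_pow 5 a).div_const 10)
    refine HasDerivAt.congr_deriv this ?_
    push_cast; ring
  rw [intervalIntegral.integral_eq_sub_of_hasDerivAt d1
      (Continuous.intervalIntegrable (by fun_prop) _ _),
    intervalIntegral.integral_eq_sub_of_hasDerivAt d2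
      (Continuous.intervalIntegrable (by fun_prop) _ _)]
  ring

lemma setIntegral_Ioi_ite_le {s : ℝ} (hs : 0 < s) (f : ℝ → ℝ) :
    ∫ a in Set.Ioi 0, (if a ≤ s then f a else 0) = ∫ a in (0 : ℝ)..s, f a := by
  have h : ∀ a ∈ Set.Ioi (0 : ℝ), (if a ≤ s then f a else 0) = (Set.Iic s).indicator f a :=
    fun a _ => by simp [Set.indicator_apply]
  rw [setIntegral_congr_fun measurableSet_Ioi h, setIntegral_indicator measurableSet_Iic,
    Set.Ioi_inter_Iic, intervalIntegral.integral_of_le hs.le]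

/-- Only absolute values of the coordinates enter, so folding each axis reduces the integral to
eight times the positive octant. -/
lemma setIntegral_bcc_first_sq : ∫ x in wignerSeitz bcc, x 0 * x 0 = 19 / 24 * bccScale ^ 5 := by
  have hs := bccScale_pos
  set s := bccScale with hsdef
  let H : ℝ → ℝ → ℝ → ℝ := fun a b c =>
    if (a ≤ s ∧ b ≤ s ∧ c ≤ s) ∧ a + b + c ≤ 3 / 2 * s then a ^ 2 else 0
  have hint : Integrable ((wignerSeitz bcc).indicator fun x : E3 => x 0 * x 0) :=
    (integrable_indicator_iff (measurableSet_wignerSeitz bcc)).2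
      (isBravaisLattice_bcc.integrableOn_of_continuous (by fun_prop))
  have hH : ∀ x y z : ℝ, (wignerSeitz bcc).indicator (fun x : E3 => x 0 * x 0)
      (!₂[x, y, z] : E3) =
      H |x| |y| |z| := fun x y z => by
    classical
    rw [Set.indicator_apply]
    refine if_congr ?_ (by simp [← sq]) rfl
    rw [mem_wignerSeitz_bcc_iff]
    simp [Fin.forall_fin_succ, ← hsdef]
  rw [← integral_indicator (measurableSet_wignerSeitz bcc), integral_E3_eq hint]
  simp_rw [hH]
  have e1 : ∀ a b : ℝ, ∫ z, H a b |z| =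
      2 * (if a ≤ s ∧ b ≤ s then a ^ 2 * max 0 (min s (3 / 2 * s - a - b)) else 0) := fun a b => by
    rw [integral_comp_abs (f := fun z => H a b z), integral_octant]
  simp_rw [e1]
  have e2 : ∀ a : ℝ, ∫ y, 2 * (if a ≤ s ∧ |y| ≤ s then
      a ^ 2 * max 0 (min s (3 / 2 * s - a - |y|)) else 0) =
      4 * (if a ≤ s then a ^ 2 * ∫ b in (0 : ℝ)..s, max 0 (min s (3 / 2 * s - a - b)) else 0) :=
    fun a => by
    rw [integral_const_mul, integral_comp_abs (f := fun y => if a ≤ s ∧ y ≤ s then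
      a ^ 2 * max 0 (min s (3 / 2 * s - a - y)) else 0)]
    by_cases ha : a ≤ s
    · simp only [ha, true_and, if_true]
      rw [setIntegral_Ioi_ite_le hs, intervalIntegral.integral_const_mul]
      ring
    · simp [ha]
  simp_rw [e2]
  rw [integral_const_mul, integral_comp_abs (f := fun a => if a ≤ s then
    a ^ 2 * ∫ b in (0 : ℝ)..s, max 0 (min s (3 / 2 * s - a - b)) else 0),
    setIntegral_Ioi_ite_le hs, integral_octant_last hs]
  ring

lemma setIntegral_bcc_norm_sq_eq :
    ∫ x in wignerSeitz bcc, ‖x‖ ^ 2 = 19 / 32 * bccScale ^ 2 := by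
  rw [setIntegral_bcc_norm_sq, setIntegral_bcc_first_sq]
  linear_combination 19 / 8 * bccScale ^ 2 * bccScale_cube

/-! ### Gaussian decomposition of the screened interaction -/

/-- The Gaussian kernel averaged over the cell. -/
noncomputable def heatCell (L : Submodule ℤ E3) (u : ℝ) (z : E3) : ℝ :=
  ∫ y in wignerSeitz L, heat u (z + y)

/-- The contribution of a Gaussian to the interaction of two screened charges, without the
self-interaction of the point charges. -/
noncomputable def heatPair (L : Submodule ℤ E3) (u : ℝ) (z : E3) : ℝ :=
  1 / 2 * ({0}ᶜ : Set E3).indicator (heat u) z - heatCell L u z +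
    1 / 2 * ∫ x in wignerSeitz L, heatCell L u (z + x)

lemma heatCell_nonneg (L : Submodule ℤ E3) (u : ℝ) (z : E3) : 0 ≤ heatCell L u z :=
  integral_nonneg fun _ => heat_nonneg _ _

lemma measurable_heatCell (L : Submodule ℤ E3) :
    Measurable (fun p : ℝ × E3 => heatCell L p.1 p.2) := by
  have h : Measurable (fun q : (ℝ × E3) × E3 => heat q.1.1 (q.1.2 + q.2)) := by
    unfold heat; fun_prop
  exact (h.stronglyMeasurable.integral_prod_right' (ν := volume.restrict (wignerSeitz L))).measurable

lemma continuous_heat (u : ℝ) : Continuous (heat u) := by unfold heat; fun_prop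

lemma heat_le {u : ℝ} (hu : 0 < u) (x : E3) : heat u x ≤ 1 / √u := by
  refine mul_le_of_le_one_right (by positivity) (Real.exp_le_one_iff.2 ?_)
  have : 0 ≤ Real.pi * u * ‖x‖ ^ 2 := by positivity
  linarith

lemma heatCell_le {L : Submodule ℤ E3} (hL : IsBravaisLattice L)
    (hvol : volume (wignerSeitz L) = 1) {u : ℝ} (hu : 0 < u) (z : E3) :
    heatCell L u z ≤ 1 / √u := by
  have h := norm_setIntegral_le_of_norm_le_const (volume_wignerSeitz_lt_top hL)
    (f := fun y => heat u (z + y)) (C := 1 / √u) fun y _ => by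
      rw [Real.norm_of_nonneg (heat_nonneg _ _)]; exact heat_le hu _
  rw [Measure.real, hvol, ENNReal.toReal_one, mul_one] at h
  exact (Real.le_norm_self _).trans h

lemma integrableOn_heatCell {L : Submodule ℤ E3} (hL : IsBravaisLattice L)
    (hvol : volume (wignerSeitz L) = 1) {u : ℝ} (hu : 0 < u) (z : E3) :
    IntegrableOn (fun x => heatCell L u (z + x)) (wignerSeitz L) := by
  have hp : IsProbabilityMeasure (volume.restrict (wignerSeitz L)) := ⟨by simpa using hvol⟩
  refine Integrable.of_bound ((measurable_heatCell L).comp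
    (measurable_const.prodMk (measurable_const.add measurable_id))).aestronglyMeasurable (1 / √u)
    (.of_forall fun x => ?_)
  rw [Real.norm_of_nonneg (heatCell_nonneg _ _ _)]
  exact heatCell_le hL hvol hu _

lemma ae_add_ne_zero (z : E3) : ∀ᵐ y : E3, z + y ≠ 0 := by
  filter_upwards [compl_mem_ae_iff.2 (measure_singleton (-z))] with y hy h
  exact hy (eq_neg_of_add_eq_zero_right h)

lemma setIntegral_heatCell {L : Submodule ℤ E3} (hL : IsBravaisLattice L) (z : E3) :
    IntegrableOn (fun u => heatCell L u z) (Set.Ioi 0) ∧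
    ∫ u in Set.Ioi 0, heatCell L u z = uniformPotential (wignerSeitz L) z := by
  have hae := ae_restrict_of_ae (s := wignerSeitz L) (ae_add_ne_zero z)
  have hm : Measurable (Function.uncurry fun (u : ℝ) (y : E3) => heat u (z + y)) := by
    unfold heat Function.uncurry
    fun_prop
  have hint : ∀ᵐ y ∂(volume.restrict (wignerSeitz L)),
      ∫ u in Set.Ioi 0, heat u (z + y) = 1 / ‖z + y‖ := by
    filter_upwards [hae] with y hy using setIntegral_heat hy
  have hprod := integrable_uncurry_of_nonneg (μ := volume.restrict (Set.Ioi (0 : ℝ)))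
    (ν := volume.restrict (wignerSeitz L)) hm (fun _ _ => heat_nonneg _ _)
    (by filter_upwards [hae] with y hy using integrableOn_heat hy)
    ((integrableOn_coulomb_add (volume_wignerSeitz_lt_top hL) z).congr
      (by filter_upwards [hint] with y hy using hy.symm))
  refine ⟨hprod.integral_prod_left, ?_⟩
  unfold heatCell
  rw [integral_integral_swap hprod, ← setIntegral_coulomb_add]
  exact integral_congr_ae hint

lemma setIntegral_setIntegral_heatCell {L : Submodule ℤ E3} (hL : IsBravaisLattice L) (z : E3) :
    IntegrableOn (fun u => ∫ x in wignerSeitz L, heatCell L u (z + x)) (Set.Ioi 0) ∧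
    ∫ u in Set.Ioi 0, ∫ x in wignerSeitz L, heatCell L u (z + x) =
      ∫ x in wignerSeitz L, uniformPotential (wignerSeitz L) (z + x) := by
  have hQ := volume_wignerSeitz_lt_top hL
  have hm : Measurable (Function.uncurry fun (u : ℝ) (x : E3) => heatCell L u (z + x)) :=
    (measurable_heatCell L).comp (measurable_fst.prodMk (measurable_const.add measurable_snd))
  have hint : ∀ x, ∫ u in Set.Ioi 0, heatCell L u (z + x) = _ :=
    fun x => (setIntegral_heatCell hL (z + x)).2
  have hprod := integrable_uncurry_of_nonneg (μ := volume.restrict (Set.Ioi (0 : ℝ)))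
    (ν := volume.restrict (wignerSeitz L)) hm (fun _ _ => heatCell_nonneg _ _ _)
    (.of_forall fun x => (setIntegral_heatCell hL (z + x)).1)
    (by simp only [hint]; exact integrableOn_uniformPotential hQ hQ z)
  refine ⟨hprod.integral_prod_left, ?_⟩
  rw [integral_integral_swap hprod]
  simp_rw [hint]

/-- Integrating the Gaussians over `u` rebuilds the Coulomb kernel in each of the three
interactions. -/
lemma setIntegral_heatPair {L : Submodule ℤ E3} (hL : IsBravaisLattice L) (z : E3) :
    IntegrableOn (fun u => heatPair L u z) (Set.Ioi 0) ∧
    ∫ u in Set.Ioi 0, heatPair L u z = jelliumPair L z := by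
  obtain ⟨i2, e2⟩ := setIntegral_heatCell hL z
  obtain ⟨i3, e3⟩ := setIntegral_setIntegral_heatCell hL z
  have h1 : IntegrableOn (fun u => ({0}ᶜ : Set E3).indicator (heat u) z) (Set.Ioi 0) ∧
      ∫ u in Set.Ioi 0, ({0}ᶜ : Set E3).indicator (heat u) z = 1 / ‖z‖ := by
    rcases eq_or_ne z 0 with rfl | hz
    · simp
    · simp only [Set.indicator_of_mem (show z ∈ ({0}ᶜ : Set E3) from hz)]
      exact ⟨integrableOn_heat hz, setIntegral_heat hz⟩
  obtain ⟨i1, e1⟩ := h1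
  have i12 : IntegrableOn (fun u => 1 / 2 * ({0}ᶜ : Set E3).indicator (heat u) z -
    heatCell L u z) (Set.Ioi 0) := (i1.const_mul _).sub i2
  refine ⟨i12.add (i3.const_mul _), ?_⟩
  unfold heatPair
  rw [integral_add i12 (i3.const_mul _), integral_sub (i1.const_mul _) i2, integral_const_mul,
    integral_const_mul, e1, e2, e3, jelliumPair_eq hL]

/-! ### Decay of the Gaussian contributions -/

lemma abs_exp_sub_quadratic_le (t : ℝ) :
    |Real.exp t - (1 + t + t ^ 2 / 2)| ≤ |t| ^ 3 * Real.exp |t| := by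
  have h := Complex.norm_exp_sub_sum_le_norm_mul_exp (t : ℂ) 3
  rw [Complex.norm_real, Real.norm_eq_abs] at h
  simp only [Finset.sum_range_succ, Finset.sum_range_zero, Nat.factorial] at h
  rw [← Real.norm_eq_abs, ← Complex.norm_real]
  refine le_trans (le_of_eq ?_) h
  congr 1; push_cast; ring

/-- The second order Taylor polynomial of the Gaussian `v ↦ heat u (z + v)`. -/
noncomputable def heatTaylor (u : ℝ) (z v : E3) : ℝ :=
  heat u z * (1 - 2 * Real.pi * u * ⟪z, v⟫ - Real.pi * u * ‖v‖ ^ 2 +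
    2 * Real.pi ^ 2 * u ^ 2 * ⟪z, v⟫ ^ 2)

lemma abs_heat_add_sub_heatTaylor_le {u r : ℝ} (hu : 0 < u) (hr : 0 < r) {z v : E3}
    (hv : ‖v‖ ≤ r) (hz : 6 * r ≤ ‖z‖) :
    |heat u (z + v) - heatTaylor u z v| ≤ 27 * Real.pi ^ 3 * r ^ 3 / √u *
      ((u ^ 3 * ‖z‖ ^ 3 + u ^ 2 * ‖z‖) * Real.exp (-(Real.pi * ‖z‖ ^ 2 / 2 * u))) := by
  set R := ‖z‖ with hR
  have hR0 : 0 < R := by linarith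
  set a : ℝ := ⟪z, v⟫ with ha
  set b := ‖v‖ with hb
  have hb0 : 0 ≤ b := norm_nonneg v
  have hπ := Real.pi_gt_three
  have hab : |a| ≤ R * r := (abs_real_inner_le_norm z v).trans (by gcongr)
  set t := -(Real.pi * u * (2 * a + b ^ 2)) with ht
  have hadd : heat u (z + v) = heat u z * Real.exp t := by
    rw [heat, heat, mul_assoc (1 / √u), ← Real.exp_add, norm_add_sq_real]
    congr 2
    rw [ht]; ring
  have hsum : |2 * a + b ^ 2| ≤ 3 * r * R := by
    calc |2 * a + b ^ 2| ≤ |2 * a| + |b ^ 2| := abs_add_le _ _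
      _ ≤ 2 * (R * r) + r ^ 2 := by
        rw [abs_mul, abs_two, abs_of_nonneg (by positivity : 0 ≤ b ^ 2)]; gcongr
      _ ≤ 3 * r * R := by nlinarith
  have ht1 : |t| ≤ 3 * Real.pi * r * u * R := by
    rw [ht, abs_neg, abs_mul, abs_of_pos (by positivity : 0 < Real.pi * u)]
    calc Real.pi * u * |2 * a + b ^ 2| ≤ Real.pi * u * (3 * r * R) := by gcongr
      _ = _ := by ring
  -- The growth `exp |t|` of the Taylor remainder thus uses up only half of the Gaussian decay; this
  -- is where `6 * r ≤ ‖z‖` enters.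
  have ht2 : |t| ≤ Real.pi * u * R ^ 2 / 2 := ht1.trans (by
    have : 3 * Real.pi * r * u * R = Real.pi * u * R * (3 * r) := by ring
    have h2 : Real.pi * u * R ^ 2 / 2 = Real.pi * u * R * (R / 2) := by ring
    rw [this, h2]
    gcongr
    linarith)
  have hid : heat u (z + v) - heatTaylor u z v = heat u z *
      (Real.exp t - (1 + t + t ^ 2 / 2)) +
      heat u z * (Real.pi ^ 2 * u ^ 2 / 2 * (4 * a * b ^ 2 + b ^ 4)) := by
    rw [hadd, heatTaylor, ← ha, ← hb, ht]; ring
  have hexp : Real.exp (-Real.pi * u * R ^ 2) * Real.exp (Real.pi * u * R ^ 2 / 2) =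
      Real.exp (-(Real.pi * R ^ 2 / 2 * u)) := by rw [← Real.exp_add]; congr 1; ring
  have hexp2 : Real.exp (-Real.pi * u * R ^ 2) ≤ Real.exp (-(Real.pi * R ^ 2 / 2 * u)) := by
    rw [Real.exp_le_exp]
    have : 0 ≤ Real.pi * u * R ^ 2 := by positivity
    linarith
  have b1 : |heat u z * (Real.exp t - (1 + t + t ^ 2 / 2))| ≤
      1 / √u * ((3 * Real.pi * r * u * R) ^ 3 * Real.exp (-(Real.pi * R ^ 2 / 2 * u))) := by
    rw [abs_mul, abs_of_nonneg (heat_nonneg _ _), heat, mul_assoc, ← hexp]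
    refine mul_le_mul_of_nonneg_left ?_ (by positivity)
    calc _ ≤ Real.exp (-Real.pi * u * R ^ 2) * (|t| ^ 3 * Real.exp |t|) := by
          gcongr; exact abs_exp_sub_quadratic_le t
      _ ≤ Real.exp (-Real.pi * u * R ^ 2) *
          ((3 * Real.pi * r * u * R) ^ 3 * Real.exp (Real.pi * u * R ^ 2 / 2)) := by gcongr
      _ = _ := by ring
  have hq : |4 * a * b ^ 2 + b ^ 4| ≤ 5 * r ^ 3 * R := by
    calc |4 * a * b ^ 2 + b ^ 4| ≤ |4 * a * b ^ 2| + |b ^ 4| := abs_add_le _ _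
      _ = 4 * |a| * b ^ 2 + b ^ 4 := by
        rw [abs_mul, abs_mul, abs_of_nonneg (by positivity : 0 ≤ b ^ 2),
          abs_of_nonneg (by positivity : 0 ≤ b ^ 4)]
        norm_num
      _ ≤ 4 * (R * r) * r ^ 2 + r ^ 4 := by gcongr
      _ ≤ 5 * r ^ 3 * R := by nlinarith [pow_pos hr 3]
  have b2 : |heat u z * (Real.pi ^ 2 * u ^ 2 / 2 * (4 * a * b ^ 2 + b ^ 4))| ≤
      1 / √u * (Real.pi ^ 2 * u ^ 2 / 2 * (5 * r ^ 3 * R) *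
        Real.exp (-(Real.pi * R ^ 2 / 2 * u))) := by
    rw [abs_mul, abs_of_nonneg (heat_nonneg _ _), heat, mul_assoc, abs_mul,
      abs_of_pos (by positivity : 0 < Real.pi ^ 2 * u ^ 2 / 2)]
    refine mul_le_mul_of_nonneg_left ?_ (by positivity)
    rw [mul_comm]
    gcongr
  rw [hid]
  refine (abs_add_le _ _).trans ((add_le_add b1 b2).trans ?_)
  have h1 : 5 / 2 * (Real.pi ^ 2 * (r ^ 3 * u ^ 2 * R)) ≤
      27 * Real.pi * (Real.pi ^ 2 * (r ^ 3 * u ^ 2 * R)) := by gcongr; linarith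
  calc _ = ((3 * Real.pi * r * u * R) ^ 3 + Real.pi ^ 2 * u ^ 2 / 2 * (5 * r ^ 3 * R)) *
        (Real.exp (-(Real.pi * R ^ 2 / 2 * u)) / √u) := by ring
    _ ≤ 27 * Real.pi ^ 3 * r ^ 3 * (u ^ 3 * R ^ 3 + u ^ 2 * R) *
        (Real.exp (-(Real.pi * R ^ 2 / 2 * u)) / √u) :=
      mul_le_mul_of_nonneg_right (by linarith) (by positivity)
    _ = _ := by ring

/-- Half the average over `x, y ∈ Q` of the mixed second difference of the Gaussian at `z`. On the
Taylor polynomial this difference leaves only a term bilinear in `x` and `y`, which averages to zero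
because the dipole vanishes. Two neutral objects interact here, so the quadrupole condition plays no
role. The radius is doubled because of the argument `x + y`. -/
lemma abs_heatPair_le {L : Submodule ℤ E3} (hL : IsBravaisLattice L)
    (hvol : volume (wignerSeitz L) = 1) {ρ : ℝ} (hρ : 0 < ρ) (hQ : ∀ x ∈ wignerSeitz L, ‖x‖ ≤ ρ)
    {u : ℝ} (hu : 0 < u) {z : E3} (hz : 6 * (2 * ρ) ≤ ‖z‖) :
    |heatPair L u z| ≤ 2 * (27 * Real.pi ^ 3 * (2 * ρ) ^ 3 / √u *
      ((u ^ 3 * ‖z‖ ^ 3 + u ^ 2 * ‖z‖) * Real.exp (-(Real.pi * ‖z‖ ^ 2 / 2 * u)))) := by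
  have hp : IsProbabilityMeasure (volume.restrict (wignerSeitz L)) := ⟨by simpa using hvol⟩
  have hz0 : z ≠ 0 := fun h => by rw [h, norm_zero] at hz; linarith
  set B := 27 * Real.pi ^ 3 * (2 * ρ) ^ 3 / √u *
      ((u ^ 3 * ‖z‖ ^ 3 + u ^ 2 * ‖z‖) * Real.exp (-(Real.pi * ‖z‖ ^ 2 / 2 * u))) with hB
  have hB0 : 0 ≤ B := by positivity
  have hE : ∀ v : E3, ‖v‖ ≤ 2 * ρ → |heat u (z + v) - heatTaylor u z v| ≤ B := fun v hv =>
    abs_heat_add_sub_heatTaylor_le hu (by positivity) hv hz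
  have hcont := continuous_heat u
  let M : E3 → E3 → ℝ := fun x y => heat u z * (-2 * Real.pi * u * ⟪x, y⟫ +
    4 * Real.pi ^ 2 * u ^ 2 * ⟪z, x⟫ * ⟪z, y⟫)
  have hM : ∀ x, ∫ y in wignerSeitz L, M x y = 0 := fun x => by
    have i1 : IntegrableOn (fun y : E3 => (⟪x, y⟫ : ℝ)) (wignerSeitz L) :=
      hL.integrableOn_of_continuous (by fun_prop)
    have i2 : IntegrableOn (fun y : E3 => (⟪z, y⟫ : ℝ)) (wignerSeitz L) :=
      hL.integrableOn_of_continuous (by fun_prop)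
    simp only [M]
    rw [integral_const_mul, integral_add (i1.const_mul _) (i2.const_mul _), integral_const_mul,
      integral_const_mul, integral_inner_wignerSeitz hL (noDipole L),
      integral_inner_wignerSeitz hL (noDipole L)]
    simp
  have hdiff : ∀ x y, heat u z - heat u (z + y) - heat u (z + x) + heat u (z + x + y) - M x y =
      (heat u (z + (x + y)) - heatTaylor u z (x + y)) - (heat u (z + x) - heatTaylor u z x) -
      (heat u (z + y) - heatTaylor u z y) := fun x y => by
    simp only [heatTaylor, M, ← add_assoc, inner_add_right, norm_add_sq_real]
    ring
  have hinner : ∀ x, ∫ y in wignerSeitz L, (heat u z - heat u (z + y) - heat u (z + x) +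
      heat u (z + x + y) - M x y) =
      heat u z - heatCell L u z - heat u (z + x) + heatCell L u (z + x) := fun x => by
    have i1 : IntegrableOn (fun y => heat u (z + y)) (wignerSeitz L) :=
      hL.integrableOn_of_continuous (by fun_prop)
    have i2 : IntegrableOn (fun y => heat u (z + x + y)) (wignerSeitz L) :=
      hL.integrableOn_of_continuous (by fun_prop)
    have i3 : IntegrableOn (fun y => M x y) (wignerSeitz L) :=
      hL.integrableOn_of_continuous (by simp only [M]; fun_prop)
    have i4 : IntegrableOn (fun y => heat u z - heat u (z + y) - heat u (z + x)) (wignerSeitz L) :=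
      hL.integrableOn_of_continuous (by fun_prop)
    have i5 : IntegrableOn (fun y => heat u z - heat u (z + y)) (wignerSeitz L) :=
      hL.integrableOn_of_continuous (by fun_prop)
    have i6 : IntegrableOn (fun y => heat u z - heat u (z + y) - heat u (z + x) +
      heat u (z + x + y)) (wignerSeitz L) := hL.integrableOn_of_continuous (by fun_prop)
    rw [integral_sub i6 i3, hM, integral_add i4 i2, integral_sub i5 (integrable_const _),
      integral_sub (integrable_const _) i1]
    simp [heatCell]
  have houter : heatPair L u z = 1 / 2 * ∫ x in wignerSeitz L,
      (heat u z - heatCell L u z - heat u (z + x) + heatCell L u (z + x)) := by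
    have i1 : IntegrableOn (fun y => heat u (z + y)) (wignerSeitz L) :=
      hL.integrableOn_of_continuous (by fun_prop)
    have i2 : IntegrableOn (fun x => heat u z - heatCell L u z - heat u (z + x)) (wignerSeitz L) :=
      hL.integrableOn_of_continuous (by fun_prop)
    rw [integral_add i2 (integrableOn_heatCell hL hvol hu z), integral_sub (integrable_const _) i1,
      heatPair, Set.indicator_of_mem (show z ∈ ({0}ᶜ : Set E3) from hz0)]
    simp only [integral_const, probReal_univ, smul_eq_mul, one_mul]
    rw [← heatCell]
    ring
  have hfin := volume_wignerSeitz_lt_top hL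
  have hbound : ∀ x ∈ wignerSeitz L,
      ‖heat u z - heatCell L u z - heat u (z + x) + heatCell L u (z + x)‖ ≤ 3 * B := by
    intro x hx
    rw [← hinner x]
    have h := norm_setIntegral_le_of_norm_le_const hfin (f := fun y => heat u z - heat u (z + y) -
      heat u (z + x) + heat u (z + x + y) - M x y) (C := 3 * B) fun y hy => by
        have hx' := hQ x hx
        have hy' := hQ y hy
        have hxy := norm_add_le x y
        rw [hdiff, Real.norm_eq_abs]
        have e1 := hE (x + y) (by linarith)
        have e2 := hE x (by linarith)
        have e3 := hE y (by linarith)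
        rw [abs_le] at e1 e2 e3 ⊢
        constructor <;> linarith [e1.1, e1.2, e2.1, e2.2, e3.1, e3.2]
    simpa [Measure.real, hvol] using h
  have h := norm_setIntegral_le_of_norm_le_const hfin hbound
  rw [houter, abs_mul, ← Real.norm_eq_abs (∫ x in wignerSeitz L, _)]
  simp only [Measure.real, hvol, ENNReal.toReal_one, mul_one] at h
  rw [abs_of_pos (by norm_num : (0 : ℝ) < 1 / 2)]
  linarith

/-! ### The Ewald formula -/

lemma rpow_inv_mul_sq {R p : ℝ} (hR : 0 < R) (n : ℕ) (hp : 2 * p = n) :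
    (1 / (Real.pi * R ^ 2 / 2)) ^ p = (2 / Real.pi) ^ p / R ^ n := by
  have h : 1 / (Real.pi * R ^ 2 / 2) = 2 / Real.pi * R⁻¹ ^ 2 := by field_simp
  rw [h, Real.mul_rpow (by positivity) (by positivity), ← Real.rpow_natCast R⁻¹ 2,
    ← Real.rpow_mul (by positivity)]
  push_cast
  rw [hp, Real.rpow_natCast, inv_pow]
  exact (div_eq_mul_inv _ _).symm

lemma integral_gaussian_bound {R : ℝ} (hR : 0 < R) :
    IntegrableOn (fun u => 1 / √u * ((u ^ 3 * R ^ 3 + u ^ 2 * R) *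
      Real.exp (-(Real.pi * R ^ 2 / 2 * u)))) (Set.Ioi 0) ∧
    ∫ u in Set.Ioi 0, 1 / √u * ((u ^ 3 * R ^ 3 + u ^ 2 * R) *
      Real.exp (-(Real.pi * R ^ 2 / 2 * u))) =
      ((2 / Real.pi) ^ (7 / 2 : ℝ) * Real.Gamma (7 / 2) +
        (2 / Real.pi) ^ (5 / 2 : ℝ) * Real.Gamma (5 / 2)) / R ^ 4 := by
  have h7 := Real.integral_rpow_mul_exp_neg_mul_Ioi (a := 7 / 2) (r := Real.pi * R ^ 2 / 2)
    (by norm_num) (by positivity)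
  have h5 := Real.integral_rpow_mul_exp_neg_mul_Ioi (a := 5 / 2) (r := Real.pi * R ^ 2 / 2)
    (by norm_num) (by positivity)
  have i7 : IntegrableOn (fun u => u ^ ((7 / 2 : ℝ) - 1) *
      Real.exp (-(Real.pi * R ^ 2 / 2 * u))) (Set.Ioi 0) := by
    by_contra hn
    rw [integral_undef hn] at h7
    have : 0 < (1 / (Real.pi * R ^ 2 / 2)) ^ (7 / 2 : ℝ) * Real.Gamma (7 / 2) :=
      mul_pos (by positivity) (Real.Gamma_pos_of_pos (by norm_num))
    linarith
  have i5 : IntegrableOn (fun u => u ^ ((5 / 2 : ℝ) - 1) *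
      Real.exp (-(Real.pi * R ^ 2 / 2 * u))) (Set.Ioi 0) := by
    by_contra hn
    rw [integral_undef hn] at h5
    have : 0 < (1 / (Real.pi * R ^ 2 / 2)) ^ (5 / 2 : ℝ) * Real.Gamma (5 / 2) :=
      mul_pos (by positivity) (Real.Gamma_pos_of_pos (by norm_num))
    linarith
  have hcongr : ∀ u ∈ Set.Ioi (0 : ℝ), R ^ 3 * (u ^ ((7 / 2 : ℝ) - 1) *
      Real.exp (-(Real.pi * R ^ 2 / 2 * u))) + R * (u ^ ((5 / 2 : ℝ) - 1) *
      Real.exp (-(Real.pi * R ^ 2 / 2 * u))) = 1 / √u * ((u ^ 3 * R ^ 3 + u ^ 2 * R) *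
      Real.exp (-(Real.pi * R ^ 2 / 2 * u))) := fun u hu => by
    have hu : 0 < u := hu
    have e7 : u ^ ((7 / 2 : ℝ) - 1) = 1 / √u * u ^ 3 := by
      rw [show (7 / 2 : ℝ) - 1 = -(1 / 2) + (3 : ℕ) by norm_num, Real.rpow_add_natCast hu.ne',
        Real.rpow_neg hu.le, ← Real.sqrt_eq_rpow, one_div]
    have e5 : u ^ ((5 / 2 : ℝ) - 1) = 1 / √u * u ^ 2 := by
      rw [show (5 / 2 : ℝ) - 1 = -(1 / 2) + (2 : ℕ) by norm_num, Real.rpow_add_natCast hu.ne',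
        Real.rpow_neg hu.le, ← Real.sqrt_eq_rpow, one_div]
    rw [e7, e5]; ring
  constructor
  · exact IntegrableOn.congr_fun ((i7.const_mul _).add (i5.const_mul _)) hcongr measurableSet_Ioi
  · rw [← setIntegral_congr_fun measurableSet_Ioi hcongr, integral_add (i7.const_mul _)
      (i5.const_mul _), integral_const_mul, integral_const_mul, h7, h5,
      rpow_inv_mul_sq hR 7 (by norm_num), rpow_inv_mul_sq hR 5 (by norm_num)]
    field_simp

/-- Integrated over `u`, the Gaussian bound becomes Gamma integrals of order `‖z‖⁻⁴`. This absolute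
summability is what permits exchanging the lattice sum and the `u` integral. -/
lemma summable_integral_norm_heatPair {L : Submodule ℤ E3} (hL : IsBravaisLattice L)
    (hvol : volume (wignerSeitz L) = 1) :
    Summable fun z : L => ∫ u in Set.Ioi 0, ‖heatPair L u z‖ := by
  obtain ⟨ρ, hρ, hQ⟩ := hL.exists_norm_le_of_mem_wignerSeitz
  set K := 2 * (27 * Real.pi ^ 3 * (2 * ρ) ^ 3) with hK
  refine summable_lattice_of_decay hL (R := 6 * (2 * ρ))
    (c := K * ((2 / Real.pi) ^ (7 / 2 : ℝ) * Real.Gamma (7 / 2) +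
        (2 / Real.pi) ^ (5 / 2 : ℝ) * Real.Gamma (5 / 2))) fun z hz => ?_
  have hz0 : 0 < ‖(z : E3)‖ := by linarith
  obtain ⟨hi, he⟩ := integral_gaussian_bound hz0
  rw [abs_of_nonneg (integral_nonneg fun _ => norm_nonneg _), mul_div_assoc, ← he,
    ← integral_const_mul]
  refine setIntegral_mono_on (setIntegral_heatPair hL z).1.norm (hi.const_mul _)
    measurableSet_Ioi fun u hu => ?_
  refine (abs_heatPair_le hL hvol hρ hQ hu hz).trans (le_of_eq ?_)
  rw [hK]; ring

/-- The theta function of a lattice. -/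
noncomputable def latticeTheta (L : Submodule ℤ E3) (u : ℝ) : ℝ :=
  ∑' z : L, Real.exp (-Real.pi * u * ‖(z : E3)‖ ^ 2)

lemma hasSum_latticeTheta {L : Submodule ℤ E3} (hL : IsBravaisLattice L) {u : ℝ} (hu : 0 < u) :
    HasSum (fun z : L => Real.exp (-Real.pi * u * ‖(z : E3)‖ ^ 2)) (latticeTheta L u) := by
  refine Summable.hasSum (summable_lattice_of_decay hL (R := 1)
    (c := 2 / (Real.pi * u) ^ 2) fun z hz => ?_)
  have hz0 : 0 < ‖(z : E3)‖ := by linarith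
  set a := Real.pi * u * ‖(z : E3)‖ ^ 2 with ha
  have ha0 : 0 < a := by positivity
  have h1 : a ^ 2 / 2 ≤ Real.exp a := by
    have := Real.quadratic_le_exp_of_nonneg ha0.le; linarith
  rw [abs_of_pos (Real.exp_pos _), show -Real.pi * u * ‖(z : E3)‖ ^ 2 = -a by rw [ha]; ring,
    Real.exp_neg]
  calc (Real.exp a)⁻¹ ≤ (a ^ 2 / 2)⁻¹ := by gcongr
    _ = _ := by rw [ha]; field_simp

lemma hasSum_heatPair {L : Submodule ℤ E3} (hL : IsBravaisLattice L)
    (hvol : volume (wignerSeitz L) = 1) {u : ℝ} (hu : 0 < u) :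
    HasSum (fun z : L => heatPair L u z)
      (1 / 2 * ((latticeTheta L u - 1) / √u - 1 / u ^ 2)) := by
  classical
  have hp : IsProbabilityMeasure (volume.restrict (wignerSeitz L)) := ⟨by simpa using hvol⟩
  have h1 : HasSum (fun z : L => ({0}ᶜ : Set E3).indicator (heat u) z)
      (1 / √u * latticeTheta L u - 1 / √u) := by
    refine (((hasSum_latticeTheta hL hu).mul_left (1 / √u)).sub
      (hasSum_ite_eq (0 : L) (1 / √u))).congr_fun ?_
    intro z
    rcases eq_or_ne z 0 with rfl | hz
    · simp
    · have : (z : E3) ∈ ({0}ᶜ : Set E3) := fun h => hz (Subtype.ext h)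
      rw [Set.indicator_of_mem this, if_neg hz, sub_zero, heat]
  have h2 : HasSum (fun z : L => heatCell L u z) (1 / u ^ 2) := by
    rw [← integral_heat hu]
    exact hL.hasSum_wignerSeitz (integrable_heat hu)
  have hm : Measurable (Function.uncurry fun (w y : E3) => heat u (w + y)) := by
    unfold heat Function.uncurry
    fun_prop
  have hw : ∀ y : E3, ∫ w, heat u (w + y) = 1 / u ^ 2 := fun y => by
    rw [integral_add_right_eq_self (heat u), integral_heat hu]
  have hprod := integrable_uncurry_of_nonneg (μ := (volume : Measure E3))
    (ν := volume.restrict (wignerSeitz L)) hm (fun _ _ => heat_nonneg _ _)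
    (.of_forall fun y => (integrable_heat hu).comp_add_right y)
    (by simp only [hw]; exact integrable_const _)
  -- Averaging over a cell of volume one preserves the total mass `1 / u ^ 2`, so the point-cell and
  -- cell-cell sums agree and their combination is `-1 / (2 * u ^ 2)`.
  have h3 : HasSum (fun z : L => ∫ x in wignerSeitz L, heatCell L u (z + x)) (1 / u ^ 2) := by
    have e : ∫ w, heatCell L u w = 1 / u ^ 2 := by
      unfold heatCell
      rw [integral_integral_swap hprod]
      simp_rw [hw]
      simp
    rw [← e]
    exact hL.hasSum_wignerSeitz hprod.integral_prod_left
  have h4 := ((h1.mul_left (1 / 2)).sub h2).add (h3.mul_left (1 / 2))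
  have e : 1 / 2 * ((latticeTheta L u - 1) / √u - 1 / u ^ 2) =
      1 / 2 * (1 / √u * latticeTheta L u - 1 / √u) - 1 / u ^ 2 + 1 / 2 * (1 / u ^ 2) := by ring
  rw [e]
  exact h4

lemma hasSum_jelliumPair_ewald {L : Submodule ℤ E3} (hL : IsBravaisLattice L)
    (hvol : volume (wignerSeitz L) = 1) :
    HasSum (fun z : L => jelliumPair L z)
      (∫ u in Set.Ioi 0, 1 / 2 * ((latticeTheta L u - 1) / √u - 1 / u ^ 2)) := by
  have := hL.countable
  have h := hasSum_integral_of_summable_integral_norm (μ := volume.restrict (Set.Ioi (0 : ℝ)))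
    (F := fun (z : L) u => heatPair L u z) (fun z => (setIntegral_heatPair hL z).1)
    (summable_integral_norm_heatPair hL hvol)
  simp only [(setIntegral_heatPair hL _).2] at h
  rwa [setIntegral_congr_fun measurableSet_Ioi
    fun u hu => (hasSum_heatPair hL hvol hu).tsum_eq] at h

/-- The Jellium energy of a lattice by Ewald's method. -/
theorem eJel_eq_integral {L : Submodule ℤ E3} (hL : IsBravaisLattice L)
    (hvol : volume (wignerSeitz L) = 1) (hq : NoQuadrupole L) :
    eJel L = 1 / 2 * ∫ u in Set.Ioi 0, ((latticeTheta L u - 1) / √u - 1 / u ^ 2) := by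
  rw [eJel_eq hL hvol (noDipole L) hq, ← integral_const_mul]
  exact (hasSum_jelliumPair hL hvol (noDipole L) hq).unique (hasSum_jelliumPair_ewald hL hvol)


/-! ### Theta functions -/

/-- The theta constant `∑ exp (-π t n²)`. -/
noncomputable def thetaThree (t : ℝ) : ℝ := ∑' n : ℤ, Real.exp (-Real.pi * t * n ^ 2)

/-- The theta constant `∑ exp (-π t (n + 1/2)²)`. -/
noncomputable def thetaTwo (t : ℝ) : ℝ := ∑' n : ℤ, Real.exp (-Real.pi * t * (n + 1 / 2) ^ 2)

/-- The theta constant `∑ (-1)ⁿ exp (-π t n²)`. -/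
noncomputable def thetaFour (t : ℝ) : ℝ :=
  ∑' n : ℤ, (-1 : ℝ) ^ n * Real.exp (-Real.pi * t * n ^ 2)

/-- A common majorant for the theta series: the subtracted `|n|` makes room for the half-integer
shift, as `(n + 1 / 2) ^ 2 ≥ n ^ 2 - |n|`. -/
lemma summable_exp_neg_quadratic {t : ℝ} (ht : 0 < t) :
    Summable fun n : ℤ => Real.exp (-Real.pi * (t * n ^ 2 - t * |(n : ℝ)|)) := by
  convert summable_pow_mul_jacobiTheta₂_term_bound (t / 2) ht 0 using 2 with n
  rw [pow_zero, one_mul, show 2 * (t / 2) * ((|n| : ℤ) : ℝ) = t * |(n : ℝ)| by push_cast; ring]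

lemma hasSum_thetaThree {t : ℝ} (ht : 0 < t) :
    HasSum (fun n : ℤ => Real.exp (-Real.pi * t * n ^ 2)) (thetaThree t) := by
  refine ((summable_exp_neg_quadratic ht).of_nonneg_of_le (fun _ => (Real.exp_pos _).le)
    fun n => Real.exp_le_exp.2 ?_).hasSum
  have : 0 ≤ Real.pi * (t * |(n : ℝ)|) := by positivity
  linarith

lemma hasSum_thetaTwo {t : ℝ} (ht : 0 < t) :
    HasSum (fun n : ℤ => Real.exp (-Real.pi * t * (n + 1 / 2) ^ 2)) (thetaTwo t) := by
  refine ((summable_exp_neg_quadratic ht).of_nonneg_of_le (fun _ => (Real.exp_pos _).le)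
    fun n => Real.exp_le_exp.2 ?_).hasSum
  have h1 : 0 ≤ Real.pi * t * (n + |(n : ℝ)|) := by
    have := neg_abs_le (n : ℝ)
    have : 0 ≤ n + |(n : ℝ)| := by linarith
    positivity
  have h2 : 0 ≤ Real.pi * t := by positivity
  linarith

lemma hasSum_thetaFour {t : ℝ} (ht : 0 < t) :
    HasSum (fun n : ℤ => (-1 : ℝ) ^ n * Real.exp (-Real.pi * t * n ^ 2)) (thetaFour t) := by
  refine Summable.hasSum (Summable.of_norm ?_)
  simpa using (hasSum_thetaThree ht).summable

lemma thetaThree_eq {t : ℝ} (ht : 0 < t) : thetaThree t = 1 / √t * thetaThree (1 / t) := by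
  unfold thetaThree
  rw [Real.tsum_exp_neg_mul_int_sq ht, ← Real.sqrt_eq_rpow]
  simp only [mul_one_div]

lemma thetaFour_eq {t : ℝ} (ht : 0 < t) : thetaFour t = 1 / √t * thetaTwo (1 / t) := by
  -- In Poisson summation the imaginary shift `-i/2` gives the signs `(-1) ^ n` on one side and the
  -- half-integer shift on the other.
  have h := Complex.tsum_exp_neg_quadratic (a := t) (by simpa using ht) (-Complex.I / 2)
  have h1 : ∀ n : ℤ, Complex.exp (-Real.pi * t * n ^ 2 + 2 * Real.pi * (-Complex.I / 2) * n) =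
      (((-1 : ℝ) ^ n * Real.exp (-Real.pi * t * n ^ 2) : ℝ) : ℂ) := fun n => by
    rw [Complex.exp_add, show 2 * Real.pi * (-Complex.I / 2) * (n : ℂ) =
      n * (-(Real.pi * Complex.I)) by ring, Complex.exp_int_mul, Complex.exp_neg,
      Complex.exp_pi_mul_I]
    push_cast
    rw [mul_comm, show ((-1 : ℂ))⁻¹ = -1 by norm_num]
  have h2 : ∀ n : ℤ, Complex.exp (-Real.pi / t * (n + Complex.I * (-Complex.I / 2)) ^ 2) =
      ((Real.exp (-Real.pi * (1 / t) * (n + 1 / 2) ^ 2) : ℝ) : ℂ) := fun n => by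
    rw [show Complex.I * (-Complex.I / 2) = 1 / 2 by
      rw [neg_div, mul_neg, ← mul_div_assoc, Complex.I_mul_I]; norm_num]
    push_cast
    congr 1
    ring
  simp only [h1, h2] at h
  rw [show (1 / 2 : ℂ) = ((1 / 2 : ℝ) : ℂ) by norm_num, ← Complex.ofReal_cpow ht.le,
    ← Real.sqrt_eq_rpow] at h
  unfold thetaFour thetaTwo
  exact_mod_cast h

lemma thetaTwo_eq {t : ℝ} (ht : 0 < t) : thetaTwo t = 1 / √t * thetaFour (1 / t) := by
  rw [thetaFour_eq (one_div_pos.2 ht), one_div_one_div, ← mul_assoc, Real.sqrt_div zero_le_one,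
    Real.sqrt_one, one_div_one_div]
  have : √t ≠ 0 := (Real.sqrt_pos.2 ht).ne'
  field_simp

lemma HasSum.cube_of_nonneg {f : ℤ → ℝ} {s : ℝ} (h : HasSum f s) (h0 : 0 ≤ f) :
    HasSum (fun k : ℤ × ℤ × ℤ => f k.1 * (f k.2.1 * f k.2.2)) (s ^ 3) := by
  have h2 := h.mul h (h.summable.mul_of_nonneg h.summable h0 h0)
  have h20 : (0 : ℤ × ℤ → ℝ) ≤ fun x => f x.1 * f x.2 := fun x => mul_nonneg (h0 _) (h0 _)
  have h3 := h.mul h2 (h.summable.mul_of_nonneg h2.summable h0 h20)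
  rwa [show s ^ 3 = s * (s * s) by ring]

/-- A point of the body-centered cubic lattice, from its integer coordinates and the choice
of a sublattice. -/
noncomputable def bccPoint (e : ℤ) (k : ℤ × ℤ × ℤ) : E3 :=
  WithLp.toLp 2 fun i => bccScale * (2 * (![k.1, k.2.1, k.2.2] i : ℤ) + e)

lemma bccPoint_mem (e : ℤ) (k : ℤ × ℤ × ℤ) : bccPoint e k ∈ bcc :=
  mem_bcc_iff.2 ⟨_, e, fun _ => rfl⟩

lemma norm_sq_bccPoint (e : ℤ) (k : ℤ × ℤ × ℤ) : ‖bccPoint e k‖ ^ 2 = (2 * bccScale) ^ 2 *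
    ((k.1 + e / 2 : ℝ) ^ 2 + ((k.2.1 + e / 2 : ℝ) ^ 2 + (k.2.2 + e / 2 : ℝ) ^ 2)) := by
  rw [EuclideanSpace.norm_sq_eq, Fin.sum_univ_three]
  simp only [bccPoint, Real.norm_eq_abs, sq_abs]
  simp
  ring

lemma bccPoint_inj {e e' : ℤ} {k k' : ℤ × ℤ × ℤ} (h : bccPoint e k = bccPoint e' k') :
    2 * k.1 + e = 2 * k'.1 + e' ∧ 2 * k.2.1 + e = 2 * k'.2.1 + e' ∧
      2 * k.2.2 + e = 2 * k'.2.2 + e' := by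
  have hi : ∀ i : Fin 3, bccScale * (2 * (![k.1, k.2.1, k.2.2] i : ℤ) + e) =
      bccScale * (2 * (![k'.1, k'.2.1, k'.2.2] i : ℤ) + e') := fun i =>
    congrArg (fun x : E3 => x i) h
  have hj := fun i => mul_left_cancel₀ bccScale_pos.ne' (hi i)
  refine ⟨?_, ?_, ?_⟩
  · exact_mod_cast hj 0
  · exact_mod_cast hj 1
  · exact_mod_cast hj 2

/-- The lattice is the disjoint union of its even and odd points, two shifted cubic lattices; hence
the cubes of `thetaThree` and `thetaTwo` in `latticeTheta_bcc`. -/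
lemma bijective_bccPoint : Function.Bijective (Sum.elim
    (fun k => (⟨bccPoint 0 k, bccPoint_mem 0 k⟩ : bcc))
    (fun k => (⟨bccPoint 1 k, bccPoint_mem 1 k⟩ : bcc))) := by
  constructor
  · rintro (⟨a, b, c⟩ | ⟨a, b, c⟩) (⟨a', b', c'⟩ | ⟨a', b', c'⟩) h <;>
    · have h := bccPoint_inj (congrArg Subtype.val h)
      simp only at h
      first
        | (congr 1; simp only [Prod.mk.injEq]; omega)
        | (exfalso; omega)
  · rintro ⟨x, hx⟩
    obtain ⟨k, e, h⟩ := mem_bcc_iff.1 hx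
    rcases Int.emod_two_eq_zero_or_one e with he | he
    · refine ⟨.inl (k 0 + e / 2, k 1 + e / 2, k 2 + e / 2), Subtype.ext ?_⟩
      have h2 : (2 * (e / 2 : ℤ) : ℝ) = e := by exact_mod_cast (by omega : 2 * (e / 2) = e)
      ext i
      rw [h i]
      fin_cases i <;> simp [bccPoint] <;> left <;> linarith
    · refine ⟨.inr (k 0 + e / 2, k 1 + e / 2, k 2 + e / 2), Subtype.ext ?_⟩
      have h2 : (2 * (e / 2 : ℤ) : ℝ) + 1 = e := by exact_mod_cast (by omega : 2 * (e / 2) + 1 = e)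
      ext i
      rw [h i]
      fin_cases i <;> simp [bccPoint] <;> left <;> linarith

lemma latticeTheta_bcc {u : ℝ} (hu : 0 < u) :
    latticeTheta bcc u = thetaThree ((2 * bccScale) ^ 2 * u) ^ 3 +
      thetaTwo ((2 * bccScale) ^ 2 * u) ^ 3 := by
  have ht : 0 < (2 * bccScale) ^ 2 * u := by have := bccScale_pos; positivity
  have h3 := (hasSum_thetaThree ht).cube_of_nonneg fun _ => (Real.exp_pos _).le
  have h2 := (hasSum_thetaTwo ht).cube_of_nonneg fun _ => (Real.exp_pos _).le
  refine (hasSum_latticeTheta isBravaisLattice_bcc hu).unique ?_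
  rw [← (Equiv.ofBijective _ bijective_bccPoint).hasSum_iff]
  refine HasSum.sum (h3.congr_fun fun k => ?_) (h2.congr_fun fun k => ?_) <;>
  · simp only [Function.comp_apply, Equiv.ofBijective_apply, Sum.elim_inl, Sum.elim_inr]
    rw [norm_sq_bccPoint, ← Real.exp_add, ← Real.exp_add]
    congr 1
    push_cast
    ring

/-! ### Expansions of the theta constants -/

lemma exp_neg_pi_le {t : ℝ} (ht : 1 ≤ t) : Real.exp (-Real.pi * t) ≤ 1 / 20 := by
  have h1 : Real.exp (-Real.pi * t) ≤ Real.exp (-3) :=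
    Real.exp_le_exp.2 (by nlinarith [Real.pi_gt_three])
  have h2 : (20 : ℝ) ≤ Real.exp 3 := by
    rw [show (3 : ℝ) = (3 : ℕ) * 1 by norm_num, Real.exp_nat_mul]
    calc (20 : ℝ) ≤ 2.718 ^ 3 := by norm_num
      _ ≤ _ := by gcongr; linarith [Real.exp_one_gt_d9]
  refine h1.trans ?_
  rw [Real.exp_neg, ← one_div]
  exact one_div_le_one_div_of_le (by norm_num) h2

lemma exp_neg_pi_pow (t : ℝ) (n : ℕ) :
    Real.exp (-Real.pi * t) ^ n = Real.exp (-Real.pi * n * t) := by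
  rw [← Real.exp_nat_mul]; congr 1; ring

lemma abs_hasSum_le_of_pow {q s : ℝ} (hq : 0 < q) (hq2 : q ≤ 1 / 20) {f : ℕ → ℝ} {m : ℕ}
    (h : HasSum f s) (hf : ∀ n, |f n| ≤ 2 * q ^ (m + n)) : |s| ≤ 3 * q ^ m := by
  have hg := (hasSum_geometric_of_lt_one hq.le (by linarith : q < 1)).mul_left (2 * q ^ m)
  have h1 : |s| ≤ 2 * q ^ m * (1 - q)⁻¹ :=
    h.norm_le_of_bounded hg fun n => (hf n).trans (le_of_eq (by ring))
  have h2 : (1 - q)⁻¹ ≤ 3 / 2 := by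
    rw [inv_le_comm₀ (by linarith) (by norm_num)]; norm_num; linarith
  refine h1.trans ?_
  have : 0 < q ^ m := by positivity
  nlinarith

lemma exists_thetaThree_eq {t : ℝ} (ht : 1 ≤ t) : ∃ τ, thetaThree t =
    1 + 2 * Real.exp (-Real.pi * t) + 2 * Real.exp (-Real.pi * t) ^ 4 + τ ∧ 0 ≤ τ ∧
      τ ≤ 3 * Real.exp (-Real.pi * t) ^ 9 := by
  have hq2 := exp_neg_pi_le ht
  have hq : 0 < Real.exp (-Real.pi * t) := Real.exp_pos _
  have h := (hasSum_thetaThree (by linarith : 0 < t)).nat_add_neg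
  have e : ∀ n : ℕ, Real.exp (-Real.pi * t * ((n : ℤ) : ℝ) ^ 2) +
      Real.exp (-Real.pi * t * ((-(n : ℤ) : ℤ) : ℝ) ^ 2) =
      2 * Real.exp (-Real.pi * t) ^ (n ^ 2) := fun n => by
    rw [← Real.exp_nat_mul]
    push_cast
    rw [neg_sq, mul_comm (-Real.pi * t)]
    ring
  set q := Real.exp (-Real.pi * t)
  simp only [e] at h
  -- Folding the series counts `n = 0` twice, so its sum is `thetaThree t + 1`. The terms `n = 0, 1,
  -- 2` are split off, and the tail starts at `q ^ 9`.
  have h3 := (hasSum_nat_add_iff' 3).2 h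
  have hb := abs_hasSum_le_of_pow (m := 9) hq hq2 h3 fun n => by
    rw [abs_of_pos (by positivity)]
    gcongr 2 * ?_
    exact pow_le_pow_of_le_one hq.le (by linarith) (by nlinarith)
  have h0 := h3.nonneg fun n => by positivity
  simp [Finset.sum_range_succ] at h0 hb
  exact ⟨_, by ring, sub_nonneg.2 h0, (le_abs_self _).trans hb⟩

lemma exists_thetaFour_eq {t : ℝ} (ht : 1 ≤ t) : ∃ τ, thetaFour t =
    1 - 2 * Real.exp (-Real.pi * t) + 2 * Real.exp (-Real.pi * t) ^ 4 + τ ∧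
      |τ| ≤ 3 * Real.exp (-Real.pi * t) ^ 9 := by
  have hq2 := exp_neg_pi_le ht
  have hq : 0 < Real.exp (-Real.pi * t) := Real.exp_pos _
  have h := (hasSum_thetaFour (by linarith : 0 < t)).nat_add_neg
  have e : ∀ n : ℕ, (-1 : ℝ) ^ (n : ℤ) * Real.exp (-Real.pi * t * ((n : ℤ) : ℝ) ^ 2) +
      (-1 : ℝ) ^ (-(n : ℤ)) * Real.exp (-Real.pi * t * ((-(n : ℤ) : ℤ) : ℝ) ^ 2) =
      (-1) ^ n * (2 * Real.exp (-Real.pi * t) ^ (n ^ 2)) := fun n => by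
    rw [← Real.exp_nat_mul, zpow_neg, zpow_natCast]
    push_cast
    rw [neg_sq, mul_comm (-Real.pi * t), ← inv_pow, show (-1 : ℝ)⁻¹ = -1 by norm_num]
    ring
  set q := Real.exp (-Real.pi * t)
  simp only [e] at h
  have h3 := (hasSum_nat_add_iff' 3).2 h
  have hb := abs_hasSum_le_of_pow (m := 9) hq hq2 h3 fun n => by
    rw [abs_mul, abs_pow, abs_neg, abs_one, one_pow, one_mul, abs_of_pos (by positivity)]
    gcongr 2 * ?_
    exact pow_le_pow_of_le_one hq.le (by linarith) (by nlinarith)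
  simp [Finset.sum_range_succ] at hb
  exact ⟨_, by ring, hb⟩

lemma exists_thetaTwo_eq {t : ℝ} (ht : 1 ≤ t) : ∃ σ, thetaTwo t =
    2 * Real.exp (-Real.pi * (1 / 4) * t) * (1 + Real.exp (-Real.pi * t) ^ 2 + σ) ∧ 0 ≤ σ ∧
      σ ≤ 3 * Real.exp (-Real.pi * t) ^ 6 := by
  have hq2 := exp_neg_pi_le ht
  have hq : 0 < Real.exp (-Real.pi * t) := Real.exp_pos _
  have hr : 0 < 2 * Real.exp (-Real.pi * (1 / 4) * t) := by positivity
  have h := (hasSum_thetaTwo (by linarith : 0 < t)).nat_add_neg_add_one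
  have e : ∀ n : ℕ, Real.exp (-Real.pi * t * (((n : ℤ) : ℝ) + 1 / 2) ^ 2) +
      Real.exp (-Real.pi * t * (((-((n : ℤ) + 1) : ℤ) : ℝ) + 1 / 2) ^ 2) =
      2 * Real.exp (-Real.pi * (1 / 4) * t) * Real.exp (-Real.pi * t) ^ (n ^ 2 + n) := fun n => by
    rw [← Real.exp_nat_mul, mul_assoc 2, ← Real.exp_add, two_mul]
    push_cast
    congr 2 <;> ring
  set q := Real.exp (-Real.pi * t)
  simp only [e] at h
  have h := h.mul_left (2 * Real.exp (-Real.pi * (1 / 4) * t))⁻¹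
  simp only [inv_mul_cancel_left₀ hr.ne'] at h
  -- The exponents `(n + 1 / 2) ^ 2 - 1 / 4 = n ^ 2 + n` are `0, 2, 6, ...`, so two terms are kept
  -- and the tail starts at `q ^ 6`.
  have h3 := (hasSum_nat_add_iff' 2).2 h
  have hb := abs_hasSum_le_of_pow (m := 6) hq hq2 h3 fun n => by
    rw [abs_of_pos (by positivity)]
    have h1 : q ^ ((n + 2) ^ 2 + (n + 2)) ≤ q ^ (6 + n) :=
      pow_le_pow_of_le_one hq.le (by linarith) (by nlinarith)
    have h2 : 0 < q ^ (6 + n) := by positivity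
    linarith
  have h0 := h3.nonneg fun n => by positivity
  refine ⟨_, ?_, h0, (le_abs_self _).trans hb⟩
  simp only [Finset.sum_range_succ, Finset.sum_range_zero]
  field_simp
  ring

lemma exp_quarter_cube (t : ℝ) :
    Real.exp (-Real.pi * (1 / 4) * t) ^ 3 = Real.exp (-Real.pi * (3 / 4) * t) := by
  rw [← Real.exp_nat_mul]; congr 1; push_cast; ring

lemma exp_three_quarters_mul (t : ℝ) : Real.exp (-Real.pi * (3 / 4) * t) *
    Real.exp (-Real.pi * t) ^ 2 = Real.exp (-Real.pi * (11 / 4) * t) := by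
  rw [← Real.exp_nat_mul, ← Real.exp_add]; congr 1; push_cast; ring

lemma thetaTwo_cube_bounds {t : ℝ} (ht : 1 ≤ t) :
    8 * Real.exp (-Real.pi * (3 / 4) * t) + 24 * Real.exp (-Real.pi * (11 / 4) * t) ≤
      thetaTwo t ^ 3 ∧
    thetaTwo t ^ 3 ≤
      8 * Real.exp (-Real.pi * (3 / 4) * t) + 24.8 * Real.exp (-Real.pi * (11 / 4) * t) := by
  obtain ⟨σ, h, h0, h1⟩ := exists_thetaTwo_eq ht
  have hq2 := exp_neg_pi_le ht
  rw [h, ← exp_three_quarters_mul, mul_pow, mul_pow, exp_quarter_cube]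
  have hq : 0 < Real.exp (-Real.pi * t) := Real.exp_pos _
  have hR : 0 < Real.exp (-Real.pi * (3 / 4) * t) := Real.exp_pos _
  set q := Real.exp (-Real.pi * t)
  set R := Real.exp (-Real.pi * (3 / 4) * t)
  obtain ⟨w, hw⟩ : ∃ w, w = q ^ 2 := ⟨_, rfl⟩
  have hw0 : 0 < w := by rw [hw]; positivity
  have hw1 : w ≤ 1 / 400 := by rw [hw]; nlinarith
  have hσ : σ ≤ 3 * w ^ 3 := by rw [hw, ← pow_mul]; exact h1
  have hσ2 : σ ≤ w / 1000 := by nlinarith [mul_pos hw0 hw0]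
  rw [← hw]
  have l : 1 + 3 * w ≤ (1 + w + σ) ^ 3 := by
    have : 0 ≤ w + σ := by linarith
    calc 1 + 3 * w ≤ 1 + 3 * (w + σ) := by linarith
      _ ≤ (1 + w + σ) ^ 3 := by nlinarith [pow_nonneg this 2, pow_nonneg this 3]
  have u : (1 + w + σ) ^ 3 ≤ 1 + 3.1 * w := by
    calc (1 + w + σ) ^ 3 ≤ (1 + 1.001 * w) ^ 3 := by
          apply pow_le_pow_left₀ (by linarith); linarith
      _ ≤ 1 + 3.1 * w := by nlinarith [mul_pos hw0 hw0, mul_pos (mul_pos hw0 hw0) hw0]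
  constructor <;> nlinarith

lemma thetaThree_cube_bounds {t : ℝ} (ht : 1 ≤ t) :
    6 * Real.exp (-Real.pi * 1 * t) + 12 * Real.exp (-Real.pi * 2 * t) +
      8 * Real.exp (-Real.pi * 3 * t) ≤ thetaThree t ^ 3 - 1 ∧
    thetaThree t ^ 3 - 1 ≤ 6 * Real.exp (-Real.pi * 1 * t) + 12 * Real.exp (-Real.pi * 2 * t) +
      8 * Real.exp (-Real.pi * 3 * t) + 20 * Real.exp (-Real.pi * 4 * t) := by
  obtain ⟨τ, h, h0, h1⟩ := exists_thetaThree_eq ht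
  have hq2 := exp_neg_pi_le ht
  have hq : 0 < Real.exp (-Real.pi * t) := Real.exp_pos _
  have e2 := exp_neg_pi_pow t 2
  have e3 := exp_neg_pi_pow t 3
  have e4 := exp_neg_pi_pow t 4
  push_cast at e2 e3 e4
  rw [h, mul_one, ← e2, ← e3, ← e4]
  set q := Real.exp (-Real.pi * t)
  have h4 : 0 < q ^ 4 := by positivity
  have h5 : q ^ 5 ≤ 1 := pow_le_one₀ hq.le (by linarith)
  have hτ : τ ≤ 3 * q ^ 4 := by nlinarith
  have hq4 : q ^ 4 ≤ 1 / 1000 := by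
    calc q ^ 4 ≤ (1 / 20) ^ 4 := by gcongr
      _ ≤ _ := by norm_num
  set v := q ^ 4
  have hv : 0 ≤ 2 * v + τ := by positivity
  constructor
  · calc _ = (1 + 2 * q) ^ 3 - 1 := by ring
      _ ≤ (1 + 2 * q + 2 * v + τ) ^ 3 - 1 := by gcongr ?_ ^ 3 - 1; linarith
  · calc (1 + 2 * q + 2 * v + τ) ^ 3 - 1 ≤ (1 + 2 * q + 5 * v) ^ 3 - 1 := by
          gcongr ?_ ^ 3 - 1; linarith
      _ = 6 * q + 12 * q ^ 2 + 8 * q ^ 3 +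
          v * (15 * (1 + 2 * q) ^ 2 + 75 * (1 + 2 * q) * v + 125 * v ^ 2) := by ring
      _ ≤ 6 * q + 12 * q ^ 2 + 8 * q ^ 3 + v * 20 := by
          gcongr
          calc 15 * (1 + 2 * q) ^ 2 + 75 * (1 + 2 * q) * v + 125 * v ^ 2
              ≤ 15 * (1 + 2 * (1 / 20)) ^ 2 + 75 * (1 + 2 * (1 / 20)) * (1 / 1000) +
                125 * (1 / 1000) ^ 2 := by gcongr
            _ ≤ 20 := by norm_num
      _ = _ := by ring

/-- The two constants are `1 + (p ± d) / 2` with `d` close to `4 * q` and `p` close to `4 * q ^ 4`.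
In the sum of cubes the odd powers of `d` cancel, leaving the main term `3 / 2 * d ^ 2`, close to
`24 * q ^ 2`. -/
lemma thetaThree_add_thetaFour_bounds {t : ℝ} (ht : 1 ≤ t) :
    24 * Real.exp (-Real.pi * 2 * t) ≤ thetaThree t ^ 3 + thetaFour t ^ 3 - 2 ∧
    thetaThree t ^ 3 + thetaFour t ^ 3 - 2 ≤
      24 * Real.exp (-Real.pi * 2 * t) + 100 * Real.exp (-Real.pi * 4 * t) := by
  obtain ⟨τ, h, h0, h1⟩ := exists_thetaThree_eq ht
  obtain ⟨τ', h', h1'⟩ := exists_thetaFour_eq ht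
  have hq2 := exp_neg_pi_le ht
  have hq : 0 < Real.exp (-Real.pi * t) := Real.exp_pos _
  have e2 := exp_neg_pi_pow t 2
  have e4 := exp_neg_pi_pow t 4
  push_cast at e2 e4
  rw [h, h', ← e2, ← e4]
  set q := Real.exp (-Real.pi * t)
  have h4 : 0 < q ^ 4 := by positivity
  have h2 : q ^ 4 ≤ q / 1000 := by
    have : q ^ 3 ≤ (1 / 20) ^ 3 := by gcongr
    nlinarith
  have h9 : 3 * q ^ 9 ≤ q ^ 4 / 100 := by
    have : q ^ 5 ≤ (1 / 20) ^ 5 := by gcongr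
    nlinarith
  obtain ⟨h1l, h1u⟩ := abs_le.1 h1'
  set v := q ^ 4 with hv
  obtain ⟨p, hp⟩ : ∃ p, p = 4 * v + τ + τ' := ⟨_, rfl⟩
  obtain ⟨d, hd⟩ : ∃ d, d = 4 * q + τ - τ' := ⟨_, rfl⟩
  have hx : 1 + 2 * q + 2 * v + τ = 1 + (p + d) / 2 := by rw [hp, hd]; ring
  have hy : 1 - 2 * q + 2 * v + τ' = 1 + (p - d) / 2 := by rw [hp, hd]; ring
  rw [hx, hy]
  have hid : (1 + (p + d) / 2) ^ 3 + (1 + (p - d) / 2) ^ 3 - 2 =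
      3 / 2 * d ^ 2 + p * (3 + 3 / 2 * p + p ^ 2 / 4 + 3 / 4 * d ^ 2) := by ring
  rw [hid]
  have hp0 : 3.9 * v ≤ p := by linarith
  have hp1 : p ≤ 4.1 * v := by linarith
  have hd0 : 4 * q - v / 50 ≤ d := by linarith
  have hd1 : d ≤ 4 * q + v / 50 := by linarith
  have hdn : 0 ≤ d := by linarith
  have hqv : q * v ≤ v / 20 := by nlinarith
  have hvv : v * v ≤ v := by nlinarith
  have hdl : 16 * q ^ 2 - v / 100 ≤ d ^ 2 :=
    calc 16 * q ^ 2 - v / 100 ≤ (4 * q - v / 50) ^ 2 := by linarith [sq_nonneg v]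
      _ ≤ d ^ 2 := pow_le_pow_left₀ (by linarith) hd0 2
  have hdu : d ^ 2 ≤ 16 * q ^ 2 + v / 10 :=
    calc d ^ 2 ≤ (4 * q + v / 50) ^ 2 := pow_le_pow_left₀ hdn hd1 2
      _ ≤ 16 * q ^ 2 + v / 10 := by linarith
  have hpn : 0 ≤ p := by linarith
  have hps : p ≤ 1 := by linarith
  constructor
  · have : 0 ≤ p * (3 / 2 * p + p ^ 2 / 4 + 3 / 4 * d ^ 2) := by positivity
    linarith
  · have : 3 + 3 / 2 * p + p ^ 2 / 4 + 3 / 4 * d ^ 2 ≤ 6 := by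
      have h1 : p ^ 2 ≤ 1 := pow_le_one₀ hpn hps
      have h2 : d ^ 2 ≤ 1 := pow_le_one₀ hdn (by linarith)
      linarith
    have := mul_le_mul_of_nonneg_left this hpn
    linarith

/-! ### The Ewald integral of the body-centered cubic lattice -/

lemma IntegrableOn.of_bounds {f l u : ℝ → ℝ} {s : Set ℝ} (hs : MeasurableSet s)
    (hf : AEStronglyMeasurable f (volume.restrict s)) (hl : IntegrableOn l s)
    (hu : IntegrableOn u s) (h : ∀ t ∈ s, l t ≤ f t ∧ f t ≤ u t) : IntegrableOn f s := by
  refine Integrable.mono' (hl.norm.add hu.norm) hf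
    (ae_restrict_of_forall_mem hs fun t ht => abs_le.2 ?_)
  obtain ⟨h1, h2⟩ := h t ht
  simp only [Pi.add_apply, Real.norm_eq_abs]
  have := neg_abs_le (l t)
  have := le_abs_self (u t)
  have := abs_nonneg (l t)
  have := abs_nonneg (u t)
  constructor <;> linarith

/-- The incomplete Gamma integral `∫_{t > 1} t^(-1/2) exp (-π c t)`. -/
noncomputable def expTail (c : ℝ) : ℝ :=
  ∫ t in Set.Ioi 1, 1 / √t * Real.exp (-Real.pi * c * t)

lemma sqrtInv_exp_eq {c : ℝ} (hc : 0 < c) :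
    IntegrableOn (fun t => 1 / √t * Real.exp (-Real.pi * c * t)) (Set.Ioi 0) ∧
      ∫ t in Set.Ioi 0, 1 / √t * Real.exp (-Real.pi * c * t) = 1 / √c := by
  have h := integrableOn_sq_inv_sqrt_mul_exp (Real.sqrt_pos.2 hc)
  have e : ∀ t, 1 / √t * Real.exp (-Real.pi * t * √c ^ 2) =
      1 / √t * Real.exp (-Real.pi * c * t) := fun t => by
    rw [Real.sq_sqrt hc.le]; ring_nf
  simpa only [e] using h

/-- Passing to the complement leaves an integral over `(0, 1]`, where the exponential series can be
integrated term by term. -/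
lemma expTail_eq {c : ℝ} (hc : 0 < c) :
    expTail c = 1 / √c - ∫ t in Set.Ioc 0 1, 1 / √t * Real.exp (-Real.pi * c * t) := by
  obtain ⟨hi, h⟩ := sqrtInv_exp_eq hc
  rw [← h, ← Set.Ioc_union_Ioi_eq_Ioi (zero_le_one' ℝ),
    setIntegral_union (Set.Ioc_disjoint_Ioi le_rfl) measurableSet_Ioi
      (hi.mono_set Set.Ioc_subset_Ioi_self) (hi.mono_set (Set.Ioi_subset_Ioi zero_le_one))]
  unfold expTail
  ring

lemma integrableOn_expTail {c : ℝ} (hc : 0 < c) :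
    IntegrableOn (fun t => 1 / √t * Real.exp (-Real.pi * c * t)) (Set.Ioi 1) :=
  (sqrtInv_exp_eq hc).1.mono_set (Set.Ioi_subset_Ioi zero_le_one)

lemma integral_one_div_sqrt : IntegrableOn (fun t : ℝ => 1 / √t) (Set.Ioc 0 1) ∧
    ∫ t in Set.Ioc (0 : ℝ) 1, 1 / √t = 2 := by
  have e : ∀ t ∈ Set.Ioc (0 : ℝ) 1, t ^ (-(1 / 2) : ℝ) = 1 / √t := fun t ht => by
    rw [Real.rpow_neg ht.1.le, ← Real.sqrt_eq_rpow, one_div]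
  constructor
  · refine IntegrableOn.congr_fun ?_ e measurableSet_Ioc
    exact (intervalIntegrable_iff_integrableOn_Ioc_of_le zero_le_one).1
      (intervalIntegral.intervalIntegrable_rpow' (by norm_num))
  · rw [← setIntegral_congr_fun measurableSet_Ioc e,
      ← intervalIntegral.integral_of_le zero_le_one, integral_rpow (.inl (by norm_num))]
    norm_num

lemma integral_one_div_sq : IntegrableOn (fun t : ℝ => 2 / t ^ 2) (Set.Ioi 1) ∧
    ∫ t in Set.Ioi (1 : ℝ), 2 / t ^ 2 = 2 := by
  have e : ∀ t ∈ Set.Ioi (1 : ℝ), 2 * t ^ (-2 : ℝ) = 2 / t ^ 2 := fun t ht => by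
    rw [Real.rpow_neg (zero_le_one.trans (le_of_lt ht))]
    norm_num [div_eq_mul_inv]
  constructor
  · exact IntegrableOn.congr_fun
      ((integrableOn_Ioi_rpow_of_lt (by norm_num) zero_lt_one).const_mul 2) e measurableSet_Ioi
  · rw [← setIntegral_congr_fun measurableSet_Ioi e, integral_const_mul,
      integral_Ioi_rpow_of_lt (by norm_num) zero_lt_one]
    norm_num

lemma integral_inv_sq_mul_exp_neg_div {c : ℝ} (hc : 0 < c) :
    IntegrableOn (fun t => 1 / t ^ 2 * Real.exp (-c / t)) (Set.Ioc 0 1) ∧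
    ∫ t in Set.Ioc 0 1, 1 / t ^ 2 * Real.exp (-c / t) = Real.exp (-c) / c := by
  have hi : IntegrableOn (fun t => 1 / t ^ 2 * Real.exp (-c / t)) (Set.Ioc 0 1) := by
    refine IntegrableOn.of_bounds measurableSet_Ioc (l := fun _ => 0) (u := fun _ => 2 / c ^ 2)
      (Measurable.aestronglyMeasurable (by fun_prop)) integrableOn_zero
      (integrableOn_const (by simp)) fun t ht => ⟨by positivity, ?_⟩
    have ht0 := ht.1
    have h1 : (c / t) ^ 2 / 2 ≤ Real.exp (c / t) := by
      have := Real.quadratic_le_exp_of_nonneg (div_pos hc ht0).le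
      have := div_pos hc ht0
      linarith
    rw [neg_div, Real.exp_neg]
    calc 1 / t ^ 2 * (Real.exp (c / t))⁻¹ ≤ 1 / t ^ 2 * ((c / t) ^ 2 / 2)⁻¹ := by gcongr
      _ = 2 / c ^ 2 := by field_simp
  refine ⟨hi, ?_⟩
  rw [← intervalIntegral.integral_of_le zero_le_one]
  have hlim : Tendsto (fun t : ℝ => Real.exp (-c / t) / c) (𝓝[>] 0) (𝓝 0) := by
    have h1 : Tendsto (fun t : ℝ => -c / t) (𝓝[>] 0) atBot := by
      simp only [div_eq_mul_inv]
      exact tendsto_inv_nhdsGT_zero.const_mul_atTop_of_neg (neg_lt_zero.2 hc)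
    simpa using (Real.tendsto_exp_atBot.comp h1).div_const c
  have hd : ∀ t : ℝ, 0 < t → HasDerivAt (fun t : ℝ => Real.exp (-c / t) / c)
      (1 / t ^ 2 * Real.exp (-c / t)) t := fun t ht => by
    have h1 := (((hasDerivAt_inv ht.ne').const_mul (-c)).exp).div_const c
    simp only [← div_eq_mul_inv (-c)] at h1
    refine HasDerivAt.congr_deriv h1 ?_
    field_simp
  have h := intervalIntegral.integral_eq_sub_of_hasDerivAt_of_tendsto (zero_lt_one' ℝ)
    (fun t ht => hd t ht.1) ((intervalIntegrable_iff_integrableOn_Ioc_of_le zero_le_one).2 hi)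
    hlim ((hd 1 one_pos).continuousAt.tendsto.mono_left nhdsWithin_le_nhds)
  rw [h]
  simp

/-- The integrand of the Ewald formula for the body-centered cubic lattice. -/
noncomputable def bccIntegrand (t : ℝ) : ℝ :=
  (thetaThree t ^ 3 + thetaTwo t ^ 3 - 1) / √t - 2 / t ^ 2

/-- Theta inversion for small `t`: the background term `2 / t ^ 2` cancels the leading `1 + 1` of
the two cubes, so only the integrable `1 / √t` and exponentially small terms survive. -/
lemma bccIntegrand_eq {t : ℝ} (ht : 0 < t) : bccIntegrand t =
    1 / t ^ 2 * (thetaThree (1 / t) ^ 3 + thetaFour (1 / t) ^ 3 - 2) - 1 / √t := by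
  unfold bccIntegrand
  rw [thetaThree_eq ht, thetaTwo_eq ht]
  have hs : 0 < √t := Real.sqrt_pos.2 ht
  have h2 : t ^ 2 = √t ^ 4 := by
    rw [show √t ^ 4 = (√t ^ 2) ^ 2 by ring, Real.sq_sqrt ht.le]
  rw [h2]
  field_simp
  ring

lemma bccIntegrand_comp {u : ℝ} (hu : 0 < u) :
    (latticeTheta bcc u - 1) / √u - 1 / u ^ 2 =
      2 * bccScale * bccIntegrand ((2 * bccScale) ^ 2 * u) := by
  have hs := bccScale_pos
  have h3 := bccScale_cube
  have hsu : 0 < √u := Real.sqrt_pos.2 hu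
  unfold bccIntegrand
  rw [latticeTheta_bcc hu, Real.sqrt_mul (by positivity), Real.sqrt_sq (by positivity)]
  have : 2 * bccScale * (2 / ((2 * bccScale) ^ 2 * u) ^ 2) = 1 / u ^ 2 := by
    rw [show ((2 * bccScale) ^ 2 * u) ^ 2 = 16 * bccScale ^ 3 * bccScale * u ^ 2 by ring, h3]
    field_simp
    norm_num
  rw [mul_sub, this]
  field_simp

lemma eJel_bcc_eq : 2 * (2 * bccScale) * eJel bcc = ∫ t in Set.Ioi 0, bccIntegrand t := by
  have hs := bccScale_pos
  rw [eJel_eq_integral isBravaisLattice_bcc volume_wignerSeitz_bcc noQuadrupole_bcc,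
    setIntegral_congr_fun measurableSet_Ioi fun u hu => bccIntegrand_comp hu,
    integral_const_mul, integral_comp_mul_left_Ioi bccIntegrand 0 (by positivity), mul_zero,
    smul_eq_mul]
  field_simp

lemma aestronglyMeasurable_bccIntegrand :
    AEStronglyMeasurable bccIntegrand (volume.restrict (Set.Ioi 0)) := by
  have h3 : AEStronglyMeasurable thetaThree (volume.restrict (Set.Ioi 0)) := by
    refine aestronglyMeasurable_of_tendsto_ae (atTop : Filter (Finset ℤ))
      (f := fun s t => ∑ n ∈ s, Real.exp (-Real.pi * t * n ^ 2))
      (fun s => Measurable.aestronglyMeasurable (by fun_prop)) ?_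
    exact ae_restrict_of_forall_mem measurableSet_Ioi fun u hu => hasSum_thetaThree hu
  have h2 : AEStronglyMeasurable thetaTwo (volume.restrict (Set.Ioi 0)) := by
    refine aestronglyMeasurable_of_tendsto_ae (atTop : Filter (Finset ℤ))
      (f := fun s t => ∑ n ∈ s, Real.exp (-Real.pi * t * (n + 1 / 2) ^ 2))
      (fun s => Measurable.aestronglyMeasurable (by fun_prop)) ?_
    exact ae_restrict_of_forall_mem measurableSet_Ioi fun u hu => hasSum_thetaTwo hu
  have hs : AEStronglyMeasurable (fun t : ℝ => (√t)⁻¹) (volume.restrict (Set.Ioi 0)) :=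
    Measurable.aestronglyMeasurable (by fun_prop)
  have hq : AEStronglyMeasurable (fun t : ℝ => 2 / t ^ 2) (volume.restrict (Set.Ioi 0)) :=
    Measurable.aestronglyMeasurable (by fun_prop)
  exact ((((h3.pow 3).add (h2.pow 3)).sub aestronglyMeasurable_const).mul hs).sub hq

lemma bccIntegrand_small_bounds :
    IntegrableOn bccIntegrand (Set.Ioc 0 1) ∧
    24 * (Real.exp (-(2 * Real.pi)) / (2 * Real.pi)) - 2 ≤ ∫ t in Set.Ioc 0 1, bccIntegrand t ∧
    ∫ t in Set.Ioc 0 1, bccIntegrand t ≤ 24 * (Real.exp (-(2 * Real.pi)) / (2 * Real.pi)) +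
      100 * (Real.exp (-(4 * Real.pi)) / (4 * Real.pi)) - 2 := by
  obtain ⟨i2, h2⟩ := integral_inv_sq_mul_exp_neg_div (c := 2 * Real.pi) (by positivity)
  obtain ⟨i4, h4⟩ := integral_inv_sq_mul_exp_neg_div (c := 4 * Real.pi) (by positivity)
  obtain ⟨is, hs⟩ := integral_one_div_sqrt
  have il : IntegrableOn (fun t => 24 * (1 / t ^ 2 * Real.exp (-(2 * Real.pi) / t)) - 1 / √t)
    (Set.Ioc 0 1) := (i2.const_mul 24).sub is
  have i24 : IntegrableOn (fun t => 24 * (1 / t ^ 2 * Real.exp (-(2 * Real.pi) / t)) +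
    100 * (1 / t ^ 2 * Real.exp (-(4 * Real.pi) / t))) (Set.Ioc 0 1) :=
    (i2.const_mul 24).add (i4.const_mul 100)
  have iu : IntegrableOn (fun t => 24 * (1 / t ^ 2 * Real.exp (-(2 * Real.pi) / t)) +
    100 * (1 / t ^ 2 * Real.exp (-(4 * Real.pi) / t)) - 1 / √t)
    (Set.Ioc 0 1) := i24.sub is
  have hb : ∀ t ∈ Set.Ioc (0 : ℝ) 1,
      24 * (1 / t ^ 2 * Real.exp (-(2 * Real.pi) / t)) - 1 / √t ≤ bccIntegrand t ∧
      bccIntegrand t ≤ 24 * (1 / t ^ 2 * Real.exp (-(2 * Real.pi) / t)) +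
        100 * (1 / t ^ 2 * Real.exp (-(4 * Real.pi) / t)) - 1 / √t := fun t ht => by
    obtain ⟨h1, h2⟩ := thetaThree_add_thetaFour_bounds (one_le_one_div ht.1 ht.2)
    rw [bccIntegrand_eq ht.1]
    rw [show -Real.pi * 2 * (1 / t) = -(2 * Real.pi) / t by ring] at h1 h2
    rw [show -Real.pi * 4 * (1 / t) = -(4 * Real.pi) / t by ring] at h2
    have h0 : 0 ≤ 1 / t ^ 2 := by positivity
    have := mul_le_mul_of_nonneg_left h1 h0
    have := mul_le_mul_of_nonneg_left h2 h0
    constructor <;> linarith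
  have hi := IntegrableOn.of_bounds measurableSet_Ioc
    (aestronglyMeasurable_bccIntegrand.mono_set Set.Ioc_subset_Ioi_self) il iu hb
  refine ⟨hi, ?_, ?_⟩
  · have := setIntegral_mono_on il hi measurableSet_Ioc fun t ht => (hb t ht).1
    rwa [integral_sub (i2.const_mul 24) is, integral_const_mul, h2, hs] at this
  · have := setIntegral_mono_on hi iu measurableSet_Ioc fun t ht => (hb t ht).2
    rwa [integral_sub i24 is,
      integral_add (i2.const_mul 24) (i4.const_mul 100), integral_const_mul, integral_const_mul,
      h2, h4, hs] at this

lemma integral_sum_expTail {n : ℕ} (a c : Fin n → ℝ) (hc : ∀ i, 0 < c i) :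
    IntegrableOn (fun t => ∑ i, a i * (1 / √t * Real.exp (-Real.pi * c i * t)) - 2 / t ^ 2)
      (Set.Ioi 1) ∧
    ∫ t in Set.Ioi 1, (∑ i, a i * (1 / √t * Real.exp (-Real.pi * c i * t)) - 2 / t ^ 2) =
      ∑ i, a i * expTail (c i) - 2 := by
  obtain ⟨iq, hq⟩ := integral_one_div_sq
  have hi : ∀ i ∈ Finset.univ, Integrable
      (fun t => a i * (1 / √t * Real.exp (-Real.pi * c i * t))) (volume.restrict (Set.Ioi 1)) :=
    fun i _ => (integrableOn_expTail (hc i)).const_mul (a i)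
  have hs := integrable_finsetSum _ hi
  refine ⟨hs.sub iq, ?_⟩
  rw [integral_sub hs iq, hq, integral_finsetSum _ hi]
  simp_rw [integral_const_mul]
  rfl

lemma bccIntegrand_large_bounds :
    IntegrableOn bccIntegrand (Set.Ioi 1) ∧
    8 * expTail (3 / 4) + 24 * expTail (11 / 4) + 6 * expTail 1 + 12 * expTail 2 +
      8 * expTail 3 - 2 ≤ ∫ t in Set.Ioi 1, bccIntegrand t ∧
    ∫ t in Set.Ioi 1, bccIntegrand t ≤ 8 * expTail (3 / 4) + 24.8 * expTail (11 / 4) +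
      6 * expTail 1 + 12 * expTail 2 + 8 * expTail 3 + 20 * expTail 4 - 2 := by
  obtain ⟨il, hl⟩ := integral_sum_expTail ![8, 24, 6, 12, 8] ![3 / 4, 11 / 4, 1, 2, 3]
    (by intro i; fin_cases i <;> norm_num)
  obtain ⟨iu, hu⟩ := integral_sum_expTail ![8, 24.8, 6, 12, 8, 20] ![3 / 4, 11 / 4, 1, 2, 3, 4]
    (by intro i; fin_cases i <;> norm_num)
  simp only [Fin.sum_univ_five, Fin.sum_univ_six] at il hl iu hu
  have hb : ∀ t ∈ Set.Ioi (1 : ℝ), _ ≤ bccIntegrand t ∧ bccIntegrand t ≤ _ := fun t ht => by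
    have ht : 1 < t := ht
    have h0 : 0 ≤ 1 / √t := by positivity
    obtain ⟨h1, h2⟩ := thetaThree_cube_bounds ht.le
    obtain ⟨h3, h4⟩ := thetaTwo_cube_bounds ht.le
    have e : bccIntegrand t = 1 / √t * (thetaThree t ^ 3 - 1 + thetaTwo t ^ 3) - 2 / t ^ 2 := by
      unfold bccIntegrand; ring
    rw [e]
    exact ⟨sub_le_sub_right (mul_le_mul_of_nonneg_left (add_le_add h1 h3) h0) _,
      sub_le_sub_right (mul_le_mul_of_nonneg_left (add_le_add h2 h4) h0) _⟩
  have il' := il.congr_fun (fun t _ => show _ = 1 / √t *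
    (6 * Real.exp (-Real.pi * 1 * t) + 12 * Real.exp (-Real.pi * 2 * t) +
      8 * Real.exp (-Real.pi * 3 * t) + (8 * Real.exp (-Real.pi * (3 / 4) * t) +
      24 * Real.exp (-Real.pi * (11 / 4) * t))) - 2 / t ^ 2 by simp; ring) measurableSet_Ioi
  have iu' := iu.congr_fun (fun t _ => show _ = 1 / √t *
    (6 * Real.exp (-Real.pi * 1 * t) + 12 * Real.exp (-Real.pi * 2 * t) +
      8 * Real.exp (-Real.pi * 3 * t) + 20 * Real.exp (-Real.pi * 4 * t) +
      (8 * Real.exp (-Real.pi * (3 / 4) * t) +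
      24.8 * Real.exp (-Real.pi * (11 / 4) * t))) - 2 / t ^ 2 by simp; ring) measurableSet_Ioi
  have hi := IntegrableOn.of_bounds measurableSet_Ioi
    (aestronglyMeasurable_bccIntegrand.mono_set (Set.Ioi_subset_Ioi zero_le_one)) il' iu' hb
  refine ⟨hi, ?_, ?_⟩
  · have := setIntegral_mono_on il hi measurableSet_Ioi fun t ht =>
      (le_of_eq (by simp; ring)).trans (hb t ht).1
    rw [hl] at this
    simpa using this
  · have := setIntegral_mono_on hi iu measurableSet_Ioi fun t ht =>
      (hb t ht).2.trans (le_of_eq (by simp; ring))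
    rw [hu] at this
    simpa using this

/-- The constant `-4` collects `-∫ 1/√t` over `(0, 1]` and `-∫ 2/t²` over `(1, ∞)`, each equal to
`-2`. -/
lemma eJel_bcc_bounds :
    8 * expTail (3 / 4) + 24 * expTail (11 / 4) + 6 * expTail 1 + 12 * expTail 2 +
      8 * expTail 3 + 24 * (Real.exp (-(2 * Real.pi)) / (2 * Real.pi)) - 4 ≤
        2 * (2 * bccScale) * eJel bcc ∧
    2 * (2 * bccScale) * eJel bcc ≤ 8 * expTail (3 / 4) + 24.8 * expTail (11 / 4) +
      6 * expTail 1 + 12 * expTail 2 + 8 * expTail 3 + 20 * expTail 4 +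
      24 * (Real.exp (-(2 * Real.pi)) / (2 * Real.pi)) +
      100 * (Real.exp (-(4 * Real.pi)) / (4 * Real.pi)) - 4 := by
  obtain ⟨i1, l1, u1⟩ := bccIntegrand_small_bounds
  obtain ⟨i2, l2, u2⟩ := bccIntegrand_large_bounds
  rw [eJel_bcc_eq, ← Set.Ioc_union_Ioi_eq_Ioi (zero_le_one' ℝ),
    setIntegral_union (Set.Ioc_disjoint_Ioi le_rfl) measurableSet_Ioi i1 i2]
  constructor <;> linarith

/-! ### Numerical values -/

lemma abs_exp_neg_sub_le {x : ℝ} {n : ℕ} (hx : 0 ≤ x) (hn : x / (n + 1) ≤ 1 / 2) :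
    |Real.exp (-x) - ∑ k ∈ Finset.range n, (-x) ^ k / (k ! : ℝ)| ≤ 2 * (x ^ n / (n ! : ℝ)) := by
  have h := Complex.exp_bound' (x := ((-x : ℝ) : ℂ)) (n := n) (by
    rw [Complex.norm_real, Real.norm_eq_abs, abs_neg, abs_of_nonneg hx]
    simpa using hn)
  rw [Complex.norm_real, Real.norm_eq_abs, abs_neg, abs_of_nonneg hx] at h
  rw [← Real.norm_eq_abs, ← Complex.norm_real]
  push_cast at h ⊢
  linarith

lemma integral_sqrtInv_mul_pow (k : ℕ) :
    IntegrableOn (fun t : ℝ => 1 / √t * t ^ k) (Set.Ioc 0 1) ∧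
      ∫ t in Set.Ioc (0 : ℝ) 1, 1 / √t * t ^ k = 2 / (2 * k + 1) := by
  have hk : (-1 : ℝ) < -(1 / 2) + (k : ℕ) := by
    have : (0 : ℝ) ≤ k := k.cast_nonneg
    linarith
  have e : ∀ t ∈ Set.Ioc (0 : ℝ) 1, t ^ (-(1 / 2) + (k : ℕ) : ℝ) = 1 / √t * t ^ k := fun t ht => by
    rw [Real.rpow_add_natCast ht.1.ne', Real.rpow_neg ht.1.le, ← Real.sqrt_eq_rpow, one_div]
  constructor
  · refine IntegrableOn.congr_fun ?_ e measurableSet_Ioc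
    exact (intervalIntegrable_iff_integrableOn_Ioc_of_le zero_le_one).1
      (intervalIntegral.intervalIntegrable_rpow' hk)
  · rw [← setIntegral_congr_fun measurableSet_Ioc e,
      ← intervalIntegral.integral_of_le zero_le_one, integral_rpow (.inl hk),
      Real.zero_rpow (by linarith), Real.one_rpow]
    have : (k : ℝ) + 1 / 2 ≠ 0 := by positivity
    rw [show -(1 / 2) + (k : ℝ) + 1 = k + 1 / 2 by ring]
    field_simp
    ring

lemma integral_sqrtInv_exp_bounds {x : ℝ} {n : ℕ} (hx : 0 ≤ x) (hn : x / (n + 1) ≤ 1 / 2) :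
    IntegrableOn (fun t => 1 / √t * Real.exp (-x * t)) (Set.Ioc 0 1) ∧
    |(∫ t in Set.Ioc 0 1, 1 / √t * Real.exp (-x * t)) -
      ∑ k ∈ Finset.range n, (-x) ^ k / (k ! : ℝ) * (2 / (2 * k + 1))| ≤
        4 * (x ^ n / (n ! : ℝ)) := by
  obtain ⟨is, hs⟩ := integral_one_div_sqrt
  have hterm : ∀ k ∈ Finset.range n, Integrable (fun t : ℝ => (-x) ^ k / (k ! : ℝ) *
      (1 / √t * t ^ k)) (volume.restrict (Set.Ioc 0 1)) :=
    fun k _ => (integral_sqrtInv_mul_pow k).1.const_mul _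
  have ip := integrable_finsetSum _ hterm
  have hp : ∫ t in Set.Ioc (0 : ℝ) 1, ∑ k ∈ Finset.range n,
      (-x) ^ k / (k ! : ℝ) * (1 / √t * t ^ k) =
      ∑ k ∈ Finset.range n, (-x) ^ k / (k ! : ℝ) * (2 / (2 * k + 1)) := by
    rw [integral_finsetSum _ hterm]
    exact Finset.sum_congr rfl fun k _ => by
      rw [integral_const_mul, (integral_sqrtInv_mul_pow k).2]
  have hb : ∀ t ∈ Set.Ioc (0 : ℝ) 1, |1 / √t * Real.exp (-x * t) -
      ∑ k ∈ Finset.range n, (-x) ^ k / (k ! : ℝ) * (1 / √t * t ^ k)| ≤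
      2 * (x ^ n / (n ! : ℝ)) * (1 / √t) := fun t ht => by
    have h0 : 0 ≤ 1 / √t := by positivity
    have ht0 := ht.1.le
    have hxt : x * t ≤ x := mul_le_of_le_one_right hx ht.2
    have h := abs_exp_neg_sub_le (x := x * t) (n := n) (by positivity)
      (le_trans (by gcongr) hn)
    have e : 1 / √t * Real.exp (-x * t) -
        ∑ k ∈ Finset.range n, (-x) ^ k / (k ! : ℝ) * (1 / √t * t ^ k) =
        1 / √t * (Real.exp (-(x * t)) - ∑ k ∈ Finset.range n, (-(x * t)) ^ k / (k ! : ℝ)) := by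
      rw [mul_sub, Finset.mul_sum, neg_mul]
      congr 1
      exact Finset.sum_congr rfl fun k _ => by rw [← neg_mul, mul_pow]; ring
    rw [e, abs_mul, abs_of_nonneg h0, mul_comm]
    gcongr
    refine h.trans ?_
    gcongr
  have ii : IntegrableOn (fun t => 1 / √t * Real.exp (-x * t)) (Set.Ioc 0 1) := by
    refine Integrable.mono' is (Measurable.aestronglyMeasurable (by fun_prop))
      (ae_restrict_of_forall_mem measurableSet_Ioc fun t ht => ?_)
    rw [Real.norm_eq_abs, abs_of_nonneg (by positivity)]
    have ht0 := ht.1.le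
    refine mul_le_of_le_one_right (by positivity) (Real.exp_le_one_iff.2 ?_)
    nlinarith
  refine ⟨ii, ?_⟩
  rw [← hp, ← integral_sub ii ip, ← Real.norm_eq_abs]
  refine (norm_integral_le_of_norm_le (is.const_mul _)
    (ae_restrict_of_forall_mem measurableSet_Ioc hb)).trans (le_of_eq ?_)
  rw [integral_const_mul, hs]
  ring

/-- Monotonicity in the exponent allows `π` to be replaced by a rational bound before any series is
evaluated. -/
lemma setIntegral_sqrtInv_exp_anti {x y : ℝ} (hx : 0 ≤ x) (hxy : x ≤ y) :
    ∫ t in Set.Ioc 0 1, 1 / √t * Real.exp (-y * t) ≤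
      ∫ t in Set.Ioc 0 1, 1 / √t * Real.exp (-x * t) := by
  have hn : ∀ z : ℝ, z / (⌈2 * z⌉₊ + 1) ≤ 1 / 2 := fun z => by
    rw [div_le_iff₀ (by positivity)]
    linarith [Nat.le_ceil (2 * z)]
  refine setIntegral_mono_on (integral_sqrtInv_exp_bounds (hx.trans hxy) (hn y)).1
    (integral_sqrtInv_exp_bounds hx (hn x)).1 measurableSet_Ioc fun t ht => ?_
  have ht0 := ht.1.le
  gcongr

lemma expTail_lower {c p : ℝ} (n : ℕ) (hc : 0 < c) (hp : 0 ≤ p) (hpi : p ≤ Real.pi)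
    (hn : c * p / (n + 1) ≤ 1 / 2) :
    1 / √c - (∑ k ∈ Finset.range n, (-(c * p)) ^ k / (k ! : ℝ) * (2 / (2 * k + 1)) +
      4 * ((c * p) ^ n / (n ! : ℝ))) ≤ expTail c := by
  have h1 := setIntegral_sqrtInv_exp_anti (x := c * p) (y := Real.pi * c) (by positivity)
    (by nlinarith)
  have h2 := (abs_le.1 (integral_sqrtInv_exp_bounds (x := c * p) (n := n) (by positivity) hn).2).2
  rw [expTail_eq hc]
  simp only [neg_mul] at h1 h2 ⊢
  linarith

lemma expTail_upper {c p : ℝ} (n : ℕ) (hc : 0 < c) (hpi : Real.pi ≤ p)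
    (hn : c * p / (n + 1) ≤ 1 / 2) :
    expTail c ≤ 1 / √c - (∑ k ∈ Finset.range n, (-(c * p)) ^ k / (k ! : ℝ) * (2 / (2 * k + 1)) -
      4 * ((c * p) ^ n / (n ! : ℝ))) := by
  have hp0 : 0 ≤ p := Real.pi_pos.le.trans hpi
  have h1 := setIntegral_sqrtInv_exp_anti (x := Real.pi * c) (y := c * p) (by positivity)
    (by nlinarith)
  have h2 := (abs_le.1 (integral_sqrtInv_exp_bounds (x := c * p) (n := n) (by positivity) hn).2).1
  rw [expTail_eq hc]
  simp only [neg_mul] at h1 h2 ⊢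
  linarith

lemma le_one_div_sqrt {x c : ℝ} (hc : 0 < c) (hx : 0 < x) (h : x ^ 2 * c ≤ 1) : x ≤ 1 / √c := by
  rw [le_one_div hx (Real.sqrt_pos.2 hc), Real.sqrt_le_left (by positivity), one_div, inv_pow,
    ← one_div, le_div_iff₀ (by positivity)]
  linarith

lemma one_div_sqrt_le {x c : ℝ} (hc : 0 < c) (hx : 0 < x) (h : 1 ≤ x ^ 2 * c) : 1 / √c ≤ x := by
  rw [one_div_le (Real.sqrt_pos.2 hc) hx, Real.le_sqrt' (by positivity), one_div, inv_pow,
    ← one_div, div_le_iff₀ (by positivity)]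
  linarith

lemma expTail_three_quarters : 0.034578 ≤ expTail (3 / 4) ∧ expTail (3 / 4) ≤ 0.0345793 := by
  constructor
  · refine le_trans ?_ (expTail_lower 20 (by norm_num) (by norm_num) Real.pi_gt_d6.le (by norm_num))
    have h := le_one_div_sqrt (x := 1.1547005) (c := 3 / 4) (by norm_num) (by norm_num)
      (by norm_num)
    refine le_trans ?_ (sub_le_sub_right h _)
    norm_num [Finset.sum_range_succ, Nat.factorial]
  · refine le_trans (expTail_upper 20 (by norm_num) Real.pi_lt_d6.le (by norm_num)) ?_
    have h := one_div_sqrt_le (x := 1.1547006) (c := 3 / 4) (by norm_num) (by norm_num)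
      (by norm_num)
    refine (sub_le_sub_right h _).trans ?_
    norm_num [Finset.sum_range_succ, Nat.factorial]

lemma expTail_one : 0.0121885 ≤ expTail 1 ∧ expTail 1 ≤ 0.0121893 := by
  constructor
  · refine le_trans ?_ (expTail_lower 22 (by norm_num) (by norm_num) Real.pi_gt_d6.le (by norm_num))
    norm_num [Finset.sum_range_succ, Nat.factorial]
  · refine le_trans (expTail_upper 22 (by norm_num) Real.pi_lt_d6.le (by norm_num)) ?_
    norm_num [Finset.sum_range_succ, Nat.factorial]

lemma expTail_two : 0.0002773 ≤ expTail 2 ∧ expTail 2 ≤ 0.0002782 := by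
  constructor
  · refine le_trans ?_ (expTail_lower 30 (by norm_num) (by norm_num) Real.pi_gt_d6.le (by norm_num))
    have h := le_one_div_sqrt (x := 0.7071067) (c := 2) (by norm_num) (by norm_num)
      (by norm_num)
    refine le_trans ?_ (sub_le_sub_right h _)
    norm_num [Finset.sum_range_succ, Nat.factorial]
  · refine le_trans (expTail_upper 30 (by norm_num) Real.pi_lt_d6.le (by norm_num)) ?_
    have h := one_div_sqrt_le (x := 0.7071068) (c := 2) (by norm_num) (by norm_num)
      (by norm_num)
    refine (sub_le_sub_right h _).trans ?_
    norm_num [Finset.sum_range_succ, Nat.factorial]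

lemma expTail_eleven_quarters :
    0.0000191 ≤ expTail (11 / 4) ∧ expTail (11 / 4) ≤ 0.0000199 := by
  constructor
  · refine le_trans ?_ (expTail_lower 38 (by norm_num) (by norm_num) Real.pi_gt_d6.le (by norm_num))
    have h := le_one_div_sqrt (x := 0.6030226) (c := 11 / 4) (by norm_num) (by norm_num)
      (by norm_num)
    refine le_trans ?_ (sub_le_sub_right h _)
    norm_num [Finset.sum_range_succ, Nat.factorial]
  · refine le_trans (expTail_upper 38 (by norm_num) Real.pi_lt_d6.le (by norm_num)) ?_
    have h := one_div_sqrt_le (x := 0.6030227) (c := 11 / 4) (by norm_num) (by norm_num)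
      (by norm_num)
    refine (sub_le_sub_right h _).trans ?_
    norm_num [Finset.sum_range_succ, Nat.factorial]

lemma expTail_three : 0.0000078 ≤ expTail 3 ∧ expTail 3 ≤ 0.0000086 := by
  constructor
  · refine le_trans ?_ (expTail_lower 40 (by norm_num) (by norm_num) Real.pi_gt_d6.le (by norm_num))
    have h := le_one_div_sqrt (x := 0.5773502) (c := 3) (by norm_num) (by norm_num)
      (by norm_num)
    refine le_trans ?_ (sub_le_sub_right h _)
    norm_num [Finset.sum_range_succ, Nat.factorial]
  · refine le_trans (expTail_upper 40 (by norm_num) Real.pi_lt_d6.le (by norm_num)) ?_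
    have h := one_div_sqrt_le (x := 0.5773503) (c := 3) (by norm_num) (by norm_num)
      (by norm_num)
    refine (sub_le_sub_right h _).trans ?_
    norm_num [Finset.sum_range_succ, Nat.factorial]

lemma expTail_four_le : expTail 4 ≤ 0.0000007 := by
  refine le_trans (expTail_upper 50 (by norm_num) Real.pi_lt_d6.le (by norm_num)) ?_
  have h := one_div_sqrt_le (x := 0.5) (c := 4) (by norm_num) (by norm_num) (by norm_num)
  refine (sub_le_sub_right h _).trans ?_
  norm_num [Finset.sum_range_succ, Nat.factorial]

lemma exp_neg_two_pi_bounds : 0.00186743 ≤ Real.exp (-(2 * Real.pi)) ∧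
    Real.exp (-(2 * Real.pi)) ≤ 0.00186745 := by
  constructor
  · refine le_trans ?_ (Real.exp_le_exp.2 (by linarith [Real.pi_lt_d6] :
      -6.283186 ≤ -(2 * Real.pi)))
    have h := (abs_le.1 (abs_exp_neg_sub_le (x := 6.283186) (n := 32) (by norm_num)
      (by norm_num))).1
    norm_num [Finset.sum_range_succ, Nat.factorial] at h ⊢
    linarith
  · refine le_trans (Real.exp_le_exp.2 (by linarith [Real.pi_gt_d6] :
      -(2 * Real.pi) ≤ -6.283184)) ?_
    have h := (abs_le.1 (abs_exp_neg_sub_le (x := 6.283184) (n := 32) (by norm_num)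
      (by norm_num))).2
    norm_num [Finset.sum_range_succ, Nat.factorial] at h ⊢
    linarith

lemma bccScale_bounds : 0.62996 ≤ bccScale ∧ bccScale ≤ 0.629961 ∧
    0.39685026 ≤ bccScale ^ 2 ∧ bccScale ^ 2 ≤ 0.39685027 := by
  have h := bccScale_cube
  have h0 := bccScale_pos
  have hl : 0.629960524 ≤ bccScale := by
    by_contra! hlt
    have : bccScale ^ 3 < 0.629960524 ^ 3 := by gcongr
    norm_num [h] at this
  have hu : bccScale ≤ 0.629960526 := by
    by_contra! hlt
    have : 0.629960526 ^ 3 < bccScale ^ 3 := by gcongr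
    norm_num [h] at this
  refine ⟨by linarith, by linarith, ?_, ?_⟩ <;> nlinarith

lemma eJel_bcc_mem : -1.444249 ≤ eJel bcc ∧ eJel bcc ≤ -1.444153 := by
  obtain ⟨l, u⟩ := eJel_bcc_bounds
  obtain ⟨l1, u1⟩ := expTail_three_quarters
  obtain ⟨l2, u2⟩ := expTail_one
  obtain ⟨l3, u3⟩ := expTail_two
  obtain ⟨l4, u4⟩ := expTail_eleven_quarters
  obtain ⟨l5, u5⟩ := expTail_three
  have u6 := expTail_four_le
  obtain ⟨l7, u7⟩ := exp_neg_two_pi_bounds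
  obtain ⟨ls, us, -, -⟩ := bccScale_bounds
  have hπl := Real.pi_gt_d6
  have hπu := Real.pi_lt_d6
  have e4 : Real.exp (-(4 * Real.pi)) = Real.exp (-(2 * Real.pi)) ^ 2 := by
    rw [← Real.exp_nat_mul]; congr 1; push_cast; ring
  have l8 : 0.00029715 ≤ Real.exp (-(2 * Real.pi)) / (2 * Real.pi) := by
    rw [le_div_iff₀ (by positivity)]; linarith
  have u8 : Real.exp (-(2 * Real.pi)) / (2 * Real.pi) ≤ 0.00029725 := by
    rw [div_le_iff₀ (by positivity)]; linarith
  have u9 : Real.exp (-(4 * Real.pi)) / (4 * Real.pi) ≤ 0.0000004 := by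
    rw [div_le_iff₀ (by positivity), e4]
    calc Real.exp (-(2 * Real.pi)) ^ 2 ≤ 0.00186745 ^ 2 := by gcongr
      _ ≤ _ := by linarith
  -- The sign decides which end of the enclosure of `bccScale` is the unfavorable one when dividing
  -- by it.
  have hneg : eJel bcc ≤ 0 := by nlinarith
  constructor <;> nlinarith

lemma integral_screenedCoulomb_bcc_mem : 0.4935018 ≤ ∫ y, screenedCoulomb bcc y ∧
    ∫ y, screenedCoulomb bcc y ≤ 0.4935023 := by
  rw [integral_screenedCoulomb isBravaisLattice_bcc volume_wignerSeitz_bcc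
    (integrable_screenedCoulomb isBravaisLattice_bcc volume_wignerSeitz_bcc (noDipole bcc)
      noQuadrupole_bcc), setIntegral_bcc_norm_sq_eq]
  obtain ⟨-, -, l, u⟩ := bccScale_bounds
  have hπl := Real.pi_gt_d6
  have hπu := Real.pi_lt_d6
  constructor
  · calc (0.4935018 : ℝ) ≤ 2 * 3.141592 / 3 * (19 / 32 * 0.39685026) := by norm_num
      _ ≤ _ := by gcongr
  · calc 2 * Real.pi / 3 * (19 / 32 * bccScale ^ 2)
        ≤ 2 * 3.141593 / 3 * (19 / 32 * 0.39685027) := by gcongr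
      _ ≤ _ := by norm_num

/-! ### Assembly of the theorem -/

theorem mainTheorem3 :
    (∀ L : Submodule ℤ E3, IsBravaisLattice L → volume (wignerSeitz L) = 1 →
      NoDipole L → NoQuadrupole L →
      -- the lattice state is a probability measure with one-body density `1` on the cell union
      (∀ C : Set E3, Bornology.IsBounded C → IsProbabilityMeasure (latticeState L C) ∧
        oneBodyDensity (latticeState L C) = volume.restrict (cellUnion L C)) ∧
      -- the Jellium energy per particle converges, to the usual expression
      (∀ (D : Set E3) (C : ℕ → Set E3), IsGrowingSequence C D →
        Tendsto (fun n => jelliumPerParticle L (C n)) atTop (𝓝 (eJel L))) ∧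
      Integrable (screenedCoulomb L) volume ∧
      Summable (fun x : {x : E3 // x ∈ L ∧ x ≠ 0} => screenedCoulomb L x) ∧
      eJel L = 1 / 2 * (∑' x : {x : E3 // x ∈ L ∧ x ≠ 0}, screenedCoulomb L x)
        - 1 / 2 * (∫ y in wignerSeitz L, 1 / ‖y‖) - 1 / 2 * (∫ y, screenedCoulomb L y) ∧
      -- the indirect energy per particle converges, to the Jellium energy plus the shift
      (∀ (D : Set E3) (C : ℕ → Set E3), IsGrowingSequence C D →
        Tendsto (fun n => indirectPerParticle L (C n)) atTop
          (𝓝 (eJel L + (∫ y, screenedCoulomb L y)))) ∧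
      -- the value of the shift
      Tendsto (fun k : E3 => (4 * Real.pi * (‖k‖ ^ 2)⁻¹ : ℂ) *
          (1 - (∫ x in wignerSeitz L, Complex.exp (-Complex.I * (⟪k, x⟫ : ℝ))))) (𝓝[≠] 0)
        (𝓝 (((∫ y, screenedCoulomb L y) : ℝ) : ℂ)) ∧
      (∫ y, screenedCoulomb L y) = 2 * Real.pi / 3 * (∫ x in wignerSeitz L, ‖x‖ ^ 2) ∧
      0 < (∫ y, screenedCoulomb L y) ∧
      eJel L < eJel L + (∫ y, screenedCoulomb L y)) ∧
    -- the body-centered cubic lattice is of this kind, with these numerical values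
    (IsBravaisLattice bcc ∧ volume (wignerSeitz bcc) = 1 ∧ NoDipole bcc ∧ NoQuadrupole bcc ∧
      |eJel bcc - (-1.4442)| < 0.00005 ∧
      |eJel bcc + (∫ y, screenedCoulomb bcc y) - (-0.9507)| < 0.00005) := by
 
  have hneb : ∀ L : Submodule ℤ E3, IsBravaisLattice L → volume (wignerSeitz L) = 1 →
      NoDipole L → NoQuadrupole L → 0 < ∫ y, screenedCoulomb L y := fun L hL hvol hd hq => by
    rw [integral_screenedCoulomb hL hvol (integrable_screenedCoulomb hL hvol hd hq)]
    have := integral_norm_sq_wignerSeitz_pos hL hvol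
    positivity
  refine ⟨fun L hL hvol hd hq => ?_, isBravaisLattice_bcc, volume_wignerSeitz_bcc, noDipole bcc,
    noQuadrupole_bcc, ?_, ?_⟩
  · have hpos := hneb L hL hvol hd hq
    have hW := integrable_screenedCoulomb hL hvol hd hq
    have hS := summable_screenedCoulomb hL hvol hd hq
    have hE := eJel_eq hL hvol hd hq
    have hI := integral_screenedCoulomb hL hvol hW
    refine ⟨fun C hC => latticeState_spec hL hvol hC, fun D C hC => ?_, hW,
      summable_screenedCoulomb_ne_zero hS, ?_, fun D C hC => ?_, ?_, hI, hpos, by linarith⟩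
    · rw [hE]
      exact tendsto_jelliumPerParticle hL hvol hd hq hC
    · rw [hE, tsum_screenedCoulomb hS]
      ring
    · exact tendsto_indirectPerParticle hL hvol hd hq hC
    · rw [hI]
      exact tendsto_fourier_shift hL hvol hd hq
  · obtain ⟨h1, h2⟩ := eJel_bcc_mem
    rw [abs_lt]
    constructor <;> linarith
  · obtain ⟨h1, h2⟩ := eJel_bcc_mem
    obtain ⟨h3, h4⟩ := integral_screenedCoulomb_bcc_mem
    rw [abs_lt]
    constructor <;> linarith
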